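/- For $\tau$ with $\operatorname{Im}\tau>0$ let $$\zeta(z;\tau)=\frac1z+\sum_{0\ne u\in\mathbb Z+\tau\mathbb Z}\Big(\frac1{z-u}+\frac1u+\frac z{u^2}\Big)$$ be the Weierstrass zeta function, $\eta_1=2\zeta(1/2;\tau)$, $\eta_2=2\zeta(\tau/2;\tau)$, and $\xi(x+y\tau;\tau)=x\,\eta_1+y\,\eta_2$ for $x,y\in\mathbb R$. **Parameters.** Fix $\tau$ with $\operatorname{Im}\tau>0$ and a bounded sequence $(q_k)_{k\in\mathbb Z}$ in $\mathbb C$ whose distance to $\mathbb Z+\tau\mathbb Z$ is bounded below by a positive constant independent of $k$. The parameters are a real number $t$ and $x=(a_k,b_k,v_k,\tau_k)_{k\in\mathbb Z}\in\ell^\infty(\mathbb Z,\mathbb C)^4$. The central value $\underline x$ of $x$ is given by $\underline a_k=-\frac12$, $\underline v_k=(-\operatorname{conj})^kq_k$, $\underline\tau_k=(-\operatorname{conj})^k\tau$, $\underline b_k=\frac12\xi(\underline v_k;\underline\tau_k)$, where $\operatorname{conj}$ is complex conjugation. **The surface.** Let $T_k=\mathbb C/(\mathbb Z+\tau_k\mathbb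 Z)$, let $0_k\in T_k$ be the class of $0$, and let $g_k(z)=a_k(\zeta(z;\tau_k)-\zeta(z-v_k;\tau_k))+b_k$. For small $\varepsilon>0$ and $x$ near $\underline x$, $1/g_k$ restricts to diffeomorphisms $z_k^+$ and $z_k^-$ from disjoint neighbourhoods of $v_k$ and of $0_k$ in $T_k$ onto the disk $D(0,2\varepsilon)$. Let $D_k^\pm=\{|z_k^\pm|<\varepsilon\}$ and $\Omega_k=T_k\setminus(\overline{D_k^+}\cup\overline{D_k^-})$. The surface $\Sigma[t,x]$ is obtained from the disjoint union of all $T_k$ as follows. If $t=0$, identify $v_k\in T_k$ with $0_{k+1}\in T_{k+1}$ for all $k$, which creates nodes. If $0<|t|<\varepsilon$, remove the disks $|z_k^\pm|\le t^2/\varepsilon$ and identify the annuli $t^2/\varepsilon<|z_k^+|<\varepsilon$ and $t^2/\varepsilon<|z_{k+1}^-|<\varepsilon$ by $z_k^+z_{k+1}^-=t^2$. Let $\alpha_k,\beta_k$ be the classes of $[0,1]$ and $[0,\tau_k]$ in $T_k$, represented by curves that avoid the removed disks (the nodes if $t=0$), and let $\gamma$ be the class of the circles $\partial D_k^-$. For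 $t=0$, a regular 1-form is a 1-form that is holomorphic away from the nodes and has at most simple poles at the nodes, with opposite residues on the two sides of each node. **The fixed domain.** Let $\mathbb T=\mathbb C/(\mathbb Z+i\mathbb Z)$ and $\psi_k:\mathbb T\to T_k$, $\psi_k(x+iy)=x+\tau_ky$. For $\varepsilon'>0$ let $\widetilde\Omega_k$ be $\mathbb T$ minus the closed disks of radius $\varepsilon'$ centred at $0$ and at the preimage of $\underline v_k$ under $\psi_k[\underline x]$. Put $\widetilde\Omega=\bigsqcup_k\widetilde\Omega_k$ and let $\psi=\psi_k$ on $\widetilde\Omega_k$. Let $C^0(\widetilde\Omega)$ be the Banach space of 1-forms $f_1\,dx+f_2\,dy$ on $\widetilde\Omega$ with $f_1,f_2$ bounded, continuous and complex valued, with the supremum over $\widetilde\Omega$ of the pointwise norm $|\eta(z)|=\sup_{X\in\mathbb C^*}|\eta(z)X|/|X|$. **Proposition.** For every sufficiently small $\varepsilon>0$, every $\varepsilon'>0$ that is sufficiently small depending on $\varepsilon$, and all $(t,x)$ in a neighbourhood of $(0,\underline x)$ in $\mathbb R\times\ell^\infty(\mathbb Z,\mathbb C)^4$, the surface $\Sigma[t,x]$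 is defined as above, $\psi$ maps $\widetilde\Omega$ into $\Sigma[t,x]$ (minus its nodes) with $\Omega_k\subset\psi_k(\widetilde\Omega_k)$ for all $k$, and: (a) there is a holomorphic (regular if $t=0$) 1-form $\omega[t,x]$ on $\Sigma[t,x]$ with imaginary periods on $\alpha_k$ and $\beta_k$ for all $k\in\mathbb Z$ and $\int_\gamma\omega[t,x]=2\pi i$; (b) at $t=0$, for all $k\in\mathbb Z$, $\omega[0,x]=\big(\zeta(z;\tau_k)-\zeta(z-v_k;\tau_k)-\xi(v_k;\tau_k)\big)\,dz$ in $T_k$; (c) the pullback $\psi^*\omega[t,x]$ lies in $C^0(\widetilde\Omega)$, and $(t,x)\mapsto\psi^*\omega[t,x]$ is a smooth ($C^\infty$) map from this neighbourhood to $C^0(\widetilde\Omega)$. -/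

import Mathlib

open Complex Set Filter Topology Metric
open scoped ENNReal ContDiff BoundedContinuousFunction

noncomputable section

namespace StackedTori

/-! ### Tori and Weierstrass functions -/

/-- The lattice `ℤ + τ ℤ`. -/
def latticeOf (τ : ℂ) : AddSubgroup ℂ := AddSubgroup.closure {1, τ}

/-- The torus `T_τ = ℂ / (ℤ + τ ℤ)`, with its quotient topology. -/
abbrev Torus (τ : ℂ) : Type := ℂ ⧸ latticeOf τ

/-- The projection `ℂ → T_τ`. -/
def toTorus (τ z : ℂ) : Torus τ := QuotientAddGroup.mk z

/-- The Weierstrass zeta function of `ℤ + τ ℤ`: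
`1/z + ∑_{u ≠ 0} (1/(z-u) + 1/u + z/u²)`, with `u = m + n τ`. -/
def wZeta (z τ : ℂ) : ℂ :=
  1 / z + ∑' p : {p : ℤ × ℤ // p ≠ 0},
    (1 / (z - ((p.1.1 : ℂ) + (p.1.2 : ℂ) * τ)) + 1 / ((p.1.1 : ℂ) + (p.1.2 : ℂ) * τ)
      + z / ((p.1.1 : ℂ) + (p.1.2 : ℂ) * τ) ^ 2)

/-- The quasi-period `η₁ = 2 ζ(1/2)`. -/
def eta1 (τ : ℂ) : ℂ := 2 * wZeta (1 / 2) τ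

/-- The quasi-period `η₂ = 2 ζ(τ/2)`. -/
def eta2 (τ : ℂ) : ℂ := 2 * wZeta (τ / 2) τ

/-- The real number `x` in `p = x + y τ`. -/
def coordX (p τ : ℂ) : ℝ := p.re - p.im / τ.im * τ.re

/-- The real number `y` in `p = x + y τ`. -/
def coordY (p τ : ℂ) : ℝ := p.im / τ.im

theorem coordX_add_coordY_mul (p τ : ℂ) (hτ : τ.im ≠ 0) :
    (coordX p τ : ℂ) + (coordY p τ : ℂ) * τ = p := by
  apply Complex.ext
  · simp [coordX, coordY]
  · simp [coordX, coordY, hτ]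

/-- `ξ(p; τ) = x η₁ + y η₂`, where `p = x + y τ`. -/
def wXi (p τ : ℂ) : ℂ := (coordX p τ : ℂ) * eta1 τ + (coordY p τ : ℂ) * eta2 τ

/-! ### Parameters -/

/-- The space `ℓ^∞` of bounded sequences of complex numbers indexed by `ℤ`. -/
abbrev Linf : Type := lp (fun _ : ℤ => ℂ) ∞

/-- The parameter space of all `x = (a, b, v, τ)`. -/
abbrev Params : Type := Linf × Linf × Linf × Linf

def Params.a (x : Params) (k : ℤ) : ℂ := x.1 k
def Params.b (x : Params) (k : ℤ) : ℂ := x.2.1 k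
def Params.v (x : Params) (k : ℤ) : ℂ := x.2.2.1 k
def Params.tau (x : Params) (k : ℤ) : ℂ := x.2.2.2 k

/-- The map `(-conj)^k`. Since `-conj` is an involution this is the identity for even `k` and
`z ↦ -conj z` for odd `k`. -/
def negConjPow (k : ℤ) (z : ℂ) : ℂ := if Even k then z else -(starRingEnd ℂ) z

theorem norm_negConjPow (k : ℤ) (z : ℂ) : ‖negConjPow k z‖ = ‖z‖ := by
  unfold negConjPow
  split_ifs <;> simp

theorem memLinf_of_bound (f : ℤ → ℂ) (C : ℝ) (h : ∀ k, ‖f k‖ ≤ C) :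
    Memℓp f ∞ := by
  refine memℓp_infty ⟨C, ?_⟩
  rintro _ ⟨k, rfl⟩
  exact h k

theorem norm_wXi_le (p τ : ℂ) :
    ‖wXi p τ‖ ≤ ‖p‖ * ((1 + |τ.im|⁻¹ * |τ.re|) * ‖eta1 τ‖ + |τ.im|⁻¹ * ‖eta2 τ‖) := by
  have h2 : |coordY p τ| ≤ ‖p‖ * |τ.im|⁻¹ := by
    unfold coordY
    rw [abs_div, div_eq_mul_inv]
    exact mul_le_mul_of_nonneg_right (Complex.abs_im_le_norm p) (by positivity)
  have h1 : |coordX p τ| ≤ ‖p‖ * (1 + |τ.im|⁻¹ * |τ.re|) := by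
    have e : coordX p τ = p.re - coordY p τ * τ.re := rfl
    rw [e]
    calc |p.re - coordY p τ * τ.re| ≤ |p.re| + |coordY p τ * τ.re| := abs_sub _ _
      _ ≤ ‖p‖ + ‖p‖ * |τ.im|⁻¹ * |τ.re| := by
          rw [abs_mul]
          exact add_le_add (Complex.abs_re_le_norm p)
            (mul_le_mul_of_nonneg_right h2 (abs_nonneg _))
      _ = _ := by ring
  calc ‖wXi p τ‖ ≤ ‖(coordX p τ : ℂ) * eta1 τ‖ + ‖(coordY p τ : ℂ) * eta2 τ‖ := norm_add_le _ _
    _ = |coordX p τ| * ‖eta1 τ‖ + |coordY p τ| * ‖eta2 τ‖ := by simp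
    _ ≤ ‖p‖ * (1 + |τ.im|⁻¹ * |τ.re|) * ‖eta1 τ‖ + ‖p‖ * |τ.im|⁻¹ * ‖eta2 τ‖ := by gcongr
    _ = _ := by ring

/-- The central values of `v`: `v_k = (-conj)^k q_k`. -/
def centralV (q : Linf) : Linf :=
  ⟨fun k => negConjPow k (q k), memLinf_of_bound _ ‖q‖ fun k => by
    rw [norm_negConjPow]; exact lp.norm_apply_le_norm (by simp) q k⟩

/-- The central values of `τ`: `τ_k = (-conj)^k τ`. -/
def centralTau (τ : ℂ) : Linf :=
  ⟨fun k => negConjPow k τ, memLinf_of_bound _ ‖τ‖ fun k => (norm_negConjPow k τ).le⟩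

/-- The central values of `a`: `a_k = -1/2`. -/
def centralA : Linf := ⟨fun _ => -1 / 2, memLinf_of_bound _ ‖(-1 / 2 : ℂ)‖ fun _ => le_rfl⟩

/-- The central values of `b`: `b_k = ξ(v_k; τ_k) / 2` at the central values of `v` and `τ`. -/
def centralB (q : Linf) (τ : ℂ) : Linf :=
  ⟨fun k => 1 / 2 * wXi (negConjPow k (q k)) (negConjPow k τ), by
    let M : ℂ → ℝ := fun σ =>
      (1 + |σ.im|⁻¹ * |σ.re|) * ‖eta1 σ‖ + |σ.im|⁻¹ * ‖eta2 σ‖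
    have hM : ∀ σ, 0 ≤ M σ := fun σ => by positivity
    refine memLinf_of_bound _ (1 / 2 * (‖q‖ * (M τ + M (-(starRingEnd ℂ) τ)))) fun k => ?_
    rw [norm_mul]
    have h0 : ‖(1 / 2 : ℂ)‖ = 1 / 2 := by norm_num
    rw [h0]
    refine mul_le_mul_of_nonneg_left ?_ (by norm_num)
    refine (norm_wXi_le _ _).trans ?_
    rw [norm_negConjPow]
    refine mul_le_mul (lp.norm_apply_le_norm (by simp) q k) ?_ (hM _) (norm_nonneg _)
    change M (negConjPow k τ) ≤ _
    unfold negConjPow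
    split_ifs
    · linarith [hM (-(starRingEnd ℂ) τ)]
    · linarith [hM τ]⟩

/-- The central value of the parameters `x = (a, b, v, τ)` determined by `τ` and by
representatives `q_k ∈ ℂ` of a configuration. -/
def central (q : Linf) (τ : ℂ) : Params := (centralA, centralB q τ, centralV q, centralTau τ)

/-- Uniform separation: the points `q_k` stay at distance at least `ϱ > 0` from `0` in the
torus `T_τ`. -/
def UniformlySeparated (q : Linf) (τ : ℂ) : Prop :=
  ∃ ϱ : ℝ, 0 < ϱ ∧ ∀ k : ℤ, ∀ u ∈ latticeOf τ, ϱ ≤ ‖q k - u‖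

/-! ### The noded surface `Σ[t, x]` -/

/-- The elliptic function `g_k(z) = a_k (ζ(z; τ_k) - ζ(z - v_k; τ_k)) + b_k`. -/
def gauss (x : Params) (k : ℤ) (z : ℂ) : ℂ :=
  x.a k * (wZeta z (x.tau k) - wZeta (z - x.v k) (x.tau k)) + x.b k

/-- The local complex coordinates `z_k^+ = 1/g_k` near `v_k` and `z_k^- = 1/g_k` near `0_k`, which
are diffeomorphisms from disjoint neighbourhoods of these points in `T_k` onto the disk
`D(0, 2ε)`. They are recorded through their inverses, lifted to `ℂ`: `plus k` (resp. `minus k`) is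
the inverse of `z_k^+` with value `v_k` at `0` (resp. of `z_k^-` with value `0` at `0`). On
`D(0, 2ε)` these inverses are uniquely determined by the conditions below. -/
structure NodeCoordinates (x : Params) (ε : ℝ) where
  plus : ℤ → ℂ → ℂ
  minus : ℤ → ℂ → ℂ
  plus_holomorphic : ∀ k, DifferentiableOn ℂ (plus k) (ball 0 (2 * ε))
  minus_holomorphic : ∀ k, DifferentiableOn ℂ (minus k) (ball 0 (2 * ε))
  plus_zero : ∀ k, plus k 0 = x.v k
  minus_zero : ∀ k, minus k 0 = 0
  inv_gauss_plus : ∀ k, ∀ w ∈ ball (0 : ℂ) (2 * ε), w ≠ 0 → (gauss x k (plus k w))⁻¹ = w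
  inv_gauss_minus : ∀ k, ∀ w ∈ ball (0 : ℂ) (2 * ε), w ≠ 0 → (gauss x k (minus k w))⁻¹ = w
  plus_injOn : ∀ k, InjOn (fun w => toTorus (x.tau k) (plus k w)) (ball 0 (2 * ε))
  minus_injOn : ∀ k, InjOn (fun w => toTorus (x.tau k) (minus k w)) (ball 0 (2 * ε))
  disjoint : ∀ k, Disjoint ((fun w => toTorus (x.tau k) (plus k w)) '' ball 0 (2 * ε))
    ((fun w => toTorus (x.tau k) (minus k w)) '' ball 0 (2 * ε))

variable {x : Params} {ε : ℝ}

/-- The union of the two closed disks `|z_k^±| ≤ r` in `T_k`. -/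
def closedDisks (c : NodeCoordinates x ε) (r : ℝ) (k : ℤ) : Set (Torus (x.tau k)) :=
  (fun w => toTorus (x.tau k) (c.plus k w)) '' closedBall 0 r ∪
    (fun w => toTorus (x.tau k) (c.minus k w)) '' closedBall 0 r

/-- The part of `T_k` used to build `Σ[t, x]`: all of `T_k` if `t = 0`, and `T_k` minus the two
disks `|z_k^±| ≤ t²/ε` if `t ≠ 0`. -/
def piece (c : NodeCoordinates x ε) (t : ℝ) (k : ℤ) : Set (Torus (x.tau k)) :=
  {p | t = 0 ∨ p ∉ closedDisks c (t ^ 2 / ε) k}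

/-- The identifications defining `Σ[t, x]`. If `t = 0`, the points `v_k ∈ T_k` and
`0_{k+1} ∈ T_{k+1}` are identified to a node; if `t ≠ 0`, the annuli `t²/ε < |z_k^+| < ε` and
`t²/ε < |z_{k+1}^-| < ε` are identified by `z_k^+ z_{k+1}^- = t²`. -/
inductive Glue (c : NodeCoordinates x ε) (t : ℝ) :
    (Σ k : ℤ, piece c t k) → (Σ k : ℤ, piece c t k) → Prop
  | node (ht : t = 0) (k : ℤ) (p : piece c t k) (p' : piece c t (k + 1))
      (hp : p.1 = toTorus (x.tau k) (x.v k)) (hp' : p'.1 = toTorus (x.tau (k + 1)) 0) :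
      Glue c t ⟨k, p⟩ ⟨k + 1, p'⟩
  | neck (ht : t ≠ 0) (k : ℤ) (p : piece c t k) (p' : piece c t (k + 1)) (w w' : ℂ)
      (hw : t ^ 2 / ε < ‖w‖ ∧ ‖w‖ < ε) (hw' : t ^ 2 / ε < ‖w'‖ ∧ ‖w'‖ < ε)
      (hww' : w * w' = (t : ℂ) ^ 2)
      (hp : p.1 = toTorus (x.tau k) (c.plus k w))
      (hp' : p'.1 = toTorus (x.tau (k + 1)) (c.minus (k + 1) w')) :
      Glue c t ⟨k, p⟩ ⟨k + 1, p'⟩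

/-- The Riemann surface `Σ[t, x]`, with nodes if `t = 0`. -/
def Surface (c : NodeCoordinates x ε) (t : ℝ) : Type := Quot (Glue c t)

/-- `Σ[t, x]` carries the quotient topology. -/
instance (c : NodeCoordinates x ε) (t : ℝ) : TopologicalSpace (Surface c t) :=
  inferInstanceAs (TopologicalSpace (Quot (Glue c t)))

/-- The preimage in `ℂ` of `T_k` minus the disks `|z_k^±| ≤ t²/ε`. For `t = 0` these disks are the
two points `v_k` and `0_k`, which are the nodes of `T_k`. -/
def chartDomain (c : NodeCoordinates x ε) (t : ℝ) (k : ℤ) : Set ℂ :=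
  {z | toTorus (x.tau k) z ∉ closedDisks c (t ^ 2 / ε) k}

/-- The canonical local parametrization `ℂ ⊇ chartDomain → T_k → Σ[t, x]`. For `k ∈ ℤ` these
holomorphic parametrizations cover `Σ[t, x]` minus its nodes and define its complex structure. -/
def chart (c : NodeCoordinates x ε) (t : ℝ) (k : ℤ) (z : chartDomain c t k) : Surface c t :=
  Quot.mk _ ⟨k, ⟨toTorus (x.tau k) z.1, Or.inr z.2⟩⟩

/-- A holomorphic 1-form on `Σ[t, x]`, regular if `t = 0`. It is given in the parametrization
`chart c t k` by `coeff k z dz`, where the `coeff k` are holomorphic and the local expressions agree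
under every holomorphic change of parameter `h`, that is, `coeff k z = coeff l (h z) h'(z)`. For `t = 0` it has at
most simple poles on both sides of each node, with opposite residues. -/
structure OneForm (c : NodeCoordinates x ε) (t : ℝ) where
  coeff : ℤ → ℂ → ℂ
  holomorphic : ∀ k, DifferentiableOn ℂ (coeff k) (chartDomain c t k)
  compatible : ∀ (k l : ℤ) (V : Set ℂ) (h : ℂ → ℂ), IsOpen V → DifferentiableOn ℂ h V →
    ∀ (hV : ∀ z ∈ V, z ∈ chartDomain c t k) (hV' : ∀ z ∈ V, h z ∈ chartDomain c t l),
    (∀ (z : ℂ) (hz : z ∈ V), chart c t k ⟨z, hV z hz⟩ = chart c t l ⟨h z, hV' z hz⟩) →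
    ∀ z ∈ V, coeff k z = coeff l (h z) * deriv h z
  regular : t = 0 → ∃ r : ℤ → ℂ, ∀ k,
    Tendsto (fun z => z * coeff k z) (𝓝[≠] 0) (𝓝 (r k)) ∧
    Tendsto (fun z => (z - x.v k) * coeff k z) (𝓝[≠] (x.v k)) (𝓝 (-r (k + 1)))

namespace OneForm

variable {c : NodeCoordinates x ε} {t : ℝ}

/-- The periods of `θ` along all `C¹` curves in the part of `T_k` contained in `Σ[t, x]` (minus
nodes) which lift to curves in `ℂ` from a point `z` to `z + u` are imaginary. For `u = 1` and
`u = τ_k` these are the representatives of `α_k` and `β_k`. -/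
def ImaginaryPeriod (θ : OneForm c t) (k : ℤ) (u : ℂ) : Prop :=
  ∀ γ : ℝ → ℂ, ContDiff ℝ 1 γ → (∀ s ∈ Icc (0 : ℝ) 1, γ s ∈ chartDomain c t k) →
    γ 1 = γ 0 + u → (∫ s in (0 : ℝ)..1, θ.coeff k (γ s) * deriv γ s).re = 0

/-- The integral of `θ` along the circle `∂D_k^-`, that is `|z_k^-| = ε` positively oriented in the
coordinate `z_k^-`. -/
def integralBoundaryDisk (θ : OneForm c t) (k : ℤ) : ℂ :=
  ∮ w in C(0, ε), θ.coeff k (c.minus k w) * deriv (c.minus k) w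

end OneForm

/-! ### The fixed domain and the pullback -/

/-- The lift `ℂ → ℂ`, `x + i y ↦ x + τ y`, of the diffeomorphism from the square torus to `T_τ`.
Being real linear, it is also its own differential. -/
def psi (τ z : ℂ) : ℂ := (z.re : ℂ) + τ * (z.im : ℂ)

/-- The inverse image of `v` under `psi τ`. -/
def psiInv (τ v : ℂ) : ℂ := (coordX v τ : ℂ) + Complex.I * (coordY v τ : ℂ)

theorem psi_psiInv (τ v : ℂ) (hτ : τ.im ≠ 0) : psi τ (psiInv τ v) = v := by
  have h := coordX_add_coordY_mul v τ hτ
  simp only [psi, psiInv]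
  simp only [Complex.add_re, Complex.add_im, Complex.mul_re, Complex.mul_im, Complex.I_re,
    Complex.I_im, Complex.ofReal_re, Complex.ofReal_im]
  simp only [zero_mul, mul_zero, one_mul, sub_zero, add_zero, zero_add]
  rw [mul_comm τ]
  exact h

/-- The domain `Ω̃_k`: the square torus minus the closed disks of radius `ε'` centred at `0` and at
the inverse image of `v_k`, for the reference value `x₀` of the parameters. -/
def fixedDomain (x₀ : Params) (ε' : ℝ) (k : ℤ) : Set (Torus Complex.I) :=
  (toTorus Complex.I '' closedBall 0 ε' ∪
    toTorus Complex.I '' closedBall (psiInv (x₀.tau k) (x₀.v k)) ε')ᶜ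

/-- The disjoint union `Ω̃` of the `Ω̃_k`. -/
abbrev FixedDomain (x₀ : Params) (ε' : ℝ) : Type := Σ k : ℤ, fixedDomain x₀ ε' k

/-- The Banach space `C⁰(Ω̃)` of bounded continuous (not necessarily holomorphic) 1-forms on `Ω̃`,
with the sup norm. A complex valued 1-form `f₁ dx + f₂ dy` at a point is a real linear map `ℂ → ℂ`,
and its norm is the operator norm. -/
abbrev FormSpace (x₀ : Params) (ε' : ℝ) : Type := FixedDomain x₀ ε' →ᵇ (ℂ →L[ℝ] ℂ)

/-- `η` is the pullback `ψ^* θ`. -/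
def IsPullback {c : NodeCoordinates x ε} {t : ℝ} {x₀ : Params} {ε' : ℝ}
    (η : FormSpace x₀ ε') (θ : OneForm c t) : Prop :=
  ∀ (k : ℤ) (z : ℂ) (hz : toTorus Complex.I z ∈ fixedDomain x₀ ε' k) (X : ℂ),
    η ⟨k, ⟨toTorus Complex.I z, hz⟩⟩ X = θ.coeff k (psi (x.tau k) z) * psi (x.tau k) X

end StackedTori

end

/-! At `t = 0` the form is explicit on each torus; for `t ≠ 0` it is obtained by solving a small
linear perturbation problem, uniformly in `k`. Near the nodes use the local parameter s with z = s
near 0 and z = v - s near v. Since ζ is odd, `g` is invariant under z ↦ v - z, so w = 1/g is the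
same function of s at both nodes.

Near a node the wanted form is ±dw/w, plus a part holomorphic in the whole disk, plus the
contribution of the adjacent torus. The latter is the holomorphic part at the other side of the
neck, pulled back by w ↦ t²/w, so it carries a factor t² on circles of fixed radius. The terms ±dw/w
match across the neck because w ↦ t²/w reverses the sign of dw/w and the two sides carry opposite
residues.

The unknowns are the holomorphic parts U on circles of radius r₂ around all nodes. The contribution
dΨ of the adjacent torus has a primitive Ψ on an annulus. Convolving Ψ over the circles with ζ,
which is a Cauchy kernel on the torus, gives a function outside the circles of radius r₁ and another
inside those of radius r₃; by Cauchy's formula on the annulus they differ by Ψ exactly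
(`NeckData.conv_eq`). The glued function has additive quasi-periods η₁S and η₂S, so its differential
is a form on the torus, and adding the constant `periodCorrection` makes the real parts of the
periods vanish. Real parts of periods are computed with log|σ|, a single-valued primitive of Re(ζ
dz); only the real part of Legendre's relation is needed (`NeckData.re_period_eq_zero`).

Requiring that U be the holomorphic part of the form so produced is a linear equation U = b + A(t,x)
U with A = 0 at the central value, because of the factor t². It is solved by inverting 1 - A
(`exists_neckSolutions`), and its solutions give forms which agree across the necks
(`NeckSolution.compatible`). The solution is as smooth in (t, x) as A and b.

For the latter, every kernel is a smooth function of finitely many variables: `t`, the parameters of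
two adjacent tori, and points of the plane. It is evaluated along families with values in a compact
set. Superposition with such a function is a smooth operator on bounded continuous functions
(`contDiffOn_superpos`), with estimates that are uniform in the index. The same theorem, with the
lattice as index set, gives the joint smoothness of ζ in z and τ. Finally, forms on the fixed domain
are lifted isometrically to bounded functions on a part of the plane, where the superposition
theorem applies. -/

noncomputable section

namespace StackedTori

set_option linter.unusedSectionVars false

/-! ### Superposition operators on bounded continuous functions -/

section Superposition

variable {𝕜 : Type*} [RCLike 𝕜] {I : Type*} [TopologicalSpace I]
  {E : Type} [NormedAddCommGroup E] [NormedSpace 𝕜 E] [NormedSpace ℝ E]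

open Classical in
/-- The superposition operator `φ ↦ F ∘ φ`, with value `0` where `F ∘ φ` is not bounded and
continuous. -/
def superpos {G : Type*} [NormedAddCommGroup G] (F : E → G) (φ : I →ᵇ E) : I →ᵇ G :=
  if h : Continuous (fun i => F (φ i)) ∧ ∃ C, ∀ i, ‖F (φ i)‖ ≤ C then
    BoundedContinuousFunction.ofNormedAddCommGroup _ h.1 _ h.2.choose_spec else 0

theorem superpos_apply {G : Type*} [NormedAddCommGroup G] {F : E → G} {W K : Set E}
    (hF : ContinuousOn F W) (hK : IsCompact K) (hKW : K ⊆ W) {φ : I →ᵇ E}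
    (hφ : ∀ i, φ i ∈ K) (i : I) : superpos F φ i = F (φ i) := by
  have h : Continuous (fun i => F (φ i)) ∧ ∃ C, ∀ i, ‖F (φ i)‖ ≤ C := by
    refine ⟨(hF.mono hKW).comp_continuous φ.continuous hφ, ?_⟩
    obtain ⟨C, hC⟩ := hK.exists_bound_of_continuousOn (hF.mono hKW)
    exact ⟨C, fun i => hC _ (hφ i)⟩
  rw [superpos, dif_pos h]
  rfl

/-- The function `i ↦ A i (h i)`. -/
def mulOpAux {G : Type*} [NormedAddCommGroup G] [NormedSpace 𝕜 G] (A : I →ᵇ (E →L[𝕜] G))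
    (h : I →ᵇ E) : I →ᵇ G :=
  BoundedContinuousFunction.ofNormedAddCommGroup (fun i => A i (h i))
    (A.continuous.clm_apply h.continuous) (‖A‖ * ‖h‖) fun i =>
      (A i).le_of_opNorm_le_of_le (A.norm_coe_le_norm i) (h.norm_coe_le_norm i)

theorem norm_mulOpAux_le {G : Type*} [NormedAddCommGroup G] [NormedSpace 𝕜 G]
    (A : I →ᵇ (E →L[𝕜] G)) (h : I →ᵇ E) : ‖mulOpAux A h‖ ≤ 1 * ‖A‖ * ‖h‖ := by
  rw [one_mul]
  exact BoundedContinuousFunction.norm_ofNormedAddCommGroup_le _ (by positivity) _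

/-- Bounded continuous families of operators act on bounded continuous functions. -/
def mulOp {G : Type*} [NormedAddCommGroup G] [NormedSpace 𝕜 G] :
    (I →ᵇ (E →L[𝕜] G)) →L[𝕜] ((I →ᵇ E) →L[𝕜] (I →ᵇ G)) :=
  LinearMap.mkContinuous₂
    (LinearMap.mk₂ 𝕜 (mulOpAux (𝕜 := 𝕜) (I := I) (E := E) (G := G))
      (fun A B h => BoundedContinuousFunction.ext fun i => by simp [mulOpAux])
      (fun c A h => BoundedContinuousFunction.ext fun i => by simp [mulOpAux])
      (fun A h h' => BoundedContinuousFunction.ext fun i => by simp [mulOpAux])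
      (fun c A h => BoundedContinuousFunction.ext fun i => by simp [mulOpAux])) 1
    norm_mulOpAux_le

@[simp] theorem mulOp_apply {G : Type*} [NormedAddCommGroup G] [NormedSpace 𝕜 G]
    (A : I →ᵇ (E →L[𝕜] G)) (h : I →ᵇ E) (i : I) : mulOp A h i = A i (h i) := rfl

/-- By compactness `F'` is uniformly continuous at the points of `K`, so the mean value inequality
on balls gives a remainder that is o(‖h‖) uniformly in the index. The larger compact set `K'`
contains the values of `φ + h`, so that `superpos F (φ + h)` is not the default value. -/
theorem hasFDerivAt_superpos {G : Type*} [NormedAddCommGroup G] [NormedSpace 𝕜 G] {F : E → G}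
    {F' : E → E →L[𝕜] G} {W K K' : Set E} (hW : IsOpen W)
    (hF : ∀ e ∈ W, HasFDerivAt F (F' e) e) (hF' : ContinuousOn F' W)
    (hK : IsCompact K) (hKW : K ⊆ W) (hK' : IsCompact K') (hKW' : K' ⊆ W) {r : ℝ} (hr : 0 < r)
    (hKK : ∀ e ∈ K, ∀ e', dist e' e < r → e' ∈ K')
    {φ : I →ᵇ E} (hφ : ∀ i, φ i ∈ K) :
    HasFDerivAt (superpos F) (mulOp (𝕜 := 𝕜) (superpos F' φ)) φ := by
  have hFc : ContinuousOn F W := fun e he => (hF e he).continuousAt.continuousWithinAt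
  rw [hasFDerivAt_iff_isLittleO_nhds_zero, Asymptotics.isLittleO_iff]
  intro c hc
  have hu := hK.uniformContinuousAt_of_continuousAt F'
    (fun e he => hF'.continuousAt (hW.mem_nhds (hKW he))) (dist_mem_uniformity hc)
  obtain ⟨d, hd, hdu⟩ := Metric.mem_uniformity_dist.1 hu
  have hd' : 0 < min d r := lt_min hd hr
  filter_upwards [ball_mem_nhds (0 : I →ᵇ E) hd'] with h hh
  rw [mem_ball_zero_iff] at hh
  rw [BoundedContinuousFunction.norm_le (by positivity)]
  intro i
  have hi : ‖h i‖ < min d r := (h.norm_coe_le_norm i).trans_lt hh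
  have hφh : ∀ j, (φ + h) j ∈ K' := fun j => by
    refine hKK _ (hφ j) _ ?_
    rw [BoundedContinuousFunction.add_apply, dist_self_add_left]
    exact ((h.norm_coe_le_norm j).trans_lt hh).trans_le (min_le_right _ _)
  simp only [BoundedContinuousFunction.sub_apply, mulOp_apply]
  rw [superpos_apply hFc hK' hKW' hφh, superpos_apply hFc hK hKW hφ, superpos_apply hF' hK hKW hφ]
  have hball : ∀ e ∈ ball (φ i) (min d r), HasFDerivWithinAt F (F' e) (ball (φ i) (min d r)) e :=
    fun e he => (hF e (hKW' (hKK _ (hφ i) _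
      ((mem_ball.1 he).trans_le (min_le_right _ _))))).hasFDerivWithinAt
  have key := Convex.norm_image_sub_le_of_norm_hasFDerivWithin_le' (𝕜 := 𝕜)
    (φ := F' (φ i)) (C := c) hball ?_ (convex_ball _ _) (mem_ball_self hd')
    (y := φ i + h i) (by simpa [mem_ball, dist_self_add_left] using hi)
  · rw [add_sub_cancel_left] at key
    refine key.trans ?_
    gcongr
    exact h.norm_coe_le_norm i
  · intro e he
    have := hdu (a := φ i) (b := e) (by
      rw [dist_comm]; exact (mem_ball.1 he).trans_le (min_le_left _ _)) (hφ i)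
    rw [← dist_eq_norm, dist_comm]
    exact this.le

theorem exists_compact_thickening [ProperSpace E] {W K : Set E} (hW : IsOpen W)
    (hK : IsCompact K) (hKW : K ⊆ W) :
    ∃ K', IsCompact K' ∧ K' ⊆ W ∧ ∃ r > 0, ∀ e ∈ K, ∀ e', dist e' e < r → e' ∈ K' := by
  obtain ⟨r, hr, h⟩ := hK.exists_cthickening_subset_open hW hKW
  exact ⟨cthickening r K, hK.cthickening, h, r, hr, fun e he e' hd =>
    mem_cthickening_of_dist_le e' e r K he hd.le⟩

/-- The derivative is a superposition operator of the same kind, with `fderiv 𝕜 F` in place of `F`,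
followed by the bounded linear map `mulOp`. This permits induction on `n`, over all target spaces
`G` at once. -/
theorem contDiffAt_superpos [ProperSpace E] (n : ℕ) : ∀ {G : Type} [NormedAddCommGroup G]
    [NormedSpace 𝕜 G] {F : E → G} {W K : Set E}, IsOpen W → ContDiffOn 𝕜 ∞ F W → IsCompact K →
    K ⊆ W → ∀ {φ : I →ᵇ E}, (∀ i, φ i ∈ K) → ContDiffAt 𝕜 n (superpos F) φ := by
  have main : ∀ {G : Type} [NormedAddCommGroup G] [NormedSpace 𝕜 G] {F : E → G} {W K : Set E},
      IsOpen W → ContDiffOn 𝕜 ∞ F W → IsCompact K → K ⊆ W → ∀ {φ : I →ᵇ E}, (∀ i, φ i ∈ K) →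
      ∃ u ∈ 𝓝 φ, ∀ φ' ∈ u,
        HasFDerivAt (superpos F) (mulOp (𝕜 := 𝕜) (superpos (fderiv 𝕜 F) φ')) φ' := by
    intro G _ _ F W K hW hF hK hKW φ hφ
    obtain ⟨K₁, hK₁, hKW₁, r₁, hr₁, h₁⟩ := exists_compact_thickening hW hK hKW
    obtain ⟨K₂, hK₂, hKW₂, r₂, hr₂, h₂⟩ := exists_compact_thickening hW hK₁ hKW₁
    refine ⟨ball φ r₁, ball_mem_nhds _ hr₁, fun φ' hφ' => ?_⟩
    refine hasFDerivAt_superpos hW (fun e he => ?_) ?_ hK₁ hKW₁ hK₂ hKW₂ hr₂ h₂ (fun i => ?_)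
    · exact ((hF.contDiffAt (hW.mem_nhds he)).differentiableAt (by simp)).hasFDerivAt
    · exact hF.continuousOn_fderiv_of_isOpen hW (by simp)
    · exact h₁ _ (hφ i) _
        ((BoundedContinuousFunction.dist_coe_le_dist i).trans_lt (mem_ball.1 hφ'))
  induction n with
  | zero =>
    intro G _ _ F W K hW hF hK hKW φ hφ
    obtain ⟨u, hu, h⟩ := main hW hF hK hKW hφ
    rw [Nat.cast_zero, contDiffAt_zero]
    exact ⟨u, hu, fun φ' hφ' => (h φ' hφ').continuousAt.continuousWithinAt⟩
  | succ n ih =>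
    intro G _ _ F W K hW hF hK hKW φ hφ
    rw [Nat.cast_succ, contDiffAt_succ_iff_hasFDerivAt]
    refine ⟨_, main hW hF hK hKW hφ, ?_⟩
    exact (mulOp (𝕜 := 𝕜) (I := I) (E := E) (G := G)).contDiff.contDiffAt.comp φ
      (ih hW (hF.fderiv_of_isOpen hW (by simp)) hK hKW hφ)

theorem contDiffOn_superpos [ProperSpace E] {G : Type} [NormedAddCommGroup G]
    [NormedSpace 𝕜 G] {F : E → G} {W : Set E} (hW : IsOpen W) (hF : ContDiffOn 𝕜 ∞ F W) :
    ContDiffOn 𝕜 ∞ (superpos F)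
      {φ : I →ᵇ E | ∃ K, IsCompact K ∧ K ⊆ W ∧ ∀ i, φ i ∈ K} := by
  rintro φ ⟨K, hK, hKW, hφ⟩
  refine ContDiffAt.contDiffWithinAt ?_
  rw [contDiffAt_infty]
  exact fun n => contDiffAt_superpos n hW hF hK hKW hφ

theorem isOpen_superpos_domain [ProperSpace E] {W : Set E} (hW : IsOpen W) :
    IsOpen {φ : I →ᵇ E | ∃ K, IsCompact K ∧ K ⊆ W ∧ ∀ i, φ i ∈ K} := by
  rw [Metric.isOpen_iff]
  rintro φ ⟨K, hK, hKW, hφ⟩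
  obtain ⟨K₁, hK₁, hKW₁, r₁, hr₁, h₁⟩ := exists_compact_thickening hW hK hKW
  exact ⟨r₁, hr₁, fun φ' hφ' => ⟨K₁, hK₁, hKW₁, fun i => h₁ _ (hφ i) _
    ((BoundedContinuousFunction.dist_coe_le_dist i).trans_lt (mem_ball.1 hφ'))⟩⟩

end Superposition

/-! ### Integral operators -/

section IntegralOperator

variable {X Y : Type*} [TopologicalSpace X] [FirstCountableTopology X] [TopologicalSpace Y]
  {A B : Type*} [NormedAddCommGroup A] [NormedSpace ℝ A] [NormedAddCommGroup B] [NormedSpace ℝ B]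

/-- The function `x ↦ ∫ K(x, θ) u(ν x, θ) dθ` on `[0, 2π]`. -/
def integralOpAux (ν : C(X, Y)) (K : (X × ℝ) →ᵇ (A →L[ℝ] B)) (u : (Y × ℝ) →ᵇ A) : X →ᵇ B :=
  BoundedContinuousFunction.ofNormedAddCommGroup
    (fun x => ∫ θ in (0 : ℝ)..2 * Real.pi, K (x, θ) (u (ν x, θ)))
    (by
      refine intervalIntegral.continuous_of_dominated_interval (bound := fun _ => ‖K‖ * ‖u‖)
        (fun x => ?_) (fun x => Eventually.of_forall fun θ _ => ?_) (by simp)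
        (Eventually.of_forall fun θ _ => ?_)
      · refine Continuous.aestronglyMeasurable ?_
        exact (K.continuous.comp (by fun_prop)).clm_apply (u.continuous.comp (by fun_prop))
      · exact (K (x, θ)).le_of_opNorm_le_of_le (K.norm_coe_le_norm _) (u.norm_coe_le_norm _)
      · exact (K.continuous.comp (by fun_prop)).clm_apply (u.continuous.comp (by fun_prop)))
    (2 * Real.pi * ‖K‖ * ‖u‖) fun x => by
      refine (intervalIntegral.norm_integral_le_of_norm_le_const (C := ‖K‖ * ‖u‖)
        fun θ _ => ?_).trans ?_
      · exact (K (x, θ)).le_of_opNorm_le_of_le (K.norm_coe_le_norm _) (u.norm_coe_le_norm _)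
      · rw [sub_zero, abs_of_nonneg Real.two_pi_pos.le]
        exact le_of_eq (by ring)

theorem intervalIntegrable_integralOp (ν : C(X, Y)) (K : (X × ℝ) →ᵇ (A →L[ℝ] B))
    (u : (Y × ℝ) →ᵇ A) (x : X) :
    IntervalIntegrable (fun θ => K (x, θ) (u (ν x, θ))) MeasureTheory.volume 0 (2 * Real.pi) :=
  ((K.continuous.comp (by fun_prop : Continuous fun θ : ℝ => (x, θ))).clm_apply
    (u.continuous.comp (by fun_prop : Continuous fun θ : ℝ => (ν x, θ)))).intervalIntegrable _ _

theorem norm_integralOpAux_le (ν : C(X, Y)) (K : (X × ℝ) →ᵇ (A →L[ℝ] B)) (u : (Y × ℝ) →ᵇ A) :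
    ‖integralOpAux ν K u‖ ≤ 2 * Real.pi * ‖K‖ * ‖u‖ :=
  BoundedContinuousFunction.norm_ofNormedAddCommGroup_le _ (by positivity) _

theorem integralOpAux_apply (ν : C(X, Y)) (K : (X × ℝ) →ᵇ (A →L[ℝ] B)) (u : (Y × ℝ) →ᵇ A)
    (x : X) : integralOpAux ν K u x = ∫ θ in (0 : ℝ)..2 * Real.pi, K (x, θ) (u (ν x, θ)) := rfl

/-- Integral operators, as a bounded bilinear function of the kernel and of the argument. -/
def integralOp (ν : C(X, Y)) :
    ((X × ℝ) →ᵇ (A →L[ℝ] B)) →L[ℝ] ((Y × ℝ) →ᵇ A) →L[ℝ] (X →ᵇ B) :=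
  LinearMap.mkContinuous₂
    (LinearMap.mk₂ ℝ (integralOpAux (A := A) (B := B) ν)
      (fun K K' u => BoundedContinuousFunction.ext fun x => by
        simpa [integralOpAux_apply] using intervalIntegral.integral_add
          (intervalIntegrable_integralOp ν K u x) (intervalIntegrable_integralOp ν K' u x))
      (fun c K u => BoundedContinuousFunction.ext fun x => by simp [integralOpAux_apply])
      (fun K u u' => BoundedContinuousFunction.ext fun x => by
        simpa [integralOpAux_apply] using intervalIntegral.integral_add
          (intervalIntegrable_integralOp ν K u x) (intervalIntegrable_integralOp ν K u' x))
      (fun c K u => BoundedContinuousFunction.ext fun x => by simp [integralOpAux_apply]))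
    (2 * Real.pi) (norm_integralOpAux_le ν)

theorem integralOp_apply (ν : C(X, Y)) (K : (X × ℝ) →ᵇ (A →L[ℝ] B)) (u : (Y × ℝ) →ᵇ A) (x : X) :
    integralOp ν K u x = ∫ θ in (0 : ℝ)..2 * Real.pi, K (x, θ) (u (ν x, θ)) := rfl

end IntegralOperator

/-! ### Smooth maps into a closed subspace -/

/-- The range of an isometric embedding of a complete space is closed, so a derivative of `ι ∘ f`
takes its values in the range and can be pulled back. The derivative of `f` is in turn detected by
the isometry `ι.postcomp` between operator spaces, which gives the induction. -/
theorem contDiffOn_of_linearIsometry_comp (n : ℕ) {P : Type} [NormedAddCommGroup P]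
    [NormedSpace ℝ P] {N : Set P} (hN : IsOpen N) : ∀ {G G' : Type} [NormedAddCommGroup G]
    [NormedSpace ℝ G] [CompleteSpace G] [NormedAddCommGroup G'] [NormedSpace ℝ G']
    (ι : G →ₗᵢ[ℝ] G') {f : P → G}, ContDiffOn ℝ n (fun p => ι (f p)) N → ContDiffOn ℝ n f N := by
  induction n with
  | zero =>
    intro G G' _ _ _ _ _ ι f h
    rw [Nat.cast_zero, contDiffOn_zero] at h ⊢
    exact ι.isometry.isEmbedding.isInducing.continuousOn_iff.2 h
  | succ n ih =>
    intro G G' _ _ _ _ _ ι f h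
    rw [Nat.cast_succ, contDiffOn_succ_iff_fderiv_of_isOpen hN] at h
    obtain ⟨hd, -, hc⟩ := h
    have key : ∀ p ∈ N, ∃ B : P →L[ℝ] G, HasFDerivAt f B p ∧
        ι.toContinuousLinearMap.comp B = fderiv ℝ (fun p => ι (f p)) p := by
      intro p hp
      have hA := (hd.differentiableAt (hN.mem_nhds hp)).hasFDerivAt
      set A := fderiv ℝ (fun p => ι (f p)) p
      have hr : ∀ x, A x ∈ LinearMap.range ι.toLinearMap := by
        intro x
        have hcl : IsClosed ((LinearMap.range ι.toLinearMap : Submodule ℝ G') : Set G') := by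
          have := ι.isometry.isClosedEmbedding.isClosed_range
          rwa [LinearMap.coe_range]
        -- The value `A x` is the limit of the difference quotients n (ι f(p + x/n) - ι f(p)), which
        -- lie in the range.
        refine hcl.mem_of_tendsto (hA.lim x (c := fun n : ℕ => (n : ℝ)) (l := atTop) ?_)
          (Eventually.of_forall fun n => ?_)
        · simpa using tendsto_natCast_atTop_atTop (R := ℝ)
        · exact ⟨(n : ℝ) • (f (p + (n : ℝ)⁻¹ • x) - f p), by simp⟩
      let B : P →L[ℝ] G := (ι.equivRange.symm.toContinuousLinearEquiv :
        LinearMap.range ι.toLinearMap →L[ℝ] G).comp (A.codRestrict _ hr)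
      have hB : ∀ x, ι (B x) = A x := fun x =>
        congrArg Subtype.val (ι.equivRange.apply_symm_apply ⟨A x, hr x⟩)
      refine ⟨B, ?_, ContinuousLinearMap.ext hB⟩
      rw [hasFDerivAt_iff_isLittleO] at hA ⊢
      refine Asymptotics.isLittleO_norm_left.1
        ((Asymptotics.isLittleO_norm_left.2 hA).congr_left fun q => ?_)
      rw [← hB, ← map_sub, ← map_sub, ι.norm_map]
    choose! B hB hBA using key
    rw [Nat.cast_succ, contDiffOn_succ_iff_fderiv_of_isOpen hN]
    refine ⟨fun p hp => (hB p hp).differentiableAt.differentiableWithinAt, by simp, ?_⟩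
    refine ih ι.postcomp (hc.congr fun p hp => ?_)
    rw [← hBA p hp, (hB p hp).fderiv]
    rfl

/-! ### Superposition with the parameters of the surface -/

/-- The finite-dimensional space of parameters of one torus. -/
abbrev TorusParams : Type := ℂ × ℂ × ℂ × ℂ

/-- The parameters `(a_k, b_k, v_k, τ_k)`. -/
def Params.pt (x : Params) (k : ℤ) : TorusParams := (x.a k, x.b k, x.v k, x.tau k)

theorem Params.norm_pt_le (x : Params) (k : ℤ) : ‖x.pt k‖ ≤ ‖x‖ := by
  have h (f : Linf) : ‖f k‖ ≤ ‖f‖ := lp.norm_apply_le_norm (by simp) f k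
  simp only [Params.pt, Prod.norm_def, Params.a, Params.b, Params.v, Params.tau]
  exact max_le_max (h _) (max_le_max (h _) (max_le_max (h _) (h _)))

section ParamFamily

variable {X : Type*} [TopologicalSpace X] {Y : Type} [NormedAddCommGroup Y]

theorem norm_paramFamily_le (p : ℝ × Params) (k₁ k₂ : ℤ) :
    ‖(p.1, p.2.pt k₁, p.2.pt k₂, (0 : Y))‖ ≤ ‖p‖ := by
  have h (k : ℤ) : ‖p.2.pt k‖ ≤ ‖p‖ := (p.2.norm_pt_le k).trans (norm_snd_le p)
  refine norm_prod_le_iff.2 ⟨norm_fst_le p, norm_prod_le_iff.2 ⟨h _, norm_prod_le_iff.2 ⟨h _, ?_⟩⟩⟩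
  rw [norm_zero]
  exact norm_nonneg _

/-- The family of parameters `(t, x_{k₁ i}, x_{k₂ i}, 0)` indexed by `i ∈ X`. -/
def paramFamilyAux (k₁ k₂ : C(X, ℤ)) (Y : Type) [NormedAddCommGroup Y] (p : ℝ × Params) :
    X →ᵇ ℝ × TorusParams × TorusParams × Y :=
  BoundedContinuousFunction.ofNormedAddCommGroup
    (fun i => (p.1, p.2.pt (k₁ i), p.2.pt (k₂ i), (0 : Y)))
    (by
      have h (k : C(X, ℤ)) : Continuous fun i => p.2.pt (k i) :=
        (continuous_of_discreteTopology (f := p.2.pt)).comp k.continuous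
      exact continuous_const.prodMk ((h k₁).prodMk ((h k₂).prodMk continuous_const))) ‖p‖
    fun i => norm_paramFamily_le p _ _

theorem paramFamilyAux_apply (k₁ k₂ : C(X, ℤ)) (p : ℝ × Params) (i : X) :
    paramFamilyAux k₁ k₂ Y p i = (p.1, p.2.pt (k₁ i), p.2.pt (k₂ i), 0) := rfl

theorem norm_paramFamilyAux_le (k₁ k₂ : C(X, ℤ)) (p : ℝ × Params) :
    ‖paramFamilyAux k₁ k₂ Y p‖ ≤ 1 * ‖p‖ := by
  rw [one_mul]
  exact BoundedContinuousFunction.norm_ofNormedAddCommGroup_le _ (norm_nonneg _) _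

/-- `paramFamilyAux` as a bounded linear map. -/
def paramFamily (k₁ k₂ : C(X, ℤ)) (Y : Type) [NormedAddCommGroup Y] [NormedSpace ℝ Y] :
    (ℝ × Params) →L[ℝ] (X →ᵇ ℝ × TorusParams × TorusParams × Y) :=
  LinearMap.mkContinuous
    { toFun := paramFamilyAux k₁ k₂ Y
      map_add' := fun p q => BoundedContinuousFunction.ext fun i => by
        simp [paramFamilyAux_apply, Params.pt, Params.a, Params.b, Params.v, Params.tau]
      map_smul' := fun c p => BoundedContinuousFunction.ext fun i => by
        simp [paramFamilyAux_apply, Params.pt, Params.a, Params.b, Params.v, Params.tau] } 1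
    fun p => norm_paramFamilyAux_le k₁ k₂ p

theorem paramFamily_apply [NormedSpace ℝ Y] (k₁ k₂ : C(X, ℤ)) (p : ℝ × Params) (i : X) :
    paramFamily k₁ k₂ Y p i = (p.1, p.2.pt (k₁ i), p.2.pt (k₂ i), 0) := rfl

/-- The common source of smooth dependence on (t, x): the family of arguments is affine in (t, x),
and `F` is applied by a superposition operator. Compactness of `K` supplies the uniformity in `k`.
Two index maps are needed because a neck involves the parameters of two adjacent tori. -/
theorem exists_smooth_superposition [NormedSpace ℝ Y] [ProperSpace Y] {G : Type} [NormedAddCommGroup G]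
    [NormedSpace ℝ G] (k₁ k₂ : C(X, ℤ)) (y : X → Y) (hy : Continuous y)
    {F : ℝ × TorusParams × TorusParams × Y → G}
    {W K : Set (ℝ × TorusParams × TorusParams × Y)} (hW : IsOpen W) (hF : ContDiffOn ℝ ∞ F W)
    (hK : IsCompact K) (hKW : K ⊆ W) (x₀ : Params)
    (h : ∀ i, (0, x₀.pt (k₁ i), x₀.pt (k₂ i), y i) ∈ K) :
    ∃ (Φ : ℝ × Params → (X →ᵇ G)) (N : Set (ℝ × Params)), IsOpen N ∧ (0, x₀) ∈ N ∧
      ContDiffOn ℝ ∞ Φ N ∧ ∀ p ∈ N, ∀ i, (p.1, p.2.pt (k₁ i), p.2.pt (k₂ i), y i) ∈ W ∧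
        Φ p i = F (p.1, p.2.pt (k₁ i), p.2.pt (k₂ i), y i) := by
  obtain ⟨C, hC⟩ := hK.isBounded.exists_norm_le
  let y' : X →ᵇ ℝ × TorusParams × TorusParams × Y :=
    BoundedContinuousFunction.ofNormedAddCommGroup (fun i => (0, 0, 0, y i)) (by fun_prop) C
      fun i => by
        refine le_trans ?_ (hC _ (h i))
        refine (norm_prod_le_iff.2 ⟨?_, norm_prod_le_iff.2 ⟨?_, norm_prod_le_iff.2 ⟨?_, ?_⟩⟩⟩)
        iterate 3 rw [norm_zero]; exact norm_nonneg _
        exact (norm_snd_le (x₀.pt (k₂ i), y i)).trans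
          ((norm_snd_le (x₀.pt (k₁ i), x₀.pt (k₂ i), y i)).trans
            (norm_snd_le ((0 : ℝ), x₀.pt (k₁ i), x₀.pt (k₂ i), y i)))
  let φ : ℝ × Params → (X →ᵇ ℝ × TorusParams × TorusParams × Y) :=
    fun p => paramFamily k₁ k₂ Y p + y'
  have hφ : ContDiff ℝ ∞ φ := (paramFamily k₁ k₂ Y).contDiff.add contDiff_const
  have hφa (p : ℝ × Params) (i : X) : φ p i = (p.1, p.2.pt (k₁ i), p.2.pt (k₂ i), y i) := by
    change paramFamily k₁ k₂ Y p i + (0, 0, 0, y i) = _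
    rw [paramFamily_apply]
    simp
  refine ⟨fun p => superpos F (φ p), _, (isOpen_superpos_domain hW).preimage hφ.continuous,
    ⟨K, hK, hKW, fun i => by rw [hφa]; exact h i⟩,
    (contDiffOn_superpos (𝕜 := ℝ) hW hF).comp hφ.contDiffOn fun _ hp => hp, ?_⟩
  rintro p ⟨K', hK', hKW', hp⟩ i
  rw [superpos_apply hF.continuousOn hK' hKW' hp, hφa]
  exact ⟨hKW' (hφa p i ▸ hp i), rfl⟩

end ParamFamily

/-! ### The lattice -/

/-- Indices of the nonzero lattice points. -/
abbrev LatticeIndex : Type := {p : ℤ × ℤ // p ≠ 0}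

/-- The lattice point `m + n τ`. -/
def latticePoint (p : LatticeIndex) (τ : ℂ) : ℂ := (p.1.1 : ℂ) + (p.1.2 : ℂ) * τ

/-- A summand of the Weierstrass zeta function. -/
def zetaTerm (p : LatticeIndex) (z τ : ℂ) : ℂ :=
  1 / (z - latticePoint p τ) + 1 / latticePoint p τ + z / latticePoint p τ ^ 2

/-- The Weierstrass zeta function without its pole at the origin. -/
def wZetaReg (z τ : ℂ) : ℂ := ∑' p : LatticeIndex, zetaTerm p z τ

theorem wZeta_eq (z τ : ℂ) : wZeta z τ = 1 / z + wZetaReg z τ := rfl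

theorem mem_latticeOf {τ z : ℂ} : z ∈ latticeOf τ ↔ ∃ m n : ℤ, z = (m : ℂ) + (n : ℂ) * τ := by
  rw [latticeOf, AddSubgroup.mem_closure_pair]
  simp only [zsmul_eq_mul, mul_one]
  exact ⟨fun ⟨m, n, h⟩ => ⟨m, n, h.symm⟩, fun ⟨m, n, h⟩ => ⟨m, n, h.symm⟩⟩

theorem one_mem_latticeOf (τ : ℂ) : (1 : ℂ) ∈ latticeOf τ :=
  AddSubgroup.subset_closure (by simp)

theorem tau_mem_latticeOf (τ : ℂ) : τ ∈ latticeOf τ :=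
  AddSubgroup.subset_closure (by simp)

theorem notMem_latticeOf_iff {τ z : ℂ} :
    z ∉ latticeOf τ ↔ z ≠ 0 ∧ ∀ p : LatticeIndex, z ≠ latticePoint p τ := by
  rw [mem_latticeOf, not_iff_comm]
  push Not
  constructor
  · intro h
    by_cases hz : z = 0
    · exact ⟨0, 0, by simp [hz]⟩
    · obtain ⟨p, hp⟩ := h hz
      exact ⟨p.1.1, p.1.2, hp⟩
  · rintro ⟨m, n, h⟩ hz
    refine ⟨⟨(m, n), ?_⟩, h⟩
    rintro h0
    simp only [Prod.mk_eq_zero] at h0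
    simp [h0.1, h0.2] at h
    exact hz h

theorem norm_index_pos (p : LatticeIndex) : 0 < ‖p.1‖ := norm_pos_iff.2 p.2

/-- A lower bound for the norm of lattice points. -/
def latticeConst (τ : ℂ) : ℝ := (1 + (1 + ‖τ‖) / τ.im)⁻¹

theorem latticeConst_pos {τ : ℂ} (hτ : 0 < τ.im) : 0 < latticeConst τ := by
  unfold latticeConst
  positivity

/-- The imaginary part of u = m + nτ bounds n, and then m = u - nτ is bounded as well. -/
theorem latticeConst_mul_le {τ : ℂ} (hτ : 0 < τ.im) (p : LatticeIndex) :
    latticeConst τ * ‖p.1‖ ≤ ‖latticePoint p τ‖ := by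
  have hc : 0 < 1 + (1 + ‖τ‖) / τ.im := by positivity
  rw [latticeConst, inv_mul_le_iff₀ hc]
  set u := latticePoint p τ with hu
  have h2 : |(p.1.2 : ℝ)| ≤ ‖u‖ / τ.im := by
    rw [le_div_iff₀ hτ]
    have := Complex.abs_im_le_norm u
    simpa [hu, latticePoint, abs_mul, abs_of_pos hτ] using this
  have h1 : |(p.1.1 : ℝ)| ≤ ‖u‖ + ‖u‖ / τ.im * ‖τ‖ := by
    have : ((p.1.1 : ℝ) : ℂ) = u - ((p.1.2 : ℝ) : ℂ) * τ := by simp [hu, latticePoint]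
    rw [← Real.norm_eq_abs, ← Complex.norm_real, this]
    refine (norm_sub_le _ _).trans ?_
    rw [norm_mul, Complex.norm_real, Real.norm_eq_abs]
    gcongr
  rw [Prod.norm_def]
  refine max_le ?_ ?_
  · rw [Int.norm_eq_abs]
    refine h1.trans (le_of_sub_nonneg ?_)
    have : (1 + (1 + ‖τ‖) / τ.im) * ‖u‖ - (‖u‖ + ‖u‖ / τ.im * ‖τ‖) = ‖u‖ / τ.im := by
      field_simp
      ring
    rw [this]
    positivity
  · rw [Int.norm_eq_abs]
    refine h2.trans (le_of_sub_nonneg ?_)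
    have : (1 + (1 + ‖τ‖) / τ.im) * ‖u‖ - ‖u‖ / τ.im = ‖u‖ + ‖u‖ / τ.im * ‖τ‖ := by
      field_simp
      ring
    rw [this]
    positivity

theorem latticePoint_ne_zero {τ : ℂ} (hτ : 0 < τ.im) (p : LatticeIndex) : latticePoint p τ ≠ 0 :=
  norm_pos_iff.1 ((mul_pos (latticeConst_pos hτ) (norm_index_pos p)).trans_le
    (latticeConst_mul_le hτ p))

theorem finite_latticeIndex_norm_le (R : ℝ) : {p : LatticeIndex | ‖p.1‖ ≤ R}.Finite := by
  have : {p : ℤ × ℤ | ‖p‖ ≤ R}.Finite := by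
    have h := (isCompact_closedBall (0 : ℤ × ℤ) R).finite_of_discrete
    simpa [closedBall, dist_zero_right] using h
  exact this.preimage Subtype.val_injective.injOn

theorem finite_latticePoint_norm_le {τ : ℂ} (hτ : 0 < τ.im) (R : ℝ) :
    {p : LatticeIndex | ‖latticePoint p τ‖ ≤ R}.Finite := by
  refine (finite_latticeIndex_norm_le (R / latticeConst τ)).subset fun p hp => ?_
  rw [mem_ofPred_eq, le_div_iff₀' (latticeConst_pos hτ)]
  exact (latticeConst_mul_le hτ p).trans hp

theorem summable_norm_index : Summable fun p : LatticeIndex => ‖p.1‖ ^ (-3 : ℤ) := by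
  have h := EisensteinSeries.summable_one_div_norm_rpow (k := 3) (by norm_num)
  have h' : Summable fun p : ℤ × ℤ => ‖p‖ ^ (-3 : ℤ) := by
    rw [← (finTwoArrowEquiv ℤ).summable_iff]
    refine h.congr fun x => ?_
    have hx : ‖x‖ = ‖finTwoArrowEquiv ℤ x‖ := by
      simp [EisensteinSeries.norm_eq_max_natAbs, Prod.norm_def, finTwoArrowEquiv, Int.norm_eq_abs]
    simp only [Function.comp_apply]
    rw [hx, ← Real.rpow_intCast]
    norm_num
  exact h'.subtype {p | p ≠ 0}

/-! ### Joint smoothness of the zeta function -/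

/-- The points `(z, τ)` at which `wZetaReg` is smooth. -/
def zetaRegDomain : Set (ℂ × ℂ) := {w | 0 < w.2.im ∧ ∀ p : LatticeIndex, w.1 ≠ latticePoint p w.2}

/-- The summands of the zeta function, in terms of the direction and the inverse of the size of
the lattice point. -/
def zetaKernel (e : ℂ × ℂ × ℂ × ℂ × ℂ) : ℂ :=
  e.2.2.2.1 ^ 2 / ((e.1 + e.2.1 * e.2.2.2.2) ^ 2 *
    (e.2.2.1 * e.2.2.2.1 - (e.1 + e.2.1 * e.2.2.2.2)))

/-- The domain of `zetaKernel`. -/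
def zetaKernelDomain : Set (ℂ × ℂ × ℂ × ℂ × ℂ) :=
  {e | e.1 + e.2.1 * e.2.2.2.2 ≠ 0 ∧ e.2.2.1 * e.2.2.2.1 - (e.1 + e.2.1 * e.2.2.2.2) ≠ 0}

theorem isOpen_zetaKernelDomain : IsOpen zetaKernelDomain := by
  refine IsOpen.inter ?_ ?_
  · exact isOpen_ne_fun (by fun_prop) (by fun_prop)
  · exact isOpen_ne_fun (by fun_prop) (by fun_prop)

theorem contDiffOn_zetaKernel : ContDiffOn ℂ ∞ zetaKernel zetaKernelDomain := by
  unfold zetaKernel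
  refine ContDiffOn.div (by fun_prop) (by fun_prop) fun e he => ?_
  exact mul_ne_zero (pow_ne_zero 2 he.1) he.2

/-- Direction and inverse of the size of a lattice point, with the arguments `z` and `τ`. -/
def latticeData (p : LatticeIndex) (z τ : ℂ) : ℂ × ℂ × ℂ × ℂ × ℂ :=
  (((p.1.1 / ‖p.1‖ : ℝ) : ℂ), ((p.1.2 / ‖p.1‖ : ℝ) : ℂ), ((‖p.1‖⁻¹ : ℝ) : ℂ), z, τ)

theorem latticeData_dir (p : LatticeIndex) (τ : ℂ) :
    ((p.1.1 / ‖p.1‖ : ℝ) : ℂ) + ((p.1.2 / ‖p.1‖ : ℝ) : ℂ) * τ =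
      latticePoint p τ / ((‖p.1‖ : ℝ) : ℂ) := by
  have := (norm_index_pos p).ne'
  have : ((‖p.1‖ : ℝ) : ℂ) ≠ 0 := by exact_mod_cast this
  push_cast
  rw [latticePoint]
  field_simp

theorem latticeData_mem_iff (p : LatticeIndex) (z τ : ℂ) :
    latticeData p z τ ∈ zetaKernelDomain ↔ latticePoint p τ ≠ 0 ∧ z ≠ latticePoint p τ := by
  have h0 : ((‖p.1‖ : ℝ) : ℂ) ≠ 0 := by exact_mod_cast (norm_index_pos p).ne'
  simp only [zetaKernelDomain, latticeData, mem_ofPred_eq, latticeData_dir]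
  refine and_congr ?_ ?_
  · rw [div_ne_zero_iff]
    exact and_iff_left h0
  · push_cast
    rw [inv_mul_eq_div, ← sub_div, ne_eq, div_eq_zero_iff, sub_eq_zero]
    simp [h0]

/-- The summand equals z²/(u²(z - u)). With u = |p| d it becomes |p|⁻³ times a function of the
direction d, of 1/|p|, z and τ. The data d and 1/|p| are bounded, so ζ is a weighted lattice sum of
a superposition operator. -/
theorem zetaTerm_eq (p : LatticeIndex) (z τ : ℂ) (h : latticeData p z τ ∈ zetaKernelDomain) :
    zetaTerm p z τ = ((‖p.1‖ ^ (-3 : ℤ) : ℝ) : ℂ) * zetaKernel (latticeData p z τ) := by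
  have h0 : ((‖p.1‖ : ℝ) : ℂ) ≠ 0 := by exact_mod_cast (norm_index_pos p).ne'
  obtain ⟨h1, h2⟩ := (latticeData_mem_iff p z τ).1 h
  have h3 : z - latticePoint p τ ≠ 0 := sub_ne_zero.2 h2
  simp only [zetaKernel, latticeData, latticeData_dir, zetaTerm]
  push_cast
  have h4 : (‖p.1‖ : ℂ)⁻¹ * z - latticePoint p τ / (‖p.1‖ : ℂ) =
      (z - latticePoint p τ) / (‖p.1‖ : ℂ) := by ring
  rw [h4, zpow_neg]
  field_simp
  ring

theorem one_le_norm_index (p : LatticeIndex) : (1 : ℝ) ≤ ‖p.1‖ := by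
  by_contra! h
  have h' := Prod.norm_def p.1 ▸ h
  rw [max_lt_iff, Int.norm_eq_abs, Int.norm_eq_abs] at h'
  have a1 : |p.1.1| < 1 := by exact_mod_cast h'.1
  have a2 : |p.1.2| < 1 := by exact_mod_cast h'.2
  rw [Int.abs_lt_one_iff] at a1 a2
  exact p.2 (Prod.ext a1 a2)

/-- The constant part of the family `latticeData`. -/
def latticeDirs : LatticeIndex →ᵇ ℂ × ℂ × ℂ × ℂ × ℂ :=
  BoundedContinuousFunction.ofNormedAddCommGroup (fun p => latticeData p 0 0)
    continuous_of_discreteTopology 1 fun p => by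
      have hp := norm_index_pos p
      have h1 := one_le_norm_index p
      refine norm_prod_le_iff.2 ⟨?_, norm_prod_le_iff.2 ⟨?_, norm_prod_le_iff.2 ⟨?_, ?_⟩⟩⟩
      · simp only [latticeData, Complex.norm_real, norm_div, norm_norm]
        rw [div_le_one hp]
        simpa only [Int.norm_cast_real] using norm_fst_le p.1
      · simp only [latticeData, Complex.norm_real, norm_div, norm_norm]
        rw [div_le_one hp]
        simpa only [Int.norm_cast_real] using norm_snd_le p.1
      · simp only [latticeData, Complex.norm_real, norm_inv, norm_norm]
        exact inv_le_one_of_one_le₀ h1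
      · simp [latticeData]

/-- The linear part of the family `latticeData`. -/
def latticeArgs : (ℂ × ℂ) →L[ℂ] (LatticeIndex →ᵇ ℂ × ℂ × ℂ × ℂ × ℂ) :=
  LinearMap.mkContinuous
    { toFun := fun w => BoundedContinuousFunction.const _ (0, 0, 0, w.1, w.2)
      map_add' := fun w w' => BoundedContinuousFunction.ext fun p => by simp; rfl
      map_smul' := fun c w => BoundedContinuousFunction.ext fun p => by simp; rfl } 1 fun w => by
    rw [one_mul]
    refine (BoundedContinuousFunction.norm_le (norm_nonneg _)).2 fun p => ?_
    simp [Prod.norm_def]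

theorem latticeDirs_add_latticeArgs (w : ℂ × ℂ) (p : LatticeIndex) :
    (latticeDirs + latticeArgs w) p = latticeData p w.1 w.2 := by
  change latticeData p 0 0 + (0, 0, 0, w.1, w.2) = _
  simp [latticeData]

/-- Weighted summation over the lattice. -/
def latticeSum : (LatticeIndex →ᵇ ℂ) →L[ℂ] ℂ :=
  LinearMap.mkContinuous
    { toFun := fun f => ∑' p : LatticeIndex, ((‖p.1‖ ^ (-3 : ℤ) : ℝ) : ℂ) * f p
      map_add' := fun f g => by
        have h (f : LatticeIndex →ᵇ ℂ) :
            Summable fun p : LatticeIndex => ((‖p.1‖ ^ (-3 : ℤ) : ℝ) : ℂ) * f p := by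
          refine Summable.of_norm_bounded (summable_norm_index.mul_right ‖f‖) fun p => ?_
          rw [norm_mul, Complex.norm_real, Real.norm_of_nonneg (by positivity)]
          gcongr
          exact f.norm_coe_le_norm p
        rw [← (h f).tsum_add (h g)]
        simp [mul_add]
      map_smul' := fun c f => by
        simp only [BoundedContinuousFunction.smul_apply, smul_eq_mul, RingHom.id_apply,
          ← tsum_mul_left]
        exact tsum_congr fun p => by ring } (∑' p : LatticeIndex, ‖p.1‖ ^ (-3 : ℤ)) fun f => by
    rw [← tsum_mul_right]
    refine tsum_of_norm_bounded (summable_norm_index.mul_right ‖f‖).hasSum fun p => ?_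
    rw [norm_mul, Complex.norm_real, Real.norm_of_nonneg (by positivity)]
    gcongr
    exact f.norm_coe_le_norm p

/-- Directions lie on the unit sphere of the maximum norm and inverse sizes in [0, 1]. The remaining
point is a lower bound |z - u| ≥ δ|p|: for large p it follows from |u| ≥ c|p| ≥ 2|z|, and the
finitely many other p contribute a positive minimum. -/
theorem exists_compact_latticeData {w : ℂ × ℂ} (hw : w ∈ zetaRegDomain) :
    ∃ K, IsCompact K ∧ K ⊆ zetaKernelDomain ∧ ∀ p, latticeData p w.1 w.2 ∈ K := by
  obtain ⟨z, τ⟩ := w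
  obtain ⟨hτ, hz⟩ := hw
  simp only at hτ hz ⊢
  have hc := latticeConst_pos hτ
  have hmem p : latticeData p z τ ∈ zetaKernelDomain :=
    (latticeData_mem_iff _ _ _).2 ⟨latticePoint_ne_zero hτ p, hz p⟩
  obtain ⟨δ, hδ, hδp⟩ : ∃ δ > 0, ∀ p : LatticeIndex, δ * ‖p.1‖ ≤ ‖z - latticePoint p τ‖ := by
    have hfin := finite_latticeIndex_norm_le (2 * ‖z‖ / latticeConst τ)
    obtain ⟨d, hd, hdp⟩ : ∃ d > 0, ∀ p ∈ {p : LatticeIndex | ‖p.1‖ ≤ 2 * ‖z‖ / latticeConst τ},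
        d ≤ ‖z - latticePoint p τ‖ / ‖p.1‖ := by
      rcases eq_empty_or_nonempty {p : LatticeIndex | ‖p.1‖ ≤ 2 * ‖z‖ / latticeConst τ} with
        he | hne
      · exact ⟨1, one_pos, by simp [he]⟩
      · obtain ⟨a, -, ha'⟩ := exists_min_image _
          (fun p : LatticeIndex => ‖z - latticePoint p τ‖ / ‖p.1‖) hfin hne
        exact ⟨_, div_pos (norm_pos_iff.2 (sub_ne_zero.2 (hz a))) (norm_index_pos a), ha'⟩
    refine ⟨min d (latticeConst τ / 2), by positivity, fun p => ?_⟩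
    by_cases hp : ‖p.1‖ ≤ 2 * ‖z‖ / latticeConst τ
    · rw [← le_div_iff₀ (norm_index_pos p)]
      exact (min_le_left _ _).trans (hdp p hp)
    · have h1 := latticeConst_mul_le hτ p
      push Not at hp
      rw [div_lt_iff₀ hc] at hp
      have h2 := norm_sub_norm_le (latticePoint p τ) z
      rw [norm_sub_rev] at h2
      have h3 : min d (latticeConst τ / 2) * ‖p.1‖ ≤ latticeConst τ / 2 * ‖p.1‖ := by
        gcongr
        exact min_le_right _ _
      nlinarith
  let j : ℝ × ℝ × ℝ → ℂ × ℂ × ℂ × ℂ × ℂ := fun r => ((r.1 : ℂ), (r.2.1 : ℂ), (r.2.2 : ℂ), z, τ)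
  have hj : Continuous j := by fun_prop
  -- Inverse size 0, the limit at infinity of the lattice, is admitted here; this makes the set
  -- closed.
  let S : Set (ℝ × ℝ × ℝ) := {r | max |r.1| |r.2.1| = 1 ∧
    δ ≤ ‖(r.2.2 : ℂ) * z - ((r.1 : ℂ) + (r.2.1 : ℂ) * τ)‖ ∧ 0 ≤ r.2.2 ∧ r.2.2 ≤ 1}
  have hS : IsCompact S := by
    refine Metric.isCompact_of_isClosed_isBounded ?_ ?_
    · have c1 : IsClosed {r : ℝ × ℝ × ℝ | max |r.1| |r.2.1| = 1} :=
        isClosed_eq (by fun_prop) continuous_const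
      have c2 : IsClosed {r : ℝ × ℝ × ℝ |
          δ ≤ ‖(r.2.2 : ℂ) * z - ((r.1 : ℂ) + (r.2.1 : ℂ) * τ)‖} :=
        isClosed_le continuous_const (by fun_prop)
      have c3 : IsClosed {r : ℝ × ℝ × ℝ | 0 ≤ r.2.2} := isClosed_le continuous_const (by fun_prop)
      have c4 : IsClosed {r : ℝ × ℝ × ℝ | r.2.2 ≤ 1} := isClosed_le (by fun_prop) continuous_const
      exact c1.inter (c2.inter (c3.inter c4))
    · refine (isBounded_closedBall (x := (0 : ℝ × ℝ × ℝ)) (r := 1)).subset ?_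
      rintro ⟨r, s, h⟩ ⟨h1, -, h2, h3⟩
      rw [mem_closedBall_zero_iff]
      refine norm_prod_le_iff.2 ⟨(le_max_left _ _).trans h1.le,
        norm_prod_le_iff.2 ⟨(le_max_right _ _).trans h1.le, ?_⟩⟩
      rw [Real.norm_of_nonneg h2]
      exact h3
  refine ⟨j '' S, hS.image hj, ?_, fun p => ⟨(p.1.1 / ‖p.1‖, p.1.2 / ‖p.1‖, ‖p.1‖⁻¹), ?_, rfl⟩⟩
  · rintro _ ⟨⟨r, s, h⟩, ⟨h1, h2, -⟩, rfl⟩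
    refine ⟨fun h0 => ?_, fun h0 => ?_⟩
    · simp only [j] at h0
      have him := congrArg Complex.im h0
      simp only [add_im, ofReal_im, mul_im, ofReal_re, zero_mul, add_zero, zero_add, zero_im,
        mul_eq_zero, hτ.ne', or_false] at him
      have hre := congrArg Complex.re h0
      simp [him] at hre
      simp [him, hre] at h1
    · simp only [j] at h0
      simp only [h0, norm_zero] at h2
      linarith
  · have hp := norm_index_pos p
    have hp1 := one_le_norm_index p
    refine ⟨?_, ?_, by positivity, inv_le_one_of_one_le₀ hp1⟩
    · simp only [abs_div, abs_of_pos hp]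
      rw [max_div_div_right hp.le, div_eq_one_iff_eq hp.ne', Prod.norm_def, Int.norm_eq_abs,
        Int.norm_eq_abs]
    · have := latticeData_dir p τ
      simp only
      rw [this]
      have e : ((‖p.1‖⁻¹ : ℝ) : ℂ) * z - latticePoint p τ / ((‖p.1‖ : ℝ) : ℂ) =
        (z - latticePoint p τ) / ((‖p.1‖ : ℝ) : ℂ) := by push_cast; ring
      rw [e, norm_div, Complex.norm_real, norm_norm, le_div_iff₀ hp]
      exact hδp p

/-- The parameters at which the family `latticeData` stays in a compact subset of the domain of
the kernel. -/
theorem mem_zetaRegDomain_iff {w : ℂ × ℂ} : w ∈ zetaRegDomain ↔ 0 < w.2.im ∧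
    ∃ K, IsCompact K ∧ K ⊆ zetaKernelDomain ∧ ∀ p, (latticeDirs + latticeArgs w) p ∈ K := by
  simp only [latticeDirs_add_latticeArgs]
  refine ⟨fun h => ⟨h.1, exists_compact_latticeData h⟩, fun ⟨h, K, _, hKW, hK⟩ => ⟨h, fun p => ?_⟩⟩
  exact ((latticeData_mem_iff p w.1 w.2).1 (hKW (hK p))).2

theorem contDiff_latticeArgs : ContDiff ℂ ∞ fun w => latticeDirs + latticeArgs w :=
  contDiff_const.add latticeArgs.contDiff

/-- The definition imposes infinitely many open conditions. They are equivalent to the single open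
condition that the lattice family stays in a compact part of the domain of the kernel. -/
theorem isOpen_zetaRegDomain : IsOpen zetaRegDomain := by
  have : zetaRegDomain = {w : ℂ × ℂ | 0 < w.2.im} ∩ (fun w => latticeDirs + latticeArgs w) ⁻¹'
      {φ | ∃ K, IsCompact K ∧ K ⊆ zetaKernelDomain ∧ ∀ p, φ p ∈ K} := by
    ext w
    exact mem_zetaRegDomain_iff
  rw [this]
  exact (isOpen_lt continuous_const (by fun_prop)).inter
    ((isOpen_superpos_domain isOpen_zetaKernelDomain).preimage contDiff_latticeArgs.continuous)

theorem wZetaReg_eq {w : ℂ × ℂ} (hw : w ∈ zetaRegDomain) :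
    wZetaReg w.1 w.2 = latticeSum (superpos zetaKernel (latticeDirs + latticeArgs w)) := by
  obtain ⟨K, hK, hKW, hwK⟩ := (mem_zetaRegDomain_iff.1 hw).2
  refine tsum_congr fun p => ?_
  rw [superpos_apply contDiffOn_zetaKernel.continuousOn hK hKW hwK, latticeDirs_add_latticeArgs]
  refine zetaTerm_eq p _ _ (hKW ?_)
  rw [← latticeDirs_add_latticeArgs]
  exact hwK p

/-- The series is an affine map, followed by a superposition operator, followed by the bounded
functional `latticeSum`; no termwise estimates of derivatives are needed. -/
theorem contDiffOn_wZetaReg : ContDiffOn ℂ ∞ (fun w : ℂ × ℂ => wZetaReg w.1 w.2)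
    zetaRegDomain := by
  refine ContDiffOn.congr ?_ fun w hw => wZetaReg_eq hw
  refine latticeSum.contDiff.comp_contDiffOn ?_
  exact (contDiffOn_superpos isOpen_zetaKernelDomain contDiffOn_zetaKernel).comp
    contDiff_latticeArgs.contDiffOn fun w hw => (mem_zetaRegDomain_iff.1 hw).2

/-! ### Quasi-periodicity of the zeta function -/

theorem hasDerivAt_zetaTerm (p : LatticeIndex) {z τ : ℂ} (hz : z ≠ latticePoint p τ) :
    HasDerivAt (fun z => zetaTerm p z τ)
      (-(1 / (z - latticePoint p τ) ^ 2 - 1 / latticePoint p τ ^ 2)) z := by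
  have h : z - latticePoint p τ ≠ 0 := sub_ne_zero.2 hz
  have h1 := ((hasDerivAt_id z).sub_const (latticePoint p τ)).inv h
  have h2 := (h1.add_const (1 / latticePoint p τ)).add
    ((hasDerivAt_id z).div_const (latticePoint p τ ^ 2))
  refine (h2.congr_deriv ?_).congr_of_eventuallyEq (Eventually.of_forall fun w => ?_)
  · simp [neg_div, add_comm, sub_eq_add_neg]
  · simp [zetaTerm]

theorem exists_ball_zetaTerm_bound {z₀ τ : ℂ} (h : (z₀, τ) ∈ zetaRegDomain) :
    ∃ r > 0, ∃ C, ∀ z ∈ ball z₀ r, (z, τ) ∈ zetaRegDomain ∧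
      ∀ p, ‖zetaTerm p z τ‖ ≤ ‖p.1‖ ^ (-3 : ℤ) * C := by
  obtain ⟨K, hK, hKW, hwK⟩ := exists_compact_latticeData h
  obtain ⟨K', hK', hKW', r, hr, hr'⟩ := exists_compact_thickening isOpen_zetaKernelDomain hK hKW
  obtain ⟨C, hC⟩ := hK'.exists_bound_of_continuousOn
    (contDiffOn_zetaKernel.continuousOn.mono hKW')
  refine ⟨r, hr, C, fun z hz => ?_⟩
  have hmem p : latticeData p z τ ∈ K' := by
    refine hr' _ (hwK p) _ ?_
    simpa [latticeData, Prod.dist_eq, hr] using hz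
  refine ⟨⟨h.1, fun p => ((latticeData_mem_iff p z τ).1 (hKW' (hmem p))).2⟩, fun p => ?_⟩
  rw [zetaTerm_eq p z τ (hKW' (hmem p)), norm_mul, Complex.norm_real,
    Real.norm_of_nonneg (by positivity)]
  gcongr
  exact hC _ (hmem p)

/-- The periods `1` and `τ`. -/
def periods (τ : ℂ) (hτ : 0 < τ.im) : PeriodPair where
  ω₁ := 1
  ω₂ := τ
  indep := by
    rw [LinearIndependent.pair_iff]
    intro s t h
    have him := congrArg Complex.im h
    simp [hτ.ne'] at him
    have hre := congrArg Complex.re h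
    simp [him] at hre
    exact ⟨hre, him⟩

theorem mem_periods_lattice {τ : ℂ} (hτ : 0 < τ.im) {z : ℂ} :
    z ∈ (periods τ hτ).lattice ↔ z ∈ latticeOf τ := by
  rw [PeriodPair.mem_lattice, mem_latticeOf]
  simp [periods, eq_comm]

/-- Termwise differentiation. Identifying the derivative with the ℘-function makes the known
periodicity of ℘ available for the quasi-periodicity of ζ. -/
theorem hasDerivAt_wZetaReg {z τ : ℂ} (hτ : 0 < τ.im) (h : (z, τ) ∈ zetaRegDomain) :
    HasDerivAt (fun z => wZetaReg z τ) (-(periods τ hτ).weierstrassPExcept 0 z) z := by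
  obtain ⟨r, hr, C, hC⟩ := exists_ball_zetaTerm_bound h
  have hd p : ∀ w ∈ ball z r, HasDerivAt (fun z => zetaTerm p z τ)
      (-(1 / (w - latticePoint p τ) ^ 2 - 1 / latticePoint p τ ^ 2)) w :=
    fun w hw => hasDerivAt_zetaTerm p ((hC w hw).1.2 p)
  have h1 := hasSum_deriv_of_summable_norm (summable_norm_index.mul_right C)
    (fun p w hw => (hd p w hw).differentiableAt.differentiableWithinAt) isOpen_ball
    (fun p w hw => (hC w hw).2 p) (mem_ball_self hr)
  have h2 := (periods τ hτ).hasSum_weierstrassPExcept 0 z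
  rw [← (periods τ hτ).latticeEquivProd.symm.toEquiv.hasSum_iff] at h2
  have hinj : Function.Injective (Subtype.val : LatticeIndex → ℤ × ℤ) := Subtype.val_injective
  have h3 := (hinj.hasSum_iff (fun p hp => by
    have hp0 : p = 0 := by
      by_contra h0
      exact hp ⟨⟨p, h0⟩, rfl⟩
    simp [hp0])).2 h2
  have h4 : deriv (fun w => wZetaReg w τ) z = -(periods τ hτ).weierstrassPExcept 0 z := by
    refine h1.unique ?_
    convert! h3.neg using 2 with p
    rw [(hd p z (mem_ball_self hr)).deriv]
    have hp' : ((periods τ hτ).latticeEquivProd.symm p.1 : ℂ) = latticePoint p τ := by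
      rw [PeriodPair.latticeEquiv_symm_apply]
      simp [periods, latticePoint]
    simp [Function.comp_apply, hp', p.2]
  rw [← h4]
  have h5 : DifferentiableOn ℂ (fun w => ∑' p, zetaTerm p w τ) (ball z r) :=
    differentiableOn_tsum_of_summable_norm (summable_norm_index.mul_right C)
      (fun p w hw => (hd p w hw).differentiableAt.differentiableWithinAt) isOpen_ball
      (fun p w hw => (hC w hw).2 p)
  exact (h5.differentiableAt (isOpen_ball.mem_nhds (mem_ball_self hr))).hasDerivAt

theorem mem_zetaRegDomain_of_notMem {z τ : ℂ} (hτ : 0 < τ.im) (h : z ∉ latticeOf τ) :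
    (z, τ) ∈ zetaRegDomain := ⟨hτ, (notMem_latticeOf_iff.1 h).2⟩

theorem hasDerivAt_wZeta {z τ : ℂ} (hτ : 0 < τ.im) (h : z ∉ latticeOf τ) :
    HasDerivAt (fun z => wZeta z τ) (-(periods τ hτ).weierstrassP z) z := by
  have hz : z ≠ 0 := (notMem_latticeOf_iff.1 h).1
  have h1 := (hasDerivAt_inv hz).add
    (hasDerivAt_wZetaReg hτ (mem_zetaRegDomain_of_notMem hτ h))
  have h2 := (periods τ hτ).weierstrassPExcept_add 0 z
  refine (h1.congr_deriv ?_).congr_of_eventuallyEq (Eventually.of_forall fun w => ?_)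
  · rw [← h2]
    simp
  · simp [wZeta_eq]

theorem wZeta_neg (z τ : ℂ) : wZeta (-z) τ = -wZeta z τ := by
  have h : wZetaReg (-z) τ = -wZetaReg z τ := by
    have e : Function.Involutive fun p : LatticeIndex => (⟨-p.1, neg_ne_zero.2 p.2⟩ : LatticeIndex) :=
      fun p => by simp
    rw [wZetaReg, wZetaReg, ← (Function.Involutive.toPerm _ e).tsum_eq, ← tsum_neg]
    refine tsum_congr fun p => ?_
    have : latticePoint (Function.Involutive.toPerm _ e p) τ = -latticePoint p τ := by
      simp [latticePoint]
      ring
    rw [zetaTerm, zetaTerm, this]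
    have : -z - -latticePoint p τ = -(z - latticePoint p τ) := by ring
    rw [this]
    simp only [div_neg, neg_sq, neg_div]
    ring
  rw [wZeta_eq, wZeta_eq, h]
  simp [div_neg]
  ring

theorem countable_latticeOf (τ : ℂ) : (latticeOf τ : Set ℂ).Countable := by
  refine (countable_range fun p : ℤ × ℤ => (p.1 : ℂ) + (p.2 : ℂ) * τ).mono fun z hz => ?_
  obtain ⟨m, n, h⟩ := mem_latticeOf.1 hz
  exact ⟨(m, n), h.symm⟩

theorem isPreconnected_compl_latticeOf (τ : ℂ) : IsPreconnected (latticeOf τ : Set ℂ)ᶜ :=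
  ((countable_latticeOf τ).isConnected_compl_of_one_lt_rank (by simp)).isPreconnected

theorem isClosed_latticeOf {τ : ℂ} (hτ : 0 < τ.im) : IsClosed (latticeOf τ : Set ℂ) := by
  have := (periods τ hτ).isClosed_lattice
  convert this using 1
  ext z
  exact (mem_periods_lattice hτ).symm

theorem half_notMem {τ : ℂ} (hτ : 0 < τ.im) : (1 / 2 : ℂ) ∉ latticeOf τ := fun h =>
  (periods τ hτ).ω₁_div_two_notMem_lattice ((mem_periods_lattice hτ).2 h)

theorem half_tau_notMem {τ : ℂ} (hτ : 0 < τ.im) : τ / 2 ∉ latticeOf τ := fun h =>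
  (periods τ hτ).ω₂_div_two_notMem_lattice ((mem_periods_lattice hτ).2 h)

theorem add_notMem {τ z u : ℂ} (hz : z ∉ latticeOf τ) (hu : u ∈ latticeOf τ) :
    z + u ∉ latticeOf τ := fun h => hz (by simpa using sub_mem h hu)

/-- The difference ζ(z + u) - ζ(z) has derivative 0 because ℘ is periodic, and the complement of the
lattice is connected. Evaluation at -u/2, with ζ odd, gives the constant. -/
theorem wZeta_add_period {τ u z : ℂ} (hτ : 0 < τ.im) (hu : u ∈ latticeOf τ)
    (hu2 : u / 2 ∉ latticeOf τ) (hz : z ∉ latticeOf τ) :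
    wZeta (z + u) τ = wZeta z τ + 2 * wZeta (u / 2) τ := by
  have hd : ∀ w ∈ (latticeOf τ : Set ℂ)ᶜ,
      HasDerivAt (fun w => wZeta (w + u) τ - wZeta w τ) 0 w := by
    intro w hw
    have h1 := (hasDerivAt_wZeta hτ (add_notMem hw hu)).comp_add_const w u
    have h2 := h1.sub (hasDerivAt_wZeta hτ hw)
    have h3 := (periods τ hτ).weierstrassP_add_coe w ⟨u, (mem_periods_lattice hτ).2 hu⟩
    simp only at h3
    rw [h3, sub_self] at h2
    exact h2
  have hu2' : -(u / 2) ∉ latticeOf τ := fun h => hu2 (by simpa using neg_mem h)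
  have key := (isClosed_latticeOf hτ).isOpen_compl.is_const_of_deriv_eq_zero
    (isPreconnected_compl_latticeOf τ)
    (fun w hw => (hd w hw).differentiableAt.differentiableWithinAt)
    (fun w hw => (hd w hw).deriv) (x := z) (y := -(u / 2)) hz hu2'
  rw [show -(u / 2) + u = u / 2 by ring, wZeta_neg] at key
  linear_combination key

theorem wZeta_add_one {τ z : ℂ} (hτ : 0 < τ.im) (hz : z ∉ latticeOf τ) :
    wZeta (z + 1) τ = wZeta z τ + eta1 τ :=
  wZeta_add_period hτ (one_mem_latticeOf τ) (half_notMem hτ) hz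

theorem wZeta_add_tau {τ z : ℂ} (hτ : 0 < τ.im) (hz : z ∉ latticeOf τ) :
    wZeta (z + τ) τ = wZeta z τ + eta2 τ :=
  wZeta_add_period hτ (tau_mem_latticeOf τ) (half_tau_notMem hτ) hz

/-! ### The logarithm of the modulus of the sigma function -/

/-- The real linear form `X ↦ Re (c X)`. -/
def reMul : ℂ →L[ℝ] ℂ →L[ℝ] ℝ :=
  (ContinuousLinearMap.compL ℝ ℂ ℂ ℝ reCLM).comp (ContinuousLinearMap.mul ℝ ℂ)

@[simp] theorem reMul_apply (c X : ℂ) : reMul c X = (c * X).re := rfl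

theorem norm_reMul_le (c : ℂ) : ‖reMul c‖ ≤ ‖c‖ :=
  ContinuousLinearMap.opNorm_le_bound _ (norm_nonneg _) fun _ =>
    (Complex.abs_re_le_norm _).trans (norm_mul _ _).le

theorem hasFDerivAt_re {f : ℂ → ℂ} {f' z : ℂ} (h : HasDerivAt f f' z) :
    HasFDerivAt (fun z => (f z).re) (reMul f') z := by
  have := reCLM.hasFDerivAt.comp z (h.hasFDerivAt.restrictScalars ℝ)
  exact this.congr_fderiv (ContinuousLinearMap.ext fun _ => by simp [mul_comm])

/-- Locally log|f| is the real part of a branch of log f. Dividing by the value `f z` moves the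
argument near 1, away from the branch cut. -/
theorem hasFDerivAt_log_norm {f : ℂ → ℂ} {f' z : ℂ} (h : HasDerivAt f f' z) (hz : f z ≠ 0) :
    HasFDerivAt (fun z => Real.log ‖f z‖) (reMul (f' / f z)) z := by
  have h1 : HasDerivAt (fun w => Complex.log (f w / f z)) (f' / f z) z := by
    have := (h.div_const (f z)).clog (by simp [hz])
    simpa [hz] using this
  have h2 := (hasFDerivAt_re h1).add_const (Real.log ‖f z‖)
  refine h2.congr_of_eventuallyEq ?_
  filter_upwards [h.continuousAt.eventually_ne hz] with w hw
  rw [Complex.log_re, norm_div, Real.log_div (norm_ne_zero_iff.2 hw) (norm_ne_zero_iff.2 hz)]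
  ring

/-- A summand of the logarithm of the modulus of the sigma function. -/
def logSigmaTerm (p : LatticeIndex) (z τ : ℂ) : ℝ :=
  Real.log ‖1 - z / latticePoint p τ‖ +
    (z / latticePoint p τ + z ^ 2 / (2 * latticePoint p τ ^ 2)).re

/-- The logarithm of the modulus of the Weierstrass sigma function. -/
def logSigma (z τ : ℂ) : ℝ := Real.log ‖z‖ + ∑' p : LatticeIndex, logSigmaTerm p z τ

theorem hasFDerivAt_logSigmaTerm {τ z : ℂ} (hτ : 0 < τ.im) (p : LatticeIndex)
    (hz : z ≠ latticePoint p τ) :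
    HasFDerivAt (fun z => logSigmaTerm p z τ) (reMul (zetaTerm p z τ)) z := by
  have hu := latticePoint_ne_zero hτ p
  set u := latticePoint p τ with hu_def
  have hzu : 1 - z / u ≠ 0 := by
    rw [sub_ne_zero, ne_comm, ne_eq, div_eq_one_iff_eq hu]
    exact hz
  have hzu' : z - u ≠ 0 := sub_ne_zero.2 hz
  have h1 := hasFDerivAt_log_norm (((hasDerivAt_id z).div_const u).const_sub 1) hzu
  have h2 : HasDerivAt (fun z : ℂ => z / u + z ^ 2 / (2 * u ^ 2)) (1 / u + z / u ^ 2) z := by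
    have := ((hasDerivAt_id z).div_const u).add (((hasDerivAt_id z).pow 2).div_const (2 * u ^ 2))
    refine this.congr_deriv ?_
    simp
    field_simp
  have h3 := h1.add (hasFDerivAt_re h2)
  rw [← map_add] at h3
  refine h3.congr_fderiv (congrArg reMul ?_)
  rw [zetaTerm, ← hu_def]
  have : u - z ≠ 0 := sub_ne_zero.2 hz.symm
  simp only [id]
  field_simp
  ring

theorem norm_zetaTerm_le {τ z : ℂ} (hτ : 0 < τ.im) {M : ℝ} (hM : 0 < M) (hz : ‖z‖ < M)
    (p : LatticeIndex) (hp : 2 * M < ‖latticePoint p τ‖) :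
    ‖zetaTerm p z τ‖ ≤ ‖p.1‖ ^ (-3 : ℤ) * (2 * M ^ 2 / latticeConst τ ^ 3) := by
  have hu := latticePoint_ne_zero hτ p
  have hc := latticeConst_pos hτ
  have hpp := norm_index_pos p
  have h1 := latticeConst_mul_le hτ p
  set u := latticePoint p τ with hu_def
  have h2 : ‖u‖ / 2 ≤ ‖z - u‖ := by
    have := norm_sub_norm_le u z
    rw [norm_sub_rev] at this
    linarith
  have hu' : 0 < ‖u‖ := norm_pos_iff.2 hu
  have h3 : z - u ≠ 0 := norm_pos_iff.1 (lt_of_lt_of_le (by positivity) h2)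
  have h4 : zetaTerm p z τ = z ^ 2 / (u ^ 2 * (z - u)) := by
    rw [zetaTerm, ← hu_def]
    field_simp
    ring
  rw [h4, norm_div, norm_mul, norm_pow, norm_pow]
  calc ‖z‖ ^ 2 / (‖u‖ ^ 2 * ‖z - u‖) ≤ M ^ 2 / (‖u‖ ^ 2 * (‖u‖ / 2)) := by gcongr
    _ = 2 * M ^ 2 / ‖u‖ ^ 3 := by field_simp
    _ ≤ 2 * M ^ 2 / (latticeConst τ * ‖p.1‖) ^ 3 := by gcongr
    _ = _ := by
      rw [zpow_neg]
      norm_cast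
      field_simp

-- Although ∫ζ dz is multivalued, its real part log|σ| is not. On the ball |w| < M the terms with
-- |u| ≤ 2M are split off as a finite sum; the others have summably bounded derivatives and all
-- vanish at 0, so they can be differentiated termwise.
open Classical in
theorem hasFDerivAt_logSigma {τ z : ℂ} (hτ : 0 < τ.im) (hz : z ∉ latticeOf τ) :
    HasFDerivAt (fun z => logSigma z τ) (reMul (wZeta z τ)) z := by
  obtain ⟨hz0, hzp⟩ := notMem_latticeOf_iff.1 hz
  set M := ‖z‖ + 1 with hM_def
  have hM : 0 < M := by positivity
  have hzM : z ∈ ball (0 : ℂ) M := by simp [hM_def]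
  set S : Finset LatticeIndex := (finite_latticePoint_norm_le hτ (2 * M)).toFinset with hS
  have hSp p : p ∉ S → 2 * M < ‖latticePoint p τ‖ := fun h => by simpa [hS] using h
  let f : LatticeIndex → ℂ → ℝ := fun p w => if p ∈ S then 0 else logSigmaTerm p w τ
  let f' : LatticeIndex → ℂ → ℂ := fun p w => if p ∈ S then 0 else zetaTerm p w τ
  have hfd p : ∀ w ∈ ball (0 : ℂ) M, HasFDerivAt (f p) (reMul (f' p w)) w := by
    intro w hw
    by_cases hp : p ∈ S
    · simpa [f, f', hp] using hasFDerivAt_const (0 : ℝ) w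
    · simp only [f, f', hp, if_false]
      refine hasFDerivAt_logSigmaTerm hτ p ?_
      rintro rfl
      have := hSp p hp
      rw [mem_ball_zero_iff] at hw
      linarith
  have hfb p : ∀ w ∈ ball (0 : ℂ) M,
      ‖f' p w‖ ≤ ‖p.1‖ ^ (-3 : ℤ) * (2 * M ^ 2 / latticeConst τ ^ 3) := by
    intro w hw
    by_cases hp : p ∈ S
    · simp only [f', hp, if_true, norm_zero]
      have := latticeConst_pos hτ
      positivity
    · simp only [f', hp, if_false]
      exact norm_zetaTerm_le hτ hM (mem_ball_zero_iff.1 hw) p (hSp p hp)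
  have hsum := summable_norm_index.mul_right (2 * M ^ 2 / latticeConst τ ^ 3)
  have hfb' p : ∀ w ∈ ball (0 : ℂ) M, ‖reMul (f' p w)‖ ≤ _ :=
    fun w hw => (norm_reMul_le _).trans (hfb p w hw)
  have h0 : Summable fun p => f p 0 := by
    have : (fun p => f p 0) = fun _ => 0 := by
      ext p
      simp [f, logSigmaTerm]
    rw [this]
    exact summable_zero
  have hpre := (convex_ball (0 : ℂ) M).isPreconnected
  have key := hasFDerivAt_tsum_of_isPreconnected hsum isOpen_ball hpre hfd hfb'
    (mem_ball_self hM) h0 hzM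
  have hsummable w (hw : w ∈ ball (0 : ℂ) M) : Summable fun p => f p w :=
    summable_of_summable_hasFDerivAt_of_isPreconnected hsum isOpen_ball hpre hfd hfb'
      (mem_ball_self hM) h0 hw
  have hsplit {R : Type} [AddCommGroup R] [TopologicalSpace R] [IsTopologicalAddGroup R]
      [T2Space R] (g : LatticeIndex → R) (hg : Summable fun p => if p ∈ S then 0 else g p) :
      ∑' p, g p = (∑' p, if p ∈ S then 0 else g p) + ∑ p ∈ S, g p := by
    have h1 : ∑ p ∈ S, g p = ∑' p, if p ∈ S then g p else 0 := by
      rw [tsum_eq_sum (s := S) fun p hp => by simp [hp]]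
      exact Finset.sum_congr rfl fun p hp => by simp [hp]
    have h2 : Summable fun p => if p ∈ S then g p else 0 :=
      summable_of_ne_finset_zero (s := S) fun p hp => by simp [hp]
    rw [h1, ← hg.tsum_add h2]
    refine tsum_congr fun p => ?_
    split_ifs <;> simp
  have hS' : HasFDerivAt (fun w => ∑ p ∈ S, logSigmaTerm p w τ)
      (∑ p ∈ S, reMul (zetaTerm p z τ)) z :=
    HasFDerivAt.fun_sum fun p _ => hasFDerivAt_logSigmaTerm hτ p (hzp p)
  have htot := ((hasFDerivAt_log_norm (hasDerivAt_id z) hz0).add key).add hS'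
  have hd : reMul (1 / z) + ∑' p, reMul (f' p z) + ∑ p ∈ S, reMul (zetaTerm p z τ) =
      reMul (wZeta z τ) := by
    have hs' : Summable fun p => f' p z := Summable.of_norm_bounded hsum fun p => hfb p z hzM
    rw [← ContinuousLinearMap.map_tsum _ hs', ← map_sum, ← map_add, ← map_add, wZeta_eq, wZetaReg,
      hsplit _ hs', add_assoc]
  rw [← hd]
  refine htot.congr_of_eventuallyEq ?_
  filter_upwards [isOpen_ball.mem_nhds hzM] with w hw
  simp only [logSigma, Pi.add_apply]
  rw [hsplit _ (hsummable w hw), ← add_assoc]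
  rfl

theorem exists_logSigma_add {τ u η : ℂ} (hτ : 0 < τ.im) (hu : u ∈ latticeOf τ)
    (h : ∀ z ∉ latticeOf τ, wZeta (z + u) τ = wZeta z τ + η) :
    ∃ c : ℝ, ∀ z ∉ latticeOf τ, logSigma (z + u) τ = logSigma z τ + (η * z).re + c := by
  have hd : ∀ w ∈ (latticeOf τ : Set ℂ)ᶜ,
      HasFDerivAt (fun w => logSigma (w + u) τ - logSigma w τ - (η * w).re) (0 : ℂ →L[ℝ] ℝ) w := by
    intro w hw
    have h1 := (hasFDerivAt_logSigma hτ (add_notMem hw hu)).comp w ((hasFDerivAt_id w).add_const u)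
    have h2 : HasDerivAt (fun w : ℂ => η * w) η w := by
      simpa using (hasDerivAt_id w).const_mul η
    have h3 := (h1.sub (hasFDerivAt_logSigma hτ hw)).sub (hasFDerivAt_re h2)
    rw [h w hw, ContinuousLinearMap.comp_id, ← map_sub, ← map_sub, add_sub_cancel_left, sub_self,
      map_zero] at h3
    exact h3
  obtain ⟨c, hc⟩ := (isClosed_latticeOf hτ).isOpen_compl.exists_is_const_of_fderiv_eq_zero
    (isPreconnected_compl_latticeOf τ)
    (fun w hw => (hd w hw).differentiableAt.differentiableWithinAt)
    (fun w hw => (hd w hw).fderiv)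
  exact ⟨c, fun z hz => by linarith [hc z hz]⟩

theorem exists_logSigma_quasiperiods {τ : ℂ} (hτ : 0 < τ.im) :
    (∃ c : ℝ, ∀ z ∉ latticeOf τ, logSigma (z + 1) τ = logSigma z τ + (eta1 τ * z).re + c) ∧
      ∃ c : ℝ, ∀ z ∉ latticeOf τ, logSigma (z + τ) τ = logSigma z τ + (eta2 τ * z).re + c :=
  ⟨exists_logSigma_add hτ (one_mem_latticeOf τ) fun _ hz => wZeta_add_one hτ hz,
    exists_logSigma_add hτ (tau_mem_latticeOf τ) fun _ hz => wZeta_add_tau hτ hz⟩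

/-- The real part of Legendre's relation. -/
theorem legendre_re {τ : ℂ} (hτ : 0 < τ.im) : (eta1 τ * τ - eta2 τ).re = 0 := by
  obtain ⟨⟨c₁, h₁⟩, c₂, h₂⟩ := exists_logSigma_quasiperiods hτ
  have hz := half_notMem hτ
  -- The point 1/2 + 1 + τ is reached from 1/2 by adding the two periods in either order. The
  -- constants c₁ and c₂ cancel in the comparison.
  have e1 := h₁ _ (add_notMem hz (tau_mem_latticeOf τ))
  have e2 := h₂ _ (add_notMem hz (one_mem_latticeOf τ))
  have e3 := h₁ _ hz
  have e4 := h₂ _ hz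
  rw [add_right_comm] at e1
  simp only [mul_add, add_re, mul_one, sub_re] at *
  linarith

/-! ### Holomorphic dependence on the argument and the parameters -/

theorem contDiffOn_deriv_fst {E : Type*} [NormedAddCommGroup E] [NormedSpace ℂ E]
    {F : ℂ → E → ℂ} {D : Set (ℂ × E)} (hD : IsOpen D)
    (hF : ContDiffOn ℂ ∞ (fun w : ℂ × E => F w.1 w.2) D) :
    ContDiffOn ℂ ∞ (fun w : ℂ × E => deriv (fun z => F z w.2) w.1) D := by
  have h : ContDiffOn ℂ ∞ (fun w => fderiv ℂ (fun w : ℂ × E => F w.1 w.2) w (1, 0)) D :=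
    (hF.fderiv_of_isOpen hD (by simp)).clm_apply contDiffOn_const
  refine h.congr fun w hw => ?_
  have h1 := ((hF.contDiffAt (hD.mem_nhds hw)).differentiableAt (by simp)).hasFDerivAt
  have h2 : HasDerivAt (fun z : ℂ => (z, w.2)) (1, 0) w.1 :=
    (hasDerivAt_id w.1).prodMk (hasDerivAt_const w.1 w.2)
  exact (h1.comp_hasDerivAt w.1 h2).deriv

theorem differentiableAt_fst {E : Type*} [NormedAddCommGroup E] [NormedSpace ℂ E]
    {F : ℂ → E → ℂ} {D : Set (ℂ × E)} (hD : IsOpen D)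
    (hF : ContDiffOn ℂ ∞ (fun w : ℂ × E => F w.1 w.2) D) {z : ℂ} {e : E} (h : (z, e) ∈ D) :
    DifferentiableAt ℂ (fun z => F z e) z :=
  ((hF.contDiffAt (hD.mem_nhds h)).differentiableAt (by simp)).comp (f := fun z : ℂ => (z, e)) z
    ((hasDerivAt_id z).prodMk (hasDerivAt_const z e)).differentiableAt

/-- The points `(z, τ)` at which `wZeta` is smooth. -/
def zetaDomain : Set (ℂ × ℂ) := {w | 0 < w.2.im ∧ w.1 ∉ latticeOf w.2}

theorem zetaDomain_eq : zetaDomain = zetaRegDomain ∩ {w | w.1 ≠ 0} := by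
  ext w
  simp only [zetaDomain, zetaRegDomain, mem_ofPred_eq, notMem_latticeOf_iff, mem_inter_iff]
  tauto

theorem isOpen_zetaDomain : IsOpen zetaDomain := by
  rw [zetaDomain_eq]
  exact isOpen_zetaRegDomain.inter (isOpen_ne_fun (by fun_prop) (by fun_prop))

theorem contDiffOn_wZeta : ContDiffOn ℂ ∞ (fun w : ℂ × ℂ => wZeta w.1 w.2) zetaDomain := by
  rw [zetaDomain_eq]
  exact (contDiffOn_const.div contDiffOn_fst fun w hw => hw.2).add
    (contDiffOn_wZetaReg.mono inter_subset_left)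

/-- The first parameter. -/
abbrev TorusParams.a (q : TorusParams) : ℂ := q.1

/-- The second parameter. -/
abbrev TorusParams.b (q : TorusParams) : ℂ := q.2.1

/-- The position of the second node. -/
abbrev TorusParams.v (q : TorusParams) : ℂ := q.2.2.1

/-- The modulus. -/
abbrev TorusParams.tau (q : TorusParams) : ℂ := q.2.2.2

/-- The function `g` of one torus. -/
def gaussT (z : ℂ) (q : TorusParams) : ℂ := q.a * (wZeta z q.tau - wZeta (z - q.v) q.tau) + q.b

theorem gauss_eq (x : Params) (k : ℤ) (z : ℂ) : gauss x k z = gaussT z (x.pt k) := rfl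

/-- The domain of `gaussT`. -/
def gaussDomain : Set (ℂ × TorusParams) :=
  {w | (w.1, w.2.tau) ∈ zetaDomain ∧ (w.1 - w.2.v, w.2.tau) ∈ zetaDomain}

theorem isOpen_gaussDomain : IsOpen gaussDomain :=
  (isOpen_zetaDomain.preimage (by fun_prop : Continuous fun w : ℂ × TorusParams =>
    (w.1, w.2.tau))).inter (isOpen_zetaDomain.preimage
      (by fun_prop : Continuous fun w : ℂ × TorusParams => (w.1 - w.2.v, w.2.tau)))

theorem contDiffOn_gaussT : ContDiffOn ℂ ∞ (fun w : ℂ × TorusParams => gaussT w.1 w.2)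
    gaussDomain := by
  have h1 : ContDiffOn ℂ ∞ (fun w : ℂ × TorusParams => wZeta w.1 w.2.tau) gaussDomain :=
    contDiffOn_wZeta.comp (f := fun w : ℂ × TorusParams => (w.1, w.2.tau)) (by fun_prop)
      fun w hw => hw.1
  have h2 : ContDiffOn ℂ ∞ (fun w : ℂ × TorusParams => wZeta (w.1 - w.2.v) w.2.tau)
      gaussDomain :=
    contDiffOn_wZeta.comp (f := fun w : ℂ × TorusParams => (w.1 - w.2.v, w.2.tau)) (by fun_prop)
      fun w hw => hw.2
  have h3 : ContDiffOn ℂ ∞ (fun w : ℂ × TorusParams => w.2.a) gaussDomain := by fun_prop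
  have h4 : ContDiffOn ℂ ∞ (fun w : ℂ × TorusParams => w.2.b) gaussDomain := by fun_prop
  exact (h3.mul (h1.sub h2)).add h4

/-- By oddness of ζ, the reflection z ↦ v - z exchanges the two nodes and preserves g. Everything
proved at the node 0 therefore applies at v, with local parameter s = v - z. -/
theorem gaussT_symm (s : ℂ) (q : TorusParams) : gaussT (q.v - s) q = gaussT s q := by
  have h : wZeta (q.v - s) q.tau = -wZeta (s - q.v) q.tau := by rw [← wZeta_neg]; ring_nf
  simp only [gaussT, h, sub_sub_cancel_left, wZeta_neg]
  ring

/-- The product `s g(s)`, extended to `s = 0`. -/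
def gaussH (s : ℂ) (q : TorusParams) : ℂ :=
  q.a * (1 + s * wZetaReg s q.tau - s * wZeta (s - q.v) q.tau) + q.b * s

/-- The domain of `gaussH`. -/
def gaussHDomain : Set (ℂ × TorusParams) :=
  {w | (w.1, w.2.tau) ∈ zetaRegDomain ∧ (w.1 - w.2.v, w.2.tau) ∈ zetaDomain}

theorem isOpen_gaussHDomain : IsOpen gaussHDomain :=
  (isOpen_zetaRegDomain.preimage (by fun_prop : Continuous fun w : ℂ × TorusParams =>
    (w.1, w.2.tau))).inter (isOpen_zetaDomain.preimage
      (by fun_prop : Continuous fun w : ℂ × TorusParams => (w.1 - w.2.v, w.2.tau)))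

theorem contDiffOn_gaussH : ContDiffOn ℂ ∞ (fun w : ℂ × TorusParams => gaussH w.1 w.2)
    gaussHDomain := by
  have h1 : ContDiffOn ℂ ∞ (fun w : ℂ × TorusParams => wZetaReg w.1 w.2.tau) gaussHDomain :=
    contDiffOn_wZetaReg.comp (f := fun w : ℂ × TorusParams => (w.1, w.2.tau)) (by fun_prop)
      fun w hw => hw.1
  have h2 : ContDiffOn ℂ ∞ (fun w : ℂ × TorusParams => wZeta (w.1 - w.2.v) w.2.tau)
      gaussHDomain :=
    contDiffOn_wZeta.comp (f := fun w : ℂ × TorusParams => (w.1 - w.2.v, w.2.tau)) (by fun_prop)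
      fun w hw => hw.2
  have h3 : ContDiffOn ℂ ∞ (fun w : ℂ × TorusParams => w.2.a) gaussHDomain := by fun_prop
  have h4 : ContDiffOn ℂ ∞ (fun w : ℂ × TorusParams => w.2.b) gaussHDomain := by fun_prop
  have h5 : ContDiffOn ℂ ∞ (fun w : ℂ × TorusParams => w.1) gaussHDomain := by fun_prop
  exact (h3.mul ((contDiffOn_const.add (h5.mul h1)).sub (h5.mul h2))).add (h4.mul h5)

theorem gaussH_eq {s : ℂ} (hs : s ≠ 0) (q : TorusParams) : gaussH s q = s * gaussT s q := by
  rw [gaussH, gaussT, wZeta_eq s]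
  field_simp

/-- The local coordinate `1 / g` near the origin. -/
def nodeCoord (s : ℂ) (q : TorusParams) : ℂ := s / gaussH s q

theorem nodeCoord_eq {s : ℂ} (hs : s ≠ 0) (q : TorusParams) :
    nodeCoord s q = (gaussT s q)⁻¹ := by
  rw [nodeCoord, gaussH_eq hs, div_mul_cancel_left₀ hs]

@[simp] theorem nodeCoord_zero (q : TorusParams) : nodeCoord 0 q = 0 := by simp [nodeCoord]

/-- The domain of `nodeCoord`. -/
def nodeCoordDomain : Set (ℂ × TorusParams) := {w | w ∈ gaussHDomain ∧ gaussH w.1 w.2 ≠ 0}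

theorem isOpen_nodeCoordDomain : IsOpen nodeCoordDomain :=
  contDiffOn_gaussH.continuousOn.isOpen_inter_preimage isOpen_gaussHDomain isOpen_ne

theorem contDiffOn_nodeCoord : ContDiffOn ℂ ∞ (fun w : ℂ × TorusParams => nodeCoord w.1 w.2)
    nodeCoordDomain :=
  contDiffOn_fst.div (contDiffOn_gaussH.mono fun _ hw => hw.1) fun _ hw => hw.2

/-! ### Parameters with uniform control of the nodes -/

/-- The conditions on the parameters of one torus under which the disks of radius `ρ` around the
nodes are disjoint and carry the coordinate `1 / g`. -/
structure GoodParams (q : TorusParams) (ρ : ℝ) : Prop where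
  pos : 0 < ρ
  im_pos : 0 < q.tau.im
  sep : ∀ p : LatticeIndex, 4 * ρ ≤ ‖latticePoint p q.tau‖
  sep_v : ∀ u ∈ latticeOf q.tau, 4 * ρ ≤ ‖q.v - u‖
  mem : ∀ s ∈ ball (0 : ℂ) ρ, (s, q) ∈ nodeCoordDomain
  deriv_near : ∀ s ∈ ball (0 : ℂ) ρ, ‖deriv (fun s => nodeCoord s q) s - 1 / q.a‖ ≤ 1 / 2
  inv_a_ge : 3 / 2 ≤ ‖1 / q.a‖
  inv_a_le : ‖1 / q.a‖ ≤ 5 / 2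

theorem GoodParams.mono {q : TorusParams} {ρ ρ' : ℝ} (h : GoodParams q ρ) (h0 : 0 < ρ')
    (hρ : ρ' ≤ ρ) : GoodParams q ρ' where
  pos := h0
  im_pos := h.im_pos
  sep p := le_trans (by linarith) (h.sep p)
  sep_v u hu := le_trans (by linarith) (h.sep_v u hu)
  mem s hs := h.mem s (ball_subset_ball hρ hs)
  deriv_near s hs := h.deriv_near s (ball_subset_ball hρ hs)
  inv_a_ge := h.inv_a_ge
  inv_a_le := h.inv_a_le

theorem deriv_nodeCoord_zero {q : TorusParams} (h : (0, q) ∈ nodeCoordDomain) :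
    deriv (fun s => nodeCoord s q) 0 = 1 / q.a := by
  have h1 := (differentiableAt_fst isOpen_gaussHDomain contDiffOn_gaussH h.1).hasDerivAt
  have h2 := ((hasDerivAt_id (0 : ℂ)).div h1 h.2).deriv
  have h3 : gaussH 0 q = q.a := by simp [gaussH]
  have h4 : q.a ≠ 0 := h3 ▸ h.2
  change deriv ((id : ℂ → ℂ) / fun s => gaussH s q) 0 = _
  rw [h2, h3]
  simp
  field_simp

/-- At s = 0 the coordinate 1/g has derivative 1/a, which is -2 at the central value. All the
conditions are then open in s and q near (0, q₀). -/
theorem eventually_goodParams {q₀ : TorusParams} (hτ : 0 < q₀.tau.im)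
    (hv : q₀.v ∉ latticeOf q₀.tau) (ha : q₀.a = -1 / 2) :
    ∃ ρ > 0, ∀ᶠ q in 𝓝 q₀, GoodParams q ρ := by
  have hnv : -q₀.v ∉ latticeOf q₀.tau := fun h => hv (by simpa using neg_mem h)
  have h0 : ((0 : ℂ), q₀) ∈ nodeCoordDomain := by
    refine ⟨⟨⟨hτ, fun p => (latticePoint_ne_zero hτ p).symm⟩, hτ, by simpa using hnv⟩, ?_⟩
    simp [gaussH, ha]
  have hcont : ContinuousAt (fun w : ℂ × TorusParams =>
      deriv (fun s => nodeCoord s w.2) w.1 - 1 / w.2.a) (0, q₀) := by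
    refine ContinuousAt.sub ?_ (ContinuousAt.div (by fun_prop) (by fun_prop) (by simp [ha]))
    exact (contDiffOn_deriv_fst isOpen_nodeCoordDomain contDiffOn_nodeCoord).continuousOn.continuousAt
      (isOpen_nodeCoordDomain.mem_nhds h0)
  have e1 : ∀ᶠ w : ℂ × TorusParams in 𝓝 (0, q₀), w ∈ nodeCoordDomain ∧
      ‖deriv (fun s => nodeCoord s w.2) w.1 - 1 / w.2.a‖ < 1 / 2 := by
    refine Filter.Eventually.and (isOpen_nodeCoordDomain.mem_nhds h0) ?_
    refine hcont.norm.eventually (gt_mem_nhds ?_)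
    simp only [deriv_nodeCoord_zero h0]
    simp
  have e2 : ∀ᶠ q : TorusParams in 𝓝 q₀, 3 / 2 < ‖1 / q.a‖ ∧ ‖1 / q.a‖ < 5 / 2 := by
    have hc : ContinuousAt (fun q : TorusParams => ‖1 / q.a‖) q₀ :=
      (ContinuousAt.div (by fun_prop) (by fun_prop) (by simp [ha])).norm
    have : ‖1 / q₀.a‖ = 2 := by rw [ha]; norm_num
    exact (hc.eventually (lt_mem_nhds (by simp only [this]; norm_num))).and
      (hc.eventually (gt_mem_nhds (by simp only [this]; norm_num)))
  rw [nhds_prod_eq, eventually_prod_iff] at e1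
  obtain ⟨p₁, hp₁, p₂, hp₂, hp⟩ := e1
  obtain ⟨r, hr, hrp⟩ := Metric.eventually_nhds_iff_ball.1 hp₁
  have hmem q (hq : p₂ q) : ∀ s ∈ ball (0 : ℂ) r, (s, q) ∈ nodeCoordDomain :=
    fun s hs => (hp (hrp s hs) hq).1
  -- A lattice point, or a point v - u, in the ball of radius r would violate `nodeCoordDomain`.
  -- Both separations by 4ρ therefore hold with ρ = r/4.
  refine ⟨r / 4, by positivity, ?_⟩
  filter_upwards [hp₂, e2] with q hq hq2
  have hsub : ball (0 : ℂ) (r / 4) ⊆ ball 0 r := ball_subset_ball (by linarith)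
  refine ⟨by positivity, ((hmem q hq) 0 (mem_ball_self hr)).1.1.1, fun p => ?_, fun u hu => ?_,
    fun s hs => hmem q hq s (hsub hs), fun s hs => (hp (hrp s (hsub hs)) hq).2.le, hq2.1.le,
    hq2.2.le⟩
  · by_contra! hlt
    exact (hmem q hq (latticePoint p q.tau) (mem_ball_zero_iff.2 (by linarith))).1.1.2 p rfl
  · by_contra! hlt
    have := (hmem q hq (q.v - u) (mem_ball_zero_iff.2 (by linarith))).1.2.2
    simp only [sub_sub_cancel_left] at this
    exact this (neg_mem hu)

/-- The radius of the disks must not depend on the torus. The local radii are made uniform by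
compactness, using that the conditions persist for smaller radii. -/
theorem exists_goodParams_of_isCompact {K : Set TorusParams} (hK : IsCompact K)
    (h : ∀ q ∈ K, 0 < q.tau.im ∧ q.v ∉ latticeOf q.tau ∧ q.a = -1 / 2) :
    ∃ ρ > 0, ∃ δ > 0, ∀ q ∈ K, ∀ q', dist q' q < δ → GoodParams q' ρ := by
  have key : ∃ ρ > 0, ∀ᶠ q in 𝓝ˢ K, GoodParams q ρ := by
    refine hK.induction_on (p := fun s => ∃ ρ > 0, ∀ᶠ q in 𝓝ˢ s, GoodParams q ρ)
      ⟨1, one_pos, by simp⟩ ?_ ?_ ?_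
    · rintro s t hst ⟨ρ, hρ, h⟩
      exact ⟨ρ, hρ, nhdsSet_mono hst h⟩
    · rintro s t ⟨ρ, hρ, h⟩ ⟨ρ', hρ', h'⟩
      refine ⟨min ρ ρ', lt_min hρ hρ', ?_⟩
      rw [nhdsSet_union, eventually_sup]
      exact ⟨h.mono fun q hq => hq.mono (lt_min hρ hρ') (min_le_left _ _),
        h'.mono fun q hq => hq.mono (lt_min hρ hρ') (min_le_right _ _)⟩
    · intro q hq
      obtain ⟨hτ, hv, ha⟩ := h q hq
      obtain ⟨ρ, hρ, h⟩ := eventually_goodParams hτ hv ha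
      obtain ⟨U, hU, hUo, hqU⟩ := _root_.eventually_nhds_iff.1 h
      exact ⟨U, mem_nhdsWithin_of_mem_nhds (hUo.mem_nhds hqU), ρ, hρ,
        (hUo.mem_nhdsSet.2 subset_rfl |> fun h' => mem_of_superset h' hU)⟩
  obtain ⟨ρ, hρ, hev⟩ := key
  obtain ⟨U, hUo, hKU, hU⟩ := mem_nhdsSet_iff_exists.1 hev
  obtain ⟨δ, hδ, hsub⟩ := hK.exists_thickening_subset_open hUo hKU
  exact ⟨ρ, hρ, δ, hδ, fun q hq q' hd => hU (hsub (mem_thickening_iff.2 ⟨q, hq, hd⟩))⟩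

/-! ### Estimates for the coordinate 1/g at a node -/

namespace GoodParams

variable {q : TorusParams} {ρ : ℝ}

theorem differentiableAt_nodeCoord (h : GoodParams q ρ) {s : ℂ} (hs : s ∈ ball (0 : ℂ) ρ) :
    DifferentiableAt ℂ (fun s => nodeCoord s q) s :=
  differentiableAt_fst isOpen_nodeCoordDomain contDiffOn_nodeCoord (h.mem s hs)

/-- On the ball, 1/g differs from the linear map s/a by a map with Lipschitz constant 1/2. As |1/a|
lies between 3/2 and 5/2, distances are multiplied by a factor between 1 and 3. -/
theorem norm_sub_sub_le (h : GoodParams q ρ) {s s' : ℂ} (hs : s ∈ ball (0 : ℂ) ρ)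
    (hs' : s' ∈ ball (0 : ℂ) ρ) :
    ‖nodeCoord s q - nodeCoord s' q - 1 / q.a * (s - s')‖ ≤ 1 / 2 * ‖s - s'‖ := by
  have hd : ∀ z ∈ ball (0 : ℂ) ρ, HasDerivWithinAt (fun s => nodeCoord s q - 1 / q.a * s)
      (deriv (fun s => nodeCoord s q) z - 1 / q.a) (ball 0 ρ) z := by
    intro z hz
    have h1 := (h.differentiableAt_nodeCoord hz).hasDerivAt.sub
      ((hasDerivAt_id z).const_mul (1 / q.a))
    rw [mul_one] at h1
    exact h1.hasDerivWithinAt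
  have := Convex.norm_image_sub_le_of_norm_hasDerivWithin_le hd h.deriv_near (convex_ball _ _)
    hs' hs
  refine le_trans (le_of_eq ?_) this
  congr 1
  ring

theorem le_norm_nodeCoord_sub (h : GoodParams q ρ) {s s' : ℂ} (hs : s ∈ ball (0 : ℂ) ρ)
    (hs' : s' ∈ ball (0 : ℂ) ρ) : ‖s - s'‖ ≤ ‖nodeCoord s q - nodeCoord s' q‖ := by
  have h1 := h.norm_sub_sub_le hs hs'
  have h2 := norm_sub_norm_le (1 / q.a * (s - s')) (nodeCoord s q - nodeCoord s' q)
  rw [← norm_sub_rev (nodeCoord s q - nodeCoord s' q), norm_mul] at h2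
  have h3 := mul_le_mul_of_nonneg_right h.inv_a_ge (norm_nonneg (s - s'))
  linarith

theorem norm_nodeCoord_sub_le (h : GoodParams q ρ) {s s' : ℂ} (hs : s ∈ ball (0 : ℂ) ρ)
    (hs' : s' ∈ ball (0 : ℂ) ρ) : ‖nodeCoord s q - nodeCoord s' q‖ ≤ 3 * ‖s - s'‖ := by
  have h1 := h.norm_sub_sub_le hs hs'
  have h2 := norm_sub_norm_le (nodeCoord s q - nodeCoord s' q) (1 / q.a * (s - s'))
  rw [norm_mul] at h2
  have h3 := mul_le_mul_of_nonneg_right h.inv_a_le (norm_nonneg (s - s'))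
  linarith

theorem le_norm_nodeCoord (h : GoodParams q ρ) {s : ℂ} (hs : s ∈ ball (0 : ℂ) ρ) :
    ‖s‖ ≤ ‖nodeCoord s q‖ := by
  simpa using h.le_norm_nodeCoord_sub hs (mem_ball_self h.pos)

theorem norm_nodeCoord_le (h : GoodParams q ρ) {s : ℂ} (hs : s ∈ ball (0 : ℂ) ρ) :
    ‖nodeCoord s q‖ ≤ 3 * ‖s‖ := by
  simpa using h.norm_nodeCoord_sub_le hs (mem_ball_self h.pos)

theorem injOn_nodeCoord (h : GoodParams q ρ) : InjOn (fun s => nodeCoord s q) (ball 0 ρ) := by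
  intro s hs s' hs' he
  have := h.le_norm_nodeCoord_sub hs hs'
  simp only at he
  rw [he, sub_self, norm_zero] at this
  exact sub_eq_zero.1 (norm_le_zero_iff.1 this)

theorem deriv_nodeCoord_ne_zero (h : GoodParams q ρ) {s : ℂ} (hs : s ∈ ball (0 : ℂ) ρ) :
    deriv (fun s => nodeCoord s q) s ≠ 0 := by
  intro h0
  have h1 := h.deriv_near s hs
  rw [h0, zero_sub, norm_neg] at h1
  linarith [h.inv_a_ge]

/-- Quantitative open mapping: a nonconstant holomorphic function vanishing at 0, of modulus at
least r on the circle of radius r, takes every value of modulus less than r/2. -/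
theorem exists_nodeCoord_eq (h : GoodParams q ρ) {w : ℂ} (hw : ‖w‖ < ρ / 2) :
    ∃ s ∈ ball (0 : ℂ) ρ, nodeCoord s q = w := by
  have hρ := h.pos
  -- The midpoint of 2‖w‖ and ρ: both r < ρ and ‖w‖ < r/2 hold.
  set r := (ρ + 2 * ‖w‖) / 2 with hr
  have hrρ : r < ρ := by linarith
  have hr0 : 0 < r := by positivity
  have hcl : closedBall (0 : ℂ) r ⊆ ball 0 ρ := closedBall_subset_ball hrρ
  have hd : DiffContOnCl ℂ (fun s => nodeCoord s q) (ball 0 r) := by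
    refine DifferentiableOn.diffContOnCl fun s hs => ?_
    rw [closure_ball _ hr0.ne'] at hs
    exact (h.differentiableAt_nodeCoord (hcl hs)).differentiableWithinAt
  have key := hd.ball_subset_image_closedBall hr0 (ε := r) (fun s hs => ?_) ?_
  · rw [nodeCoord_zero] at key
    obtain ⟨s, hs, hsw⟩ := key (show w ∈ ball (0 : ℂ) (r / 2) by
      rw [mem_ball_zero_iff]
      linarith)
    exact ⟨s, hcl hs, hsw⟩
  · have := h.le_norm_nodeCoord_sub (hcl (sphere_subset_closedBall hs)) (mem_ball_self hρ)
    rw [sub_zero, mem_sphere_zero_iff_norm.1 hs] at this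
    exact this
  · refine Filter.Eventually.frequently (f := 𝓝[≠] (0 : ℂ)) ?_ |>.filter_mono nhdsWithin_le_nhds
    filter_upwards [self_mem_nhdsWithin,
      mem_nhdsWithin_of_mem_nhds (ball_mem_nhds (0 : ℂ) hρ)] with s hs hs' he
    exact hs (h.injOn_nodeCoord hs' (mem_ball_self hρ) he)

end GoodParams

/-- The inverse of the local coordinate `1 / g`. -/
def nodeInv (q : TorusParams) (ρ : ℝ) (w : ℂ) : ℂ :=
  Function.invFunOn (fun s => nodeCoord s q) (ball 0 ρ) w

/-! ### The inverse of the coordinate 1/g -/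

namespace GoodParams

variable {q : TorusParams} {ρ : ℝ}

theorem nodeInv_mem (h : GoodParams q ρ) {w : ℂ} (hw : ‖w‖ < ρ / 2) :
    nodeInv q ρ w ∈ ball (0 : ℂ) ρ :=
  Function.invFunOn_mem (h.exists_nodeCoord_eq hw)

theorem nodeCoord_nodeInv (h : GoodParams q ρ) {w : ℂ} (hw : ‖w‖ < ρ / 2) :
    nodeCoord (nodeInv q ρ w) q = w :=
  Function.invFunOn_eq (f := fun s => nodeCoord s q) (h.exists_nodeCoord_eq hw)

theorem nodeInv_nodeCoord (h : GoodParams q ρ) {s : ℂ} (hs : s ∈ ball (0 : ℂ) ρ)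
    (hw : ‖nodeCoord s q‖ < ρ / 2) : nodeInv q ρ (nodeCoord s q) = s :=
  h.injOn_nodeCoord (h.nodeInv_mem hw) hs (h.nodeCoord_nodeInv hw)

theorem norm_nodeInv_le (h : GoodParams q ρ) {w : ℂ} (hw : ‖w‖ < ρ / 2) :
    ‖nodeInv q ρ w‖ ≤ ‖w‖ := by
  have := h.le_norm_nodeCoord (h.nodeInv_mem hw)
  rwa [h.nodeCoord_nodeInv hw] at this

theorem nodeInv_zero (h : GoodParams q ρ) : nodeInv q ρ 0 = 0 := by
  have := h.norm_nodeInv_le (w := 0) (by simpa using h.pos)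
  simpa using this

theorem hasDerivAt_nodeInv (h : GoodParams q ρ) {w : ℂ} (hw : ‖w‖ < ρ / 2) :
    HasDerivAt (nodeInv q ρ) (deriv (fun s => nodeCoord s q) (nodeInv q ρ w))⁻¹ w := by
  have hev : ∀ᶠ w' in 𝓝 w, ‖w'‖ < ρ / 2 := continuous_norm.continuousAt.eventually
    (gt_mem_nhds hw)
  refine HasDerivAt.of_local_left_inverse ?_
    (h.differentiableAt_nodeCoord (h.nodeInv_mem hw)).hasDerivAt
    (h.deriv_nodeCoord_ne_zero (h.nodeInv_mem hw)) ?_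
  · refine tendsto_iff_norm_sub_tendsto_zero.2 (squeeze_zero' (g := fun w' => ‖w' - w‖)
      (Eventually.of_forall fun _ => norm_nonneg _) ?_ ?_)
    · filter_upwards [hev] with w' hw'
      have := h.le_norm_nodeCoord_sub (h.nodeInv_mem hw') (h.nodeInv_mem hw)
      rwa [h.nodeCoord_nodeInv hw, h.nodeCoord_nodeInv hw'] at this
    · exact tendsto_iff_norm_sub_tendsto_zero.1 tendsto_id
  · filter_upwards [hev] with w' hw'
    exact h.nodeCoord_nodeInv hw'

theorem eq_zero_of_mem (h : GoodParams q ρ) {u : ℂ} (hu : u ∈ latticeOf q.tau)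
    (hu' : ‖u‖ < 4 * ρ) : u = 0 := by
  by_contra h0
  have : u ∈ latticeOf q.tau := hu
  rw [← not_not (a := u ∈ latticeOf q.tau), notMem_latticeOf_iff] at this
  push Not at this
  obtain ⟨p, hp⟩ := this h0
  have := h.sep p
  rw [← hp] at this
  linarith

theorem inv_gaussT_nodeInv (h : GoodParams q ρ) {w : ℂ} (hw : ‖w‖ < ρ / 2) (h0 : w ≠ 0) :
    (gaussT (nodeInv q ρ w) q)⁻¹ = w := by
  have hne : nodeInv q ρ w ≠ 0 := by
    intro he
    apply h0
    rw [← h.nodeCoord_nodeInv hw, he, nodeCoord_zero]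
  rw [← nodeCoord_eq hne, h.nodeCoord_nodeInv hw]

theorem toTorus_eq_iff {τ z z' : ℂ} : toTorus τ z = toTorus τ z' ↔ z - z' ∈ latticeOf τ := by
  rw [toTorus, toTorus, QuotientAddGroup.eq, ← neg_mem_iff]
  congr! 1
  ring

end GoodParams

/-- The node coordinates of the whole surface. -/
def nodeCoordinates {x : Params} {ρ ε : ℝ} (h : ∀ k, GoodParams (x.pt k) ρ) (hε : 2 * ε ≤ ρ / 2) :
    NodeCoordinates x ε where
  -- The reflection z ↦ v - z carries the inverse coordinate at 0 to the one at v.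
  plus k w := x.v k - nodeInv (x.pt k) ρ w
  minus k w := nodeInv (x.pt k) ρ w
  plus_holomorphic k w hw := ((h k).hasDerivAt_nodeInv
    ((mem_ball_zero_iff.1 hw).trans_le hε)).differentiableAt.const_sub _ |>.differentiableWithinAt
  minus_holomorphic k w hw := ((h k).hasDerivAt_nodeInv
    ((mem_ball_zero_iff.1 hw).trans_le hε)).differentiableAt.differentiableWithinAt
  plus_zero k := by rw [(h k).nodeInv_zero, sub_zero]
  minus_zero k := (h k).nodeInv_zero
  inv_gauss_plus k w hw h0 := by
    rw [gauss_eq]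
    exact (congrArg Inv.inv (gaussT_symm _ (x.pt k))).trans
      ((h k).inv_gaussT_nodeInv ((mem_ball_zero_iff.1 hw).trans_le hε) h0)
  inv_gauss_minus k w hw h0 :=
    (h k).inv_gaussT_nodeInv ((mem_ball_zero_iff.1 hw).trans_le hε) h0
  plus_injOn k w hw w' hw' he := by
    have hw1 := (mem_ball_zero_iff.1 hw).trans_le hε
    have hw1' := (mem_ball_zero_iff.1 hw').trans_le hε
    have h1 := GoodParams.toTorus_eq_iff.1 he
    have h2 := (h k).eq_zero_of_mem h1 (by
      have := norm_sub_le (nodeInv (x.pt k) ρ w') (nodeInv (x.pt k) ρ w)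
      have h3 := mem_ball_zero_iff.1 ((h k).nodeInv_mem hw1)
      have h4 := mem_ball_zero_iff.1 ((h k).nodeInv_mem hw1')
      rw [sub_sub_sub_cancel_left]
      linarith [(h k).pos])
    rw [sub_sub_sub_cancel_left, sub_eq_zero] at h2
    rw [← (h k).nodeCoord_nodeInv hw1, ← (h k).nodeCoord_nodeInv hw1', h2]
  minus_injOn k w hw w' hw' he := by
    have hw1 := (mem_ball_zero_iff.1 hw).trans_le hε
    have hw1' := (mem_ball_zero_iff.1 hw').trans_le hε
    have h1 := GoodParams.toTorus_eq_iff.1 he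
    have h2 := (h k).eq_zero_of_mem h1 (by
      have := norm_sub_le (nodeInv (x.pt k) ρ w) (nodeInv (x.pt k) ρ w')
      have h3 := mem_ball_zero_iff.1 ((h k).nodeInv_mem hw1)
      have h4 := mem_ball_zero_iff.1 ((h k).nodeInv_mem hw1')
      linarith [(h k).pos])
    rw [sub_eq_zero] at h2
    rw [← (h k).nodeCoord_nodeInv hw1, ← (h k).nodeCoord_nodeInv hw1', h2]
  disjoint k := by
    rw [Set.disjoint_left]
    rintro _ ⟨w, hw, rfl⟩ ⟨w', hw', he⟩
    have h3 := mem_ball_zero_iff.1 ((h k).nodeInv_mem ((mem_ball_zero_iff.1 hw).trans_le hε))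
    have h4 := mem_ball_zero_iff.1 ((h k).nodeInv_mem ((mem_ball_zero_iff.1 hw').trans_le hε))
    have h5 := (h k).sep_v _ (neg_mem (GoodParams.toTorus_eq_iff.1 he))
    have h6 : (x.pt k).v - -(nodeInv (x.pt k) ρ w' - (x.v k - nodeInv (x.pt k) ρ w)) =
        nodeInv (x.pt k) ρ w' + nodeInv (x.pt k) ρ w := by
      change x.v k - _ = _
      ring
    rw [h6] at h5
    linarith [norm_add_le (nodeInv (x.pt k) ρ w') (nodeInv (x.pt k) ρ w), (h k).pos]

/-! ### Circle integrals depending on a parameter -/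

theorem hasDerivAt_circleIntegral {K K' : ℂ → ℂ → ℂ} {U : Set ℂ} {z₀ : ℂ} {r : ℝ} (hr : 0 ≤ r)
    (hU : IsOpen U) (hz₀ : z₀ ∈ U)
    (hd : ∀ z ∈ U, ∀ p ∈ sphere (0 : ℂ) r, HasDerivAt (fun z => K z p) (K' z p) z)
    (hK : ∀ z ∈ U, ContinuousOn (K z) (sphere 0 r))
    (hK' : ContinuousOn (fun w : ℂ × ℂ => K' w.1 w.2) (U ×ˢ sphere 0 r)) :
    HasDerivAt (fun z => ∮ p in C(0, r), K z p) (∮ p in C(0, r), K' z₀ p) z₀ := by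
  obtain ⟨δ, hδ, hball⟩ := Metric.nhds_basis_closedBall.mem_iff.1 (hU.mem_nhds hz₀)
  obtain ⟨C, hC⟩ := ((isCompact_closedBall z₀ δ).prod (isCompact_sphere (0 : ℂ) r)).exists_bound_of_continuousOn
    (hK'.mono (prod_mono hball subset_rfl))
  have hs θ : circleMap 0 r θ ∈ sphere (0 : ℂ) r := circleMap_mem_sphere 0 hr θ
  have hm : Continuous fun θ => deriv (circleMap (0 : ℂ) r) θ := by
    simp only [deriv_circleMap]
    fun_prop
  have hcK z (hz : z ∈ U) : Continuous fun θ => deriv (circleMap 0 r) θ • K z (circleMap 0 r θ) := by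
    simp only [smul_eq_mul]
    exact hm.mul ((hK z hz).comp_continuous (continuous_circleMap 0 r) hs)
  have hcK' : Continuous fun θ => deriv (circleMap 0 r) θ • K' z₀ (circleMap 0 r θ) := by
    simp only [smul_eq_mul]
    exact hm.mul (hK'.comp_continuous (f := fun θ => (z₀, circleMap 0 r θ))
      (by fun_prop) fun θ => ⟨hz₀, hs θ⟩)
  refine (intervalIntegral.hasDerivAt_integral_of_dominated_loc_of_deriv_le
    (F := fun z θ => deriv (circleMap 0 r) θ • K z (circleMap 0 r θ))
    (F' := fun z θ => deriv (circleMap 0 r) θ • K' z (circleMap 0 r θ))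
    (bound := fun _ => r * C) (ball_mem_nhds z₀ hδ) ?_ ((hcK z₀ hz₀).intervalIntegrable _ _)
    hcK'.aestronglyMeasurable ?_ intervalIntegrable_const ?_).2
  · filter_upwards [hU.mem_nhds hz₀] with z hz
    exact (hcK z hz).aestronglyMeasurable
  · refine Eventually.of_forall fun θ _ z hz => ?_
    rw [norm_smul, deriv_circleMap, norm_mul, norm_I, mul_one, norm_circleMap_zero, abs_of_nonneg hr]
    gcongr
    exact hC (z, circleMap 0 r θ) ⟨ball_subset_closedBall hz, hs θ⟩
  · refine Eventually.of_forall fun θ _ z hz => ?_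
    simp only [smul_eq_mul]
    exact (hd z (hball (ball_subset_closedBall hz)) _ (hs θ)).const_mul _

/-- Cauchy's formula on an annulus. The slope (f(p) - f(s))/(p - s) extends continuously to s and is
holomorphic elsewhere, so its two integrals agree. What remains is f(s) ∮ dp/(p - s), equal to 2πi
f(s) on the outer circle and to 0 on the inner one. -/
theorem circleIntegral_annulus_sub_inv {f : ℂ → ℂ} {r R : ℝ} {s : ℂ} (hr : 0 < r)
    (hf : DifferentiableOn ℂ f (closedBall 0 R \ ball 0 r)) (hs : r < ‖s‖) (hs' : ‖s‖ < R) :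
    (∮ p in C(0, R), f p / (p - s)) - ∮ p in C(0, r), f p / (p - s) =
      2 * Real.pi * I * f s := by
  have hs0 : closedBall (0 : ℂ) R \ ball 0 r ∈ 𝓝 s := by
    refine mem_of_superset ((isOpen_ball.sdiff isClosed_closedBall).mem_nhds
      (s := ball (0 : ℂ) R \ closedBall 0 r) ⟨by simpa using hs', by simpa using hs⟩) ?_
    exact sdiff_subset_sdiff ball_subset_closedBall ball_subset_closedBall
  have hsphere {c : ℝ} (h1 : r ≤ c) (h2 : c ≤ R) :
      sphere (0 : ℂ) c ⊆ closedBall (0 : ℂ) R \ ball 0 r := fun p hp => by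
    rw [mem_sphere_zero_iff_norm] at hp
    simp [hp, h1, h2]
  have hle : r ≤ R := (hs.trans hs').le
  have hfs : DifferentiableAt ℂ f s := (hf s (mem_of_mem_nhds hs0)).differentiableAt hs0
  have hd : ContinuousOn (dslope f s) (closedBall 0 R \ ball 0 r) :=
    (continuousOn_dslope hs0).2 ⟨hf.continuousOn, hfs⟩
  have h1 := circleIntegral_eq_of_differentiable_on_annulus_off_countable hr hle
    (countable_singleton s) hd fun z hz => by
      refine (differentiableAt_dslope_of_ne hz.2).2 ((hf z ?_).differentiableAt ?_)
      · exact sdiff_subset_sdiff ball_subset_closedBall ball_subset_closedBall hz.1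
      · exact mem_of_superset ((isOpen_ball.sdiff isClosed_closedBall).mem_nhds hz.1)
          (sdiff_subset_sdiff ball_subset_closedBall ball_subset_closedBall)
  have hci {c : ℝ} (h1 : r ≤ c) (h2 : c ≤ R) (hne : ‖s‖ ≠ c) :
      (∮ p in C(0, c), f p / (p - s)) =
        (∮ p in C(0, c), dslope f s p) + f s * ∮ p in C(0, c), (p - s)⁻¹ := by
    have hc : 0 ≤ c := hr.le.trans h1
    have hps : ∀ p ∈ sphere (0 : ℂ) c, p - s ≠ 0 := fun p hp he => by
      rw [mem_sphere_zero_iff_norm, sub_eq_zero.1 he] at hp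
      exact hne hp
    rw [← circleIntegral.integral_const_mul, ← circleIntegral.integral_add]
    · refine circleIntegral.integral_congr hc fun p hp => ?_
      have := hps p hp
      rw [dslope_of_ne _ (sub_ne_zero.1 this), slope_def_field]
      field_simp
      ring
    · exact (hd.mono (hsphere h1 h2)).circleIntegrable hc
    · refine (continuousOn_const.mul (ContinuousOn.inv₀ ?_ hps)).circleIntegrable hc
      fun_prop
  rw [hci hle le_rfl hs'.ne, hci le_rfl hle hs.ne', h1,
    circleIntegral.integral_sub_inv_of_mem_ball (by simpa using hs')]
  rw [circleIntegral_eq_zero_of_differentiable_on_off_countable hr.le countable_empty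
    (f := fun p => (p - s)⁻¹)]
  · ring
  · refine ContinuousOn.inv₀ (by fun_prop) fun p hp he => ?_
    rw [mem_closedBall_zero_iff, sub_eq_zero.1 he] at hp
    linarith
  · intro p hp
    refine DifferentiableAt.inv (by fun_prop) fun he => ?_
    have := hp.1
    rw [mem_ball_zero_iff, sub_eq_zero.1 he] at this
    linarith

theorem circleIntegral_eq_of_annulus {f : ℂ → ℂ} {r R : ℝ} (hr : 0 < r) (hle : r ≤ R)
    (hf : DifferentiableOn ℂ f (closedBall 0 R \ ball 0 r)) :
    (∮ p in C(0, R), f p) = ∮ p in C(0, r), f p :=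
  circleIntegral_eq_of_differentiable_on_annulus_off_countable hr hle countable_empty
    hf.continuousOn fun z hz => (hf z (sdiff_subset_sdiff ball_subset_closedBall
      ball_subset_closedBall hz.1)).differentiableAt
      (mem_of_superset ((isOpen_ball.sdiff isClosed_closedBall).mem_nhds hz.1)
        (sdiff_subset_sdiff ball_subset_closedBall ball_subset_closedBall))

/-! ### Nodes of one torus -/

/-- The orientation of the local parameter: `1` at the node `0` and `-1` at the node `v`. -/
def sgn (σ : Bool) : ℂ := if σ then -1 else 1

/-- The nodes `0` and `v` of a torus. -/
def ctr (q : TorusParams) (σ : Bool) : ℂ := if σ then q.v else 0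

/-- The local parametrization `s ↦ s` near `0` and `s ↦ v - s` near `v`. -/
def nodePt (q : TorusParams) (σ : Bool) (s : ℂ) : ℂ := ctr q σ + sgn σ * s

@[simp] theorem sgn_mul_self (σ : Bool) : sgn σ * sgn σ = 1 := by cases σ <;> simp [sgn]

theorem sgn_ne_zero (σ : Bool) : sgn σ ≠ 0 := by cases σ <;> simp [sgn]

@[simp] theorem norm_sgn (σ : Bool) : ‖sgn σ‖ = 1 := by cases σ <;> simp [sgn]

theorem hasDerivAt_nodePt (q : TorusParams) (σ : Bool) (s : ℂ) :
    HasDerivAt (nodePt q σ) (sgn σ) s :=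
  (((hasDerivAt_id s).const_mul (sgn σ)).const_add (ctr q σ)).congr_deriv (mul_one _)

theorem continuous_nodePt (q : TorusParams) (σ : Bool) : Continuous (nodePt q σ) := by
  unfold nodePt
  fun_prop

theorem gaussT_nodePt (q : TorusParams) (σ : Bool) (s : ℂ) :
    gaussT (nodePt q σ s) q = gaussT s q := by
  cases σ
  · simp [nodePt, sgn, ctr]
  · rw [← gaussT_symm s q]
    simp [nodePt, sgn, ctr, sub_eq_add_neg]

theorem exists_nodePt_eq (q : TorusParams) (σ : Bool) (z : ℂ) :
    nodePt q σ (sgn σ * (z - ctr q σ)) = z := by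
  rw [nodePt, ← mul_assoc, sgn_mul_self]
  ring

theorem nodePt_sub_notMem {q : TorusParams} {ρ : ℝ} (h : GoodParams q ρ) {σ σ' : Bool} {s p : ℂ}
    (hs : ‖s‖ < ρ) (hp : ‖p‖ < ρ) (hne : σ = σ' → s ≠ p) :
    nodePt q σ s - nodePt q σ' p ∉ latticeOf q.tau := by
  intro hu
  have hsp : ‖s - p‖ < 4 * ρ := by linarith [norm_sub_le s p, h.pos]
  have hsp' : ‖s + p‖ < 4 * ρ := by linarith [norm_add_le s p, h.pos]
  have hv u (hu : u ∈ latticeOf q.tau) : ¬ ‖q.v - u‖ < 4 * ρ := not_lt.2 (h.sep_v u hu)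
  cases σ <;> cases σ' <;> simp [nodePt, sgn, ctr] at hu hne
  · exact hne (sub_eq_zero.1 (h.eq_zero_of_mem hu hsp))
  · refine hv _ (neg_mem hu) ?_
    convert hsp' using 2
    ring
  · refine hv _ hu ?_
    convert hsp' using 2
    ring
  · have := h.eq_zero_of_mem (neg_mem hu) (by convert hsp using 2; ring)
    refine hne (sub_eq_zero.1 ?_)
    rw [← this]
    ring

theorem latticeOf_induction {τ : ℂ} {P : ℂ → Prop} {f : ℂ → ℂ}
    (hP : ∀ u ∈ latticeOf τ, ∀ z, P z → P (z + u)) (h1 : ∀ z, P z → f (z + 1) = f z)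
    (h2 : ∀ z, P z → f (z + τ) = f z) {u : ℂ} (hu : u ∈ latticeOf τ) :
    ∀ z, P z → f (z + u) = f z := by
  induction hu using AddSubgroup.closure_induction with
  | mem u hu =>
    rcases hu with rfl | rfl
    · exact h1
    · exact h2
  | zero => simp
  | add u u' hu hu' ih ih' =>
    intro z hz
    rw [← add_assoc, ih' _ (hP u hu z hz), ih z hz]
  | neg u hu ih =>
    intro z hz
    have := ih (z + -u) (hP _ (neg_mem hu) z hz)
    rw [neg_add_cancel_right] at this
    exact this.symm

theorem sub_notMem_add {τ z w u : ℂ} (hz : z - w ∉ latticeOf τ) (hu : u ∈ latticeOf τ) :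
    z + u - w ∉ latticeOf τ := by
  rw [add_sub_right_comm]
  exact add_notMem hz hu

theorem gaussT_add_mem {q : TorusParams} (hτ : 0 < q.tau.im) {u : ℂ} (hu : u ∈ latticeOf q.tau)
    {z : ℂ} (hz : z ∉ latticeOf q.tau) (hzv : z - q.v ∉ latticeOf q.tau) :
    gaussT (z + u) q = gaussT z q := by
  refine latticeOf_induction (P := fun z => z ∉ latticeOf q.tau ∧ z - q.v ∉ latticeOf q.tau)
    (f := fun z => gaussT z q)
    (fun u hu z hz => ⟨add_notMem hz.1 hu, sub_notMem_add hz.2 hu⟩) (fun z hz => ?_)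
    (fun z hz => ?_) hu z ⟨hz, hzv⟩
  · simp only [gaussT]
    rw [add_sub_right_comm, wZeta_add_one hτ hz.1, wZeta_add_one hτ hz.2]
    ring
  · simp only [gaussT]
    rw [add_sub_right_comm, wZeta_add_tau hτ hz.1, wZeta_add_tau hτ hz.2]
    ring

/-- The points off the circles of radius `r` around the nodes. -/
def offCircles (q : TorusParams) (r : ℝ) : Set ℂ :=
  {z | ∀ σ, ∀ p ∈ sphere (0 : ℂ) r, z - nodePt q σ p ∉ latticeOf q.tau}

/-- The points outside the closed disks of radius `r` around the nodes. -/
def outer (q : TorusParams) (r : ℝ) : Set ℂ :=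
  {z | ∀ σ, ∀ p ∈ closedBall (0 : ℂ) r, z - nodePt q σ p ∉ latticeOf q.tau}

open scoped Pointwise in
theorem isOpen_sub_notMem {τ : ℂ} (hτ : 0 < τ.im) {S : Set ℂ} (hS : IsCompact S) :
    IsOpen {z | ∀ p ∈ S, z - p ∉ latticeOf τ} := by
  have h : {z | ∀ p ∈ S, z - p ∉ latticeOf τ} = ((latticeOf τ : Set ℂ) + S)ᶜ := by
    ext z
    simp only [mem_ofPred_eq, mem_compl_iff, Set.mem_add, not_exists, not_and]
    refine ⟨fun h u hu p hp he => h p hp ?_, fun h p hp hu => h _ hu p hp (by ring)⟩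
    rw [← he, add_sub_cancel_right]
    exact hu
  rw [h]
  exact ((isClosed_latticeOf hτ).add_right_of_isCompact hS).isOpen_compl

theorem isOpen_nodes {q : TorusParams} (hτ : 0 < q.tau.im) {S : Set ℂ} (hS : IsCompact S) :
    IsOpen {z | ∀ σ, ∀ p ∈ S, z - nodePt q σ p ∉ latticeOf q.tau} := by
  have h : {z | ∀ σ, ∀ p ∈ S, z - nodePt q σ p ∉ latticeOf q.tau} =
      ⋂ σ, {z | ∀ p ∈ nodePt q σ '' S, z - p ∉ latticeOf q.tau} := by
    ext z
    simp
  rw [h]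
  exact isOpen_iInter_of_finite fun σ =>
    isOpen_sub_notMem hτ (hS.image (continuous_nodePt q σ))

theorem isOpen_offCircles {q : TorusParams} (hτ : 0 < q.tau.im) (r : ℝ) :
    IsOpen (offCircles q r) := isOpen_nodes hτ (isCompact_sphere 0 r)

theorem isOpen_outer {q : TorusParams} (hτ : 0 < q.tau.im) (r : ℝ) :
    IsOpen (outer q r) := isOpen_nodes hτ (isCompact_closedBall 0 r)

theorem outer_subset (q : TorusParams) (r : ℝ) : outer q r ⊆ offCircles q r :=
  fun _ hz σ p hp => hz σ p (sphere_subset_closedBall hp)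

theorem add_mem_offCircles {q : TorusParams} {r : ℝ} {u z : ℂ} (hu : u ∈ latticeOf q.tau)
    (hz : z ∈ offCircles q r) : z + u ∈ offCircles q r :=
  fun σ p hp => sub_notMem_add (hz σ p hp) hu

theorem add_mem_outer {q : TorusParams} {r : ℝ} {u z : ℂ} (hu : u ∈ latticeOf q.tau)
    (hz : z ∈ outer q r) : z + u ∈ outer q r :=
  fun σ p hp => sub_notMem_add (hz σ p hp) hu

theorem nodePt_mem_offCircles {q : TorusParams} {ρ r : ℝ} (h : GoodParams q ρ) (hr : r < ρ)
    {σ : Bool} {s : ℂ} (hs : ‖s‖ < ρ) (hsr : ‖s‖ ≠ r) : nodePt q σ s ∈ offCircles q r := by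
  intro σ' p hp
  rw [mem_sphere_zero_iff_norm] at hp
  exact nodePt_sub_notMem h hs (hp ▸ hr) fun _ he => hsr (he ▸ hp)

/-! ### Convolution with the zeta function over the circles around the nodes -/

/-- The function `∑_σ 1/(2πi) ∮ ζ(z - p) f_σ(p) dp` on the torus. -/
def nodeConv (q : TorusParams) (f : Bool → ℂ → ℂ) (r : ℝ) (z : ℂ) : ℂ :=
  ∑ σ, (2 * Real.pi * I)⁻¹ * ∮ p in C(0, r), wZeta (z - nodePt q σ p) q.tau * f σ p

/-- The sum `∑_σ 1/(2πi) ∮ f_σ(p) dp`. -/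
def nodePeriod (f : Bool → ℂ → ℂ) (r : ℝ) : ℂ :=
  ∑ σ, (2 * Real.pi * I)⁻¹ * ∮ p in C(0, r), f σ p

theorem differentiableOn_wZeta {τ : ℂ} (hτ : 0 < τ.im) :
    DifferentiableOn ℂ (fun z => wZeta z τ) (latticeOf τ : Set ℂ)ᶜ :=
  fun _ hz => (hasDerivAt_wZeta hτ hz).differentiableAt.differentiableWithinAt

theorem continuousOn_wZeta_nodePt {q : TorusParams} (hτ : 0 < q.tau.im) {r : ℝ} {z : ℂ}
    (hz : z ∈ offCircles q r) (σ : Bool) :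
    ContinuousOn (fun p => wZeta (z - nodePt q σ p) q.tau) (sphere 0 r) :=
  (differentiableOn_wZeta hτ).continuousOn.comp
    (continuous_const.sub (continuous_nodePt q σ)).continuousOn fun p hp => hz σ p hp

theorem nodeConv_add {q : TorusParams} (hτ : 0 < q.tau.im) {f : Bool → ℂ → ℂ} {r : ℝ}
    (hr : 0 ≤ r) (hf : ∀ σ, ContinuousOn (f σ) (sphere 0 r)) {u η : ℂ}
    (hu : ∀ z ∉ latticeOf q.tau, wZeta (z + u) q.tau = wZeta z q.tau + η) {z : ℂ}
    (hz : z ∈ offCircles q r) :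
    nodeConv q f r (z + u) = nodeConv q f r z + η * nodePeriod f r := by
  simp only [nodeConv, nodePeriod]
  rw [Finset.mul_sum, ← Finset.sum_add_distrib]
  refine Finset.sum_congr rfl fun σ _ => ?_
  have h1 : (∮ p in C(0, r), wZeta (z + u - nodePt q σ p) q.tau * f σ p) =
      ∮ p in C(0, r), (wZeta (z - nodePt q σ p) q.tau * f σ p + η * f σ p) := by
    refine circleIntegral.integral_congr hr fun p hp => ?_
    rw [add_sub_right_comm, hu _ (hz σ p hp)]
    ring
  rw [h1, circleIntegral.integral_add, circleIntegral.integral_const_mul]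
  · ring
  · exact ((continuousOn_wZeta_nodePt hτ hz σ).mul (hf σ)).circleIntegrable hr
  · exact (continuousOn_const.mul (hf σ)).circleIntegrable hr

theorem hasDerivAt_nodeConv_aux {q : TorusParams} (hτ : 0 < q.tau.im) {f : Bool → ℂ → ℂ} {r : ℝ}
    (hr : 0 ≤ r) (hf : ∀ σ, ContinuousOn (f σ) (sphere 0 r)) {z : ℂ} (hz : z ∈ offCircles q r) :
    HasDerivAt (nodeConv q f r) (∑ σ, (2 * Real.pi * I)⁻¹ * ∮ p in C(0, r),
      deriv (fun z => wZeta z q.tau) (z - nodePt q σ p) * f σ p) z := by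
  unfold nodeConv
  refine HasDerivAt.fun_sum fun σ _ => HasDerivAt.const_mul _ ?_
  refine hasDerivAt_circleIntegral (K := fun z p => wZeta (z - nodePt q σ p) q.tau * f σ p)
    (K' := fun z p => deriv (fun z => wZeta z q.tau) (z - nodePt q σ p) * f σ p) hr
    (isOpen_offCircles hτ r) hz (fun w hw p hp => ?_)
    (fun w hw => (continuousOn_wZeta_nodePt hτ hw σ).mul (hf σ)) ?_
  · exact ((hasDerivAt_wZeta hτ (hw σ p hp)).differentiableAt.hasDerivAt.comp_sub_const w
      (nodePt q σ p)).mul_const _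
  · refine ContinuousOn.mul ?_ ((hf σ).comp continuousOn_snd fun w hw => hw.2)
    refine ((differentiableOn_wZeta hτ).deriv
      (isClosed_latticeOf hτ).isOpen_compl).continuousOn.comp ?_ fun w hw => hw.1 σ w.2 hw.2
    exact (continuous_fst.sub ((continuous_nodePt q σ).comp continuous_snd)).continuousOn

/-- The z-derivative of ζ(z - nodePt p) is -sgn times its p-derivative, so integration by parts over
the closed circle moves the derivative to f. -/
theorem hasDerivAt_nodeConv {q : TorusParams} (hτ : 0 < q.tau.im) {f f' : Bool → ℂ → ℂ} {r : ℝ}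
    (hr : 0 ≤ r) (hf : ∀ σ, ∀ p ∈ sphere (0 : ℂ) r, HasDerivAt (f σ) (f' σ p) p)
    (hf' : ∀ σ, ContinuousOn (f' σ) (sphere 0 r)) {z : ℂ} (hz : z ∈ offCircles q r) :
    HasDerivAt (nodeConv q (fun σ p => sgn σ * f σ p) r) (nodeConv q f' r z) z := by
  have hfc σ : ContinuousOn (f σ) (sphere 0 r) :=
    fun p hp => (hf σ p hp).continuousAt.continuousWithinAt
  convert! hasDerivAt_nodeConv_aux hτ hr (f := fun σ p => sgn σ * f σ p)
    (fun σ => continuousOn_const.mul (hfc σ)) hz using 1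
  refine Finset.sum_congr rfl fun σ _ => ?_
  congr 1
  rw [← sub_eq_zero, ← circleIntegral.integral_sub]
  · refine circleIntegral.integral_eq_zero_of_hasDerivWithinAt
      (f := fun p => wZeta (z - nodePt q σ p) q.tau * f σ p) hr fun p hp => ?_
    have h1 := (hasDerivAt_wZeta hτ (hz σ p hp)).differentiableAt.hasDerivAt.comp p
      ((hasDerivAt_nodePt q σ p).const_sub z)
    have h2 := h1.mul (hf σ p hp)
    refine (h2.congr_deriv ?_).hasDerivWithinAt
    simp only [Function.comp_apply]
    ring
  · exact ((continuousOn_wZeta_nodePt hτ hz σ).mul (hf' σ)).circleIntegrable hr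
  · refine (ContinuousOn.mul ?_ (continuousOn_const.mul (hfc σ))).circleIntegrable hr
    exact ((differentiableOn_wZeta hτ).deriv
      (isClosed_latticeOf hτ).isOpen_compl).continuousOn.comp
      (continuous_const.sub (continuous_nodePt q σ)).continuousOn fun p hp => hz σ p hp

/-! ### Gluing the two convolutions on one torus -/

theorem GoodParams.mem_zetaRegDomain {q : TorusParams} {ρ : ℝ} (h : GoodParams q ρ) {x : ℂ}
    (hx : ‖x‖ < 4 * ρ) : (x, q.tau) ∈ zetaRegDomain :=
  ⟨h.im_pos, fun p he => by
    have := h.sep p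
    rw [← he] at this
    linarith⟩

/-- Primitives `Ψ σ` of `dΨ σ` on a neighbourhood `A` of the annulus `r₁ ≤ |s| ≤ r₃`, where `s` is
the local parameter at the node `σ`. -/
structure NeckData (q : TorusParams) (ρ r₁ r₃ : ℝ) (A : Set ℂ) (Ψ dΨ : Bool → ℂ → ℂ) : Prop where
  good : GoodParams q ρ
  pos : 0 < r₁
  lt : r₁ < r₃
  lt_rho : r₃ < ρ
  isOpen : IsOpen A
  zero_notMem : (0 : ℂ) ∉ A
  annulus_subset : closedBall 0 r₃ \ ball 0 r₁ ⊆ A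
  hasDerivAt : ∀ σ, ∀ s ∈ A, HasDerivAt (Ψ σ) (dΨ σ s) s

/-- The points of the torus at which the glued function is defined. -/
def gluedDomain (q : TorusParams) (r₁ r₃ : ℝ) (A : Set ℂ) : Set ℂ :=
  outer q r₁ ∪ {z | ∃ σ, ∃ s ∈ A, ‖s‖ < r₃ ∧ ∃ u ∈ latticeOf q.tau, nodePt q σ s + u = z}

open Classical in
/-- The function equal to the convolution at radius `r₁` outside the disks of radius `r₁`, and to
the convolution at radius `r₃` plus `Ψ` near the nodes. -/
def glued (q : TorusParams) (ρ r₁ r₃ : ℝ) (Ψ : Bool → ℂ → ℂ) (z : ℂ) : ℂ :=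
  if z ∈ outer q r₁ then nodeConv q (fun σ p => sgn σ * Ψ σ p) r₁ z
  else nodeConv q (fun σ p => sgn σ * Ψ σ p) r₃ z +
    if h : ∃ w : Bool × ℂ, ‖w.2‖ < ρ ∧ z - nodePt q w.1 w.2 ∈ latticeOf q.tau then
      Ψ h.choose.1 h.choose.2 else 0

/-- Integration by parts removes the primitive, whose choice is not controlled, from the formula for
the quasi-periods. Only its derivative, which depends smoothly on the parameters, remains. -/
theorem nodePeriod_by_parts {f f' : Bool → ℂ → ℂ} {r : ℝ} (hr : 0 ≤ r)
    (hf : ∀ σ, ∀ p ∈ sphere (0 : ℂ) r, HasDerivAt (f σ) (f' σ p) p)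
    (hf' : ∀ σ, ContinuousOn (f' σ) (sphere 0 r)) :
    nodePeriod (fun σ p => sgn σ * f σ p) r = nodePeriod (fun σ p => -(sgn σ * p) * f' σ p) r := by
  have hfc σ : ContinuousOn (f σ) (sphere 0 r) :=
    fun p hp => (hf σ p hp).continuousAt.continuousWithinAt
  refine Finset.sum_congr rfl fun σ _ => ?_
  congr 1
  rw [← sub_eq_zero, ← circleIntegral.integral_sub]
  · refine circleIntegral.integral_eq_zero_of_hasDerivWithinAt
      (f := fun p => sgn σ * (p * f σ p)) hr fun p hp => ?_
    have h2 := ((hasDerivAt_id p).mul (hf σ p hp)).const_mul (sgn σ)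
    refine (h2.congr_deriv ?_).hasDerivWithinAt
    simp only [id]
    ring
  · exact (continuousOn_const.mul (hfc σ)).circleIntegrable hr
  · refine (ContinuousOn.mul ?_ (hf' σ)).circleIntegrable hr
    fun_prop

/-! ### The glued function: jump, derivative and quasi-periods -/

namespace NeckData

variable {q : TorusParams} {ρ r₁ r₃ : ℝ} {A : Set ℂ} {Ψ dΨ : Bool → ℂ → ℂ}

theorem sphere_subset (h : NeckData q ρ r₁ r₃ A Ψ dΨ) {r : ℝ} (h1 : r₁ ≤ r) (h3 : r ≤ r₃) :
    sphere (0 : ℂ) r ⊆ A := fun p hp => by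
  rw [mem_sphere_zero_iff_norm] at hp
  refine h.annulus_subset ?_
  simp [hp, h1, h3]

theorem differentiableOn (h : NeckData q ρ r₁ r₃ A Ψ dΨ) (σ : Bool) : DifferentiableOn ℂ (Ψ σ) A :=
  fun s hs => (h.hasDerivAt σ s hs).differentiableAt.differentiableWithinAt

theorem continuousOn_deriv (h : NeckData q ρ r₁ r₃ A Ψ dΨ) (σ : Bool) : ContinuousOn (dΨ σ) A :=
  ((h.differentiableOn σ).deriv h.isOpen).continuousOn.congr
    fun s hs => (h.hasDerivAt σ s hs).deriv.symm

theorem nodePeriod_eq (h : NeckData q ρ r₁ r₃ A Ψ dΨ) :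
    nodePeriod (fun σ p => sgn σ * Ψ σ p) r₃ = nodePeriod (fun σ p => sgn σ * Ψ σ p) r₁ := by
  refine Finset.sum_congr rfl fun σ _ => ?_
  rw [circleIntegral_eq_of_annulus h.pos h.lt.le]
  exact ((h.differentiableOn σ).mono h.annulus_subset).const_mul _

theorem mem_offCircles (h : NeckData q ρ r₁ r₃ A Ψ dΨ) {σ : Bool} {s u : ℂ} (hs : ‖s‖ < r₃)
    (hu : u ∈ latticeOf q.tau) : nodePt q σ s + u ∈ offCircles q r₃ :=
  add_mem_offCircles hu (nodePt_mem_offCircles h.good h.lt_rho (hs.trans h.lt_rho) hs.ne)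

theorem conv_add (h : NeckData q ρ r₁ r₃ A Ψ dΨ) {r : ℝ} (h1 : r₁ ≤ r) (h3 : r ≤ r₃) {u η : ℂ}
    (hu : ∀ z ∉ latticeOf q.tau, wZeta (z + u) q.tau = wZeta z q.tau + η) {z : ℂ}
    (hz : z ∈ offCircles q r) :
    nodeConv q (fun σ p => sgn σ * Ψ σ p) r (z + u) =
      nodeConv q (fun σ p => sgn σ * Ψ σ p) r z + η * nodePeriod (fun σ p => sgn σ * Ψ σ p) r :=
  nodeConv_add h.good.im_pos (h.pos.le.trans h1)
    (fun σ => continuousOn_const.mul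
      ((h.differentiableOn σ).continuousOn.mono (h.sphere_subset h1 h3))) hu hz

/-- The two convolutions differ by the residue of the kernel at p = s. It occurs only for the node
at which the point lies, and the factor `sgn σ` in the density cancels the orientation of the local
parameter. -/
theorem conv_eq_aux (h : NeckData q ρ r₁ r₃ A Ψ dΨ) {σ : Bool} {s : ℂ} (hs : r₁ < ‖s‖)
    (hs' : ‖s‖ < r₃) :
    nodeConv q (fun σ p => sgn σ * Ψ σ p) r₁ (nodePt q σ s) =
      nodeConv q (fun σ p => sgn σ * Ψ σ p) r₃ (nodePt q σ s) + Ψ σ s := by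
  have hΨ σ := (h.differentiableOn σ).mono h.annulus_subset
  have hpρ {p : ℂ} (hp : p ∈ closedBall (0 : ℂ) r₃ \ ball 0 r₁) : ‖p‖ < ρ :=
    (mem_closedBall_zero_iff.1 hp.1).trans_lt h.lt_rho
  have hπ : (2 * Real.pi * I : ℂ) ≠ 0 := by simp [Real.pi_ne_zero]
  have hdiff σ' : (2 * Real.pi * I)⁻¹ * (∮ p in C(0, r₁),
        wZeta (nodePt q σ s - nodePt q σ' p) q.tau * (sgn σ' * Ψ σ' p)) =
      (2 * Real.pi * I)⁻¹ * (∮ p in C(0, r₃),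
        wZeta (nodePt q σ s - nodePt q σ' p) q.tau * (sgn σ' * Ψ σ' p)) +
      if σ' = σ then Ψ σ s else 0 := by
    split_ifs with hσ
    · subst hσ
      -- N(x) = x ζ(x) is holomorphic at the differences involved, with N(0) = 1, so the integrand
      -- becomes -N Ψ/(p - s).
      set N : ℂ → ℂ := fun x => 1 + x * wZetaReg x q.tau with hN
      have hNd : DifferentiableOn ℂ (fun p => -(N (sgn σ' * (s - p)) * Ψ σ' p))
          (closedBall 0 r₃ \ ball 0 r₁) := by
        refine (DifferentiableOn.mul (fun p hp => ?_) (hΨ σ')).neg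
        have hx : ‖sgn σ' * (s - p)‖ < 4 * ρ := by
          rw [norm_mul, norm_sgn, one_mul]
          linarith [norm_sub_le s p, hpρ hp, h.lt_rho, h.good.pos]
        have h1 := (hasDerivAt_wZetaReg h.good.im_pos
          (h.good.mem_zetaRegDomain hx)).differentiableAt
        have h2 : DifferentiableAt ℂ (fun p => sgn σ' * (s - p)) p := by fun_prop
        have h3 : DifferentiableAt ℂ N (sgn σ' * (s - p)) :=
          (differentiableAt_id.mul h1).const_add 1
        exact (h3.comp p h2).differentiableWithinAt
      have key := circleIntegral_annulus_sub_inv h.pos hNd hs hs'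
      have hcong {r : ℝ} (hr : 0 ≤ r) (hne : ‖s‖ ≠ r) :
          (∮ p in C(0, r), wZeta (nodePt q σ' s - nodePt q σ' p) q.tau * (sgn σ' * Ψ σ' p)) =
          ∮ p in C(0, r), -(N (sgn σ' * (s - p)) * Ψ σ' p) / (p - s) := by
        refine circleIntegral.integral_congr hr fun p hp => ?_
        rw [mem_sphere_zero_iff_norm] at hp
        have hps : s - p ≠ 0 := fun he => hne (by rw [sub_eq_zero.1 he, hp])
        have hps' : p - s ≠ 0 := fun he => hps (by rw [← neg_sub, he, neg_zero])
        have e1 : nodePt q σ' s - nodePt q σ' p = sgn σ' * (s - p) := by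
          simp only [nodePt]
          ring
        have e2 : sgn σ' * (1 / (sgn σ' * (s - p))) = 1 / (s - p) := by
          field_simp [sgn_ne_zero]
        have e3 : 1 / (s - p) = -(1 / (p - s)) := by
          rw [← neg_sub p s, div_neg]
        rw [e1, wZeta_eq, hN]
        calc (1 / (sgn σ' * (s - p)) + wZetaReg (sgn σ' * (s - p)) q.tau) * (sgn σ' * Ψ σ' p) =
            (sgn σ' * (1 / (sgn σ' * (s - p))) + sgn σ' * wZetaReg (sgn σ' * (s - p)) q.tau) *
              Ψ σ' p := by ring
          _ = _ := by
            rw [e2]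
            field_simp
            ring
      rw [hcong h.pos.le hs.ne', hcong (h.pos.trans h.lt).le hs'.ne, sub_eq_iff_eq_add.1 key]
      simp only [hN, sub_self, mul_zero, zero_mul, add_zero, one_mul]
      field_simp
      ring
    -- At the other node the kernel has no pole on the annulus, so the two integrals agree.
    · rw [add_zero, circleIntegral_eq_of_annulus h.pos h.lt.le]
      intro p hp
      refine DifferentiableWithinAt.mul ?_ (((hΨ σ') p hp).const_mul _)
      have hne : nodePt q σ s - nodePt q σ' p ∉ latticeOf q.tau :=
        nodePt_sub_notMem h.good (hs'.trans h.lt_rho) (hpρ hp) fun he => absurd he.symm hσ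
      exact ((hasDerivAt_wZeta h.good.im_pos hne).comp p
        ((hasDerivAt_nodePt q σ' p).const_sub _)).differentiableAt.differentiableWithinAt
  simp only [nodeConv]
  rw [Finset.sum_congr rfl fun σ' _ => hdiff σ', Finset.sum_add_distrib]
  simp

/-- By `nodePeriod_eq` both convolutions have the same quasi-periods. Their difference is therefore
periodic, and the identity near the node carries over to all translates. -/
theorem conv_eq (h : NeckData q ρ r₁ r₃ A Ψ dΨ) {σ : Bool} {s u : ℂ} (hs : r₁ < ‖s‖)
    (hs' : ‖s‖ < r₃) (hu : u ∈ latticeOf q.tau) :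
    nodeConv q (fun σ p => sgn σ * Ψ σ p) r₁ (nodePt q σ s + u) =
      nodeConv q (fun σ p => sgn σ * Ψ σ p) r₃ (nodePt q σ s + u) + Ψ σ s := by
  rw [← sub_eq_iff_eq_add', ← sub_eq_iff_eq_add'.2 (h.conv_eq_aux (σ := σ) hs hs')]
  refine latticeOf_induction (P := fun z => z ∈ offCircles q r₁ ∧ z ∈ offCircles q r₃)
    (f := fun z => nodeConv q (fun σ p => sgn σ * Ψ σ p) r₁ z -
      nodeConv q (fun σ p => sgn σ * Ψ σ p) r₃ z)
    (fun u hu z hz => ⟨add_mem_offCircles hu hz.1, add_mem_offCircles hu hz.2⟩)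
    (fun z hz => ?_) (fun z hz => ?_) hu _ ⟨?_, ?_⟩
  · rw [h.conv_add le_rfl h.lt.le (fun z => wZeta_add_one h.good.im_pos) hz.1,
      h.conv_add h.lt.le le_rfl (fun z => wZeta_add_one h.good.im_pos) hz.2, h.nodePeriod_eq]
    ring
  · rw [h.conv_add le_rfl h.lt.le (fun z => wZeta_add_tau h.good.im_pos) hz.1,
      h.conv_add h.lt.le le_rfl (fun z => wZeta_add_tau h.good.im_pos) hz.2, h.nodePeriod_eq]
    ring
  · exact nodePt_mem_offCircles h.good (h.lt.trans h.lt_rho) (hs'.trans h.lt_rho) hs.ne'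
  · exact nodePt_mem_offCircles h.good h.lt_rho (hs'.trans h.lt_rho) hs'.ne

theorem glued_outer {z : ℂ} (hz : z ∈ outer q r₁) :
    glued q ρ r₁ r₃ Ψ z = nodeConv q (fun σ p => sgn σ * Ψ σ p) r₁ z := by
  rw [glued, if_pos hz]

/-- The local parameter and the node of a point near the nodes are unique, so the choice made in
`glued` is harmless. Where both definitions apply they agree by `conv_eq`. -/
theorem glued_near (h : NeckData q ρ r₁ r₃ A Ψ dΨ) {σ : Bool} {s u : ℂ} (hs : ‖s‖ < r₃)
    (hu : u ∈ latticeOf q.tau) : glued q ρ r₁ r₃ Ψ (nodePt q σ s + u) =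
      nodeConv q (fun σ p => sgn σ * Ψ σ p) r₃ (nodePt q σ s + u) + Ψ σ s := by
  by_cases hz : nodePt q σ s + u ∈ outer q r₁
  · rw [glued, if_pos hz, h.conv_eq _ hs hu]
    by_contra hle
    exact hz σ s (by simpa using not_lt.1 hle) (by simpa using hu)
  · rw [glued, if_neg hz]
    have hex : ∃ w : Bool × ℂ, ‖w.2‖ < ρ ∧ nodePt q σ s + u - nodePt q w.1 w.2 ∈ latticeOf q.tau :=
      ⟨(σ, s), hs.trans h.lt_rho, by simpa using hu⟩
    rw [dif_pos hex]
    have hw := hex.choose_spec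
    set w := hex.choose
    have h1 : nodePt q σ s - nodePt q w.1 w.2 ∈ latticeOf q.tau := by
      have := sub_mem hw.2 hu
      convert this using 1
      ring
    by_cases h2 : σ = w.1
    · by_cases h3 : s = w.2
      · rw [← h2, ← h3]
      · exact absurd h1 (nodePt_sub_notMem h.good (hs.trans h.lt_rho) hw.1 fun _ => h3)
    · exact absurd h1 (nodePt_sub_notMem h.good (hs.trans h.lt_rho) hw.1 fun h3 => absurd h3 h2)

theorem conv_hasDerivAt (h : NeckData q ρ r₁ r₃ A Ψ dΨ) {r : ℝ} (h1 : r₁ ≤ r) (h3 : r ≤ r₃) {z : ℂ}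
    (hz : z ∈ offCircles q r) :
    HasDerivAt (nodeConv q (fun σ p => sgn σ * Ψ σ p) r) (nodeConv q dΨ r z) z :=
  hasDerivAt_nodeConv h.good.im_pos (h.pos.le.trans h1)
    (fun σ p hp => h.hasDerivAt σ p (h.sphere_subset h1 h3 hp))
    (fun σ => (h.continuousOn_deriv σ).mono (h.sphere_subset h1 h3)) hz

theorem hasDerivAt_glued_outer (h : NeckData q ρ r₁ r₃ A Ψ dΨ) {z : ℂ} (hz : z ∈ outer q r₁) :
    HasDerivAt (glued q ρ r₁ r₃ Ψ) (nodeConv q dΨ r₁ z) z := by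
  refine (h.conv_hasDerivAt le_rfl h.lt.le (outer_subset q r₁ hz)).congr_of_eventuallyEq ?_
  filter_upwards [(isOpen_outer h.good.im_pos r₁).mem_nhds hz] with w hw
  exact glued_outer hw

theorem hasDerivAt_glued_near (h : NeckData q ρ r₁ r₃ A Ψ dΨ) {σ : Bool} {s u : ℂ} (hsA : s ∈ A)
    (hs : ‖s‖ < r₃) (hu : u ∈ latticeOf q.tau) :
    HasDerivAt (glued q ρ r₁ r₃ Ψ) (nodeConv q dΨ r₃ (nodePt q σ s + u) + sgn σ * dΨ σ s)
      (nodePt q σ s + u) := by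
  set z := nodePt q σ s + u with hz
  have hsz : sgn σ * (z - u - ctr q σ) = s := by
    rw [hz, nodePt]
    linear_combination s * sgn_mul_self σ
  have hd : HasDerivAt (fun w => sgn σ * (w - u - ctr q σ)) (sgn σ) z := by
    simpa using (((hasDerivAt_id z).sub_const u).sub_const (ctr q σ)).const_mul (sgn σ)
  have h1 := HasDerivAt.comp (h₂ := Ψ σ) z (by rw [hsz]; exact h.hasDerivAt σ s hsA) hd
  have h2 := (h.conv_hasDerivAt h.lt.le le_rfl (h.mem_offCircles (σ := σ) hs hu)).add h1
  refine (h2.congr_deriv (by ring)).congr_of_eventuallyEq ?_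
  have hc : ∀ᶠ w in 𝓝 z, ‖sgn σ * (w - u - ctr q σ)‖ < r₃ :=
    hd.continuousAt.norm.eventually (gt_mem_nhds (by simp only [hsz]; exact hs))
  filter_upwards [hc] with w hw
  have hw' : nodePt q σ (sgn σ * (w - u - ctr q σ)) + u = w := by
    rw [exists_nodePt_eq, sub_add_cancel]
  have := h.glued_near (σ := σ) hw hu
  rw [hw'] at this
  exact this

theorem isOpen_gluedDomain (h : NeckData q ρ r₁ r₃ A Ψ dΨ) : IsOpen (gluedDomain q r₁ r₃ A) := by
  refine (isOpen_outer h.good.im_pos r₁).union ?_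
  have : {z | ∃ σ, ∃ s ∈ A, ‖s‖ < r₃ ∧ ∃ u ∈ latticeOf q.tau, nodePt q σ s + u = z} =
      ⋃ σ, ⋃ u ∈ latticeOf q.tau, (fun z => sgn σ * (z - u - ctr q σ)) ⁻¹' (A ∩ ball 0 r₃) := by
    ext z
    simp only [mem_ofPred_eq, mem_iUnion, mem_preimage, mem_inter_iff, mem_ball_zero_iff]
    constructor
    · rintro ⟨σ, s, hsA, hs, u, hu, rfl⟩
      have hsz : sgn σ * (nodePt q σ s + u - u - ctr q σ) = s := by
        rw [nodePt]
        linear_combination s * sgn_mul_self σ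
      exact ⟨σ, u, hu, by rwa [hsz], by rwa [hsz]⟩
    · rintro ⟨σ, u, hu, hA, hn⟩
      exact ⟨σ, _, hA, hn, u, hu, by rw [exists_nodePt_eq, sub_add_cancel]⟩
  rw [this]
  exact isOpen_iUnion fun σ => isOpen_biUnion fun u _ =>
    (h.isOpen.inter isOpen_ball).preimage (by fun_prop)

theorem differentiableAt_glued (h : NeckData q ρ r₁ r₃ A Ψ dΨ) {z : ℂ}
    (hz : z ∈ gluedDomain q r₁ r₃ A) : DifferentiableAt ℂ (glued q ρ r₁ r₃ Ψ) z := by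
  rcases hz with hz | ⟨σ, s, hsA, hs, u, hu, rfl⟩
  · exact (h.hasDerivAt_glued_outer hz).differentiableAt
  · exact (h.hasDerivAt_glued_near hsA hs hu).differentiableAt

theorem add_mem_gluedDomain {z u : ℂ} (hz : z ∈ gluedDomain q r₁ r₃ A) (hu : u ∈ latticeOf q.tau) :
    z + u ∈ gluedDomain q r₁ r₃ A := by
  rcases hz with hz | ⟨σ, s, hsA, hs, u', hu', rfl⟩
  · exact Or.inl (add_mem_outer hu hz)
  · exact Or.inr ⟨σ, s, hsA, hs, u' + u, add_mem hu' hu, by ring⟩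

theorem glued_add (h : NeckData q ρ r₁ r₃ A Ψ dΨ) {u η : ℂ} (hu : u ∈ latticeOf q.tau)
    (hη : ∀ z ∉ latticeOf q.tau, wZeta (z + u) q.tau = wZeta z q.tau + η) {z : ℂ}
    (hz : z ∈ gluedDomain q r₁ r₃ A) :
    glued q ρ r₁ r₃ Ψ (z + u) =
      glued q ρ r₁ r₃ Ψ z + η * nodePeriod (fun σ p => sgn σ * Ψ σ p) r₃ := by
  rcases hz with hz | ⟨σ, s, hsA, hs, u', hu', rfl⟩
  · rw [glued_outer hz, glued_outer (add_mem_outer hu hz),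
      h.conv_add le_rfl h.lt.le hη (outer_subset q r₁ hz), h.nodePeriod_eq]
  · rw [h.glued_near hs hu', add_assoc, h.glued_near hs (add_mem hu' hu), ← add_assoc,
      h.conv_add h.lt.le le_rfl hη (h.mem_offCircles hs hu')]
    ring

/-- Translation by 1 or τ changes the glued function by a constant, so its derivative defines a form
on the torus. -/
theorem deriv_glued_add (h : NeckData q ρ r₁ r₃ A Ψ dΨ) {u : ℂ} (hu : u ∈ latticeOf q.tau) {z : ℂ}
    (hz : z ∈ gluedDomain q r₁ r₃ A) :
    deriv (glued q ρ r₁ r₃ Ψ) (z + u) = deriv (glued q ρ r₁ r₃ Ψ) z := by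
  have key {u η : ℂ} (hu : u ∈ latticeOf q.tau)
      (hη : ∀ z ∉ latticeOf q.tau, wZeta (z + u) q.tau = wZeta z q.tau + η) {z : ℂ}
      (hz : z ∈ gluedDomain q r₁ r₃ A) :
      deriv (glued q ρ r₁ r₃ Ψ) (z + u) = deriv (glued q ρ r₁ r₃ Ψ) z := by
    rw [← deriv_comp_add_const]
    have : (fun z => glued q ρ r₁ r₃ Ψ (z + u)) =ᶠ[𝓝 z]
        fun z => glued q ρ r₁ r₃ Ψ z + η * nodePeriod (fun σ p => sgn σ * Ψ σ p) r₃ := by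
      filter_upwards [h.isOpen_gluedDomain.mem_nhds hz] with w hw
      exact h.glued_add hu hη hw
    rw [this.deriv_eq, deriv_add_const]
  exact latticeOf_induction (P := fun z => z ∈ gluedDomain q r₁ r₃ A)
    (fun u hu z hz => add_mem_gluedDomain hz hu)
    (fun z hz => key (one_mem_latticeOf _) (fun z => wZeta_add_one h.good.im_pos) hz)
    (fun z hz => key (tau_mem_latticeOf _) (fun z => wZeta_add_tau h.good.im_pos) hz) hu z hz

end NeckData

/-! ### The 1-form on one torus -/

/-- The 1-form with imaginary periods and residues `1` and `-1` at the nodes. -/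
def omegaT (z : ℂ) (q : TorusParams) : ℂ := wZeta z q.tau - wZeta (z - q.v) q.tau - wXi q.v q.tau

/-- The constant which makes the periods imaginary when the quasi-periods are multiplied by `S`. -/
def periodCorrection (τ S : ℂ) : ℂ :=
  -(S * eta1 τ) + I * ((S * (eta2 τ - eta1 τ * τ)).re / τ.im : ℝ)

theorem periodCorrection_zero (τ : ℂ) : periodCorrection τ 0 = 0 := by simp [periodCorrection]

theorem re_periodCorrection_one (τ S : ℂ) : (periodCorrection τ S + eta1 τ * S).re = 0 := by
  simp [periodCorrection]
  ring

theorem re_periodCorrection_tau {τ : ℂ} (hτ : 0 < τ.im) (S : ℂ) :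
    (periodCorrection τ S * τ + eta2 τ * S).re = 0 := by
  have h : periodCorrection τ S * τ + eta2 τ * S = S * (eta2 τ - eta1 τ * τ) +
      I * ((S * (eta2 τ - eta1 τ * τ)).re / τ.im : ℝ) * τ := by
    simp only [periodCorrection]
    ring
  rw [h]
  set c := S * (eta2 τ - eta1 τ * τ)
  simp [hτ.ne']

/-- This is the reason for subtracting ξ(v): writing v = x + yτ, the quantity is the real multiple y
of η₁τ - η₂, whose real part vanishes by Legendre's relation. The period τ is treated in the same
way with the multiple -x. -/
theorem re_wXi_one {τ : ℂ} (hτ : 0 < τ.im) (v : ℂ) : (eta1 τ * v - wXi v τ).re = 0 := by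
  have h : eta1 τ * v - wXi v τ = (coordY v τ : ℂ) * (eta1 τ * τ - eta2 τ) := by
    conv_lhs => enter [1]; rw [← coordX_add_coordY_mul v τ hτ.ne']
    rw [wXi]
    ring
  rw [h, re_ofReal_mul, legendre_re hτ, mul_zero]

theorem re_wXi_tau {τ : ℂ} (hτ : 0 < τ.im) (v : ℂ) : (eta2 τ * v - wXi v τ * τ).re = 0 := by
  have h : eta2 τ * v - wXi v τ * τ = (-coordX v τ : ℝ) * (eta1 τ * τ - eta2 τ) := by
    conv_lhs => enter [1]; rw [← coordX_add_coordY_mul v τ hτ.ne']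
    rw [wXi]
    push_cast
    ring
  rw [h, re_ofReal_mul, legendre_re hτ, mul_zero]

/-- The coefficient of the 1-form of one torus. -/
def coeffT (q : TorusParams) (ρ r₁ r₃ : ℝ) (Ψ : Bool → ℂ → ℂ) (z : ℂ) : ℂ :=
  omegaT z q + periodCorrection q.tau (nodePeriod (fun σ p => sgn σ * Ψ σ p) r₃) +
    deriv (glued q ρ r₁ r₃ Ψ) z

theorem omegaT_add {q : TorusParams} (hτ : 0 < q.tau.im) {u : ℂ} (hu : u ∈ latticeOf q.tau)
    {z : ℂ} (hz : z ∉ latticeOf q.tau) (hzv : z - q.v ∉ latticeOf q.tau) :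
    omegaT (z + u) q = omegaT z q := by
  refine latticeOf_induction (P := fun z => z ∉ latticeOf q.tau ∧ z - q.v ∉ latticeOf q.tau)
    (f := fun z => omegaT z q)
    (fun u hu z hz => ⟨add_notMem hz.1 hu, sub_notMem_add hz.2 hu⟩) (fun z hz => ?_)
    (fun z hz => ?_) hu z ⟨hz, hzv⟩
  · simp only [omegaT]
    rw [add_sub_right_comm, wZeta_add_one hτ hz.1, wZeta_add_one hτ hz.2]
    ring
  · simp only [omegaT]
    rw [add_sub_right_comm, wZeta_add_tau hτ hz.1, wZeta_add_tau hτ hz.2]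
    ring

theorem omegaT_nodePt (q : TorusParams) (σ : Bool) (s : ℂ) :
    omegaT (nodePt q σ s) q = omegaT s q := by
  cases σ
  · simp [nodePt, sgn, ctr]
  · have h : wZeta (q.v - s) q.tau = -wZeta (s - q.v) q.tau := by rw [← wZeta_neg]; ring_nf
    simp only [nodePt, ctr, sgn, if_true, omegaT, neg_mul, one_mul]
    rw [← sub_eq_add_neg, h, sub_sub_cancel_left, wZeta_neg]
    ring

theorem nodePt_notMem {q : TorusParams} {ρ : ℝ} (h : GoodParams q ρ) {σ : Bool} {s u : ℂ}
    (hs : ‖s‖ < ρ) (hs0 : s ≠ 0) (hu : u ∈ latticeOf q.tau) :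
    nodePt q σ s + u ∉ latticeOf q.tau ∧ nodePt q σ s + u - q.v ∉ latticeOf q.tau := by
  have key σ' := sub_notMem_add (nodePt_sub_notMem h (σ := σ) (σ' := σ') (p := 0) hs
    (by simpa using h.pos) fun _ => hs0) hu
  refine ⟨?_, ?_⟩
  · simpa [nodePt, ctr, sgn] using key false
  · simpa [nodePt, ctr, sgn] using key true

theorem notMem_of_mem_outer {q : TorusParams} {r : ℝ} (hr : 0 ≤ r) {z : ℂ} (hz : z ∈ outer q r) :
    z ∉ latticeOf q.tau ∧ z - q.v ∉ latticeOf q.tau := by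
  have key σ' := hz σ' 0 (by simpa using hr)
  refine ⟨?_, ?_⟩
  · simpa [nodePt, ctr, sgn] using key false
  · simpa [nodePt, ctr, sgn] using key true

theorem hasFDerivAt_logSigma_sub {q : TorusParams} (hτ : 0 < q.tau.im) {z : ℂ}
    (hz : z ∉ latticeOf q.tau) (hzv : z - q.v ∉ latticeOf q.tau) :
    HasFDerivAt (fun z => logSigma z q.tau - logSigma (z - q.v) q.tau - (wXi q.v q.tau * z).re)
      (reMul (omegaT z q)) z := by
  have h1 := (hasFDerivAt_logSigma hτ hzv).comp z ((hasFDerivAt_id z).sub_const q.v)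
  have h2 : HasDerivAt (fun z => wXi q.v q.tau * z) (wXi q.v q.tau) z := by
    simpa using (hasDerivAt_id z).const_mul (wXi q.v q.tau)
  have h3 := ((hasFDerivAt_logSigma hτ hz).sub h1).sub (hasFDerivAt_re h2)
  refine h3.congr_fderiv (ContinuousLinearMap.ext fun X => ?_)
  simp [omegaT]

theorem exists_logSigma_sub_add {q : TorusParams} (hτ : 0 < q.tau.im) {u η : ℂ}
    (hu : u = 1 ∧ η = eta1 q.tau ∨ u = q.tau ∧ η = eta2 q.tau) {z : ℂ}
    (hz : z ∉ latticeOf q.tau) (hzv : z - q.v ∉ latticeOf q.tau) :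
    logSigma (z + u) q.tau - logSigma (z + u - q.v) q.tau - (wXi q.v q.tau * (z + u)).re =
      logSigma z q.tau - logSigma (z - q.v) q.tau - (wXi q.v q.tau * z).re := by
  obtain ⟨⟨c₁, h₁⟩, c₂, h₂⟩ := exists_logSigma_quasiperiods hτ
  rcases hu with ⟨rfl, rfl⟩ | ⟨rfl, rfl⟩
  · have h := re_wXi_one hτ q.v
    rw [add_sub_right_comm, h₁ _ hz, h₁ _ hzv, mul_sub, mul_add, mul_one]
    simp only [sub_re, add_re] at *
    linarith
  · have h := re_wXi_tau hτ q.v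
    rw [add_sub_right_comm, h₂ _ hz, h₂ _ hzv, mul_sub, mul_add]
    simp only [sub_re, add_re] at *
    linarith

namespace NeckData

variable {q : TorusParams} {ρ r₁ r₃ : ℝ} {A : Set ℂ} {Ψ dΨ : Bool → ℂ → ℂ}

theorem notMem (h : NeckData q ρ r₁ r₃ A Ψ dΨ) {z : ℂ} (hz : z ∈ gluedDomain q r₁ r₃ A) :
    z ∉ latticeOf q.tau ∧ z - q.v ∉ latticeOf q.tau := by
  rcases hz with hz | ⟨σ, s, hsA, hs, u, hu, rfl⟩
  · exact notMem_of_mem_outer h.pos.le hz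
  · exact nodePt_notMem h.good (hs.trans h.lt_rho) (fun h0 => h.zero_notMem (h0 ▸ hsA)) hu

/-- Here the primitives have disappeared: the coefficient depends linearly on `dΨ` on the circles of
radius r₁, apart from the explicit term `omegaT`. Smooth dependence on the parameters is read off
from this formula. -/
theorem coeffT_outer (h : NeckData q ρ r₁ r₃ A Ψ dΨ) {z : ℂ} (hz : z ∈ outer q r₁) :
    coeffT q ρ r₁ r₃ Ψ z = omegaT z q +
      periodCorrection q.tau (nodePeriod (fun σ p => -(sgn σ * p) * dΨ σ p) r₁) +
        nodeConv q dΨ r₁ z := by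
  rw [coeffT, (h.hasDerivAt_glued_outer hz).deriv, h.nodePeriod_eq,
    nodePeriod_by_parts h.pos.le (fun σ p hp => h.hasDerivAt σ p (h.sphere_subset le_rfl h.lt.le hp))
      fun σ => (h.continuousOn_deriv σ).mono (h.sphere_subset le_rfl h.lt.le)]

theorem coeffT_near (h : NeckData q ρ r₁ r₃ A Ψ dΨ) {σ : Bool} {s : ℂ} (hsA : s ∈ A)
    (hs : ‖s‖ < r₃) :
    coeffT q ρ r₁ r₃ Ψ (nodePt q σ s) = omegaT s q +
      periodCorrection q.tau (nodePeriod (fun σ p => -(sgn σ * p) * dΨ σ p) r₃) +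
        (nodeConv q dΨ r₃ (nodePt q σ s) + sgn σ * dΨ σ s) := by
  have h1 := h.hasDerivAt_glued_near (σ := σ) hsA hs (zero_mem _)
  rw [add_zero] at h1
  rw [coeffT, h1.deriv, omegaT_nodePt,
    nodePeriod_by_parts (h.pos.trans h.lt).le
      (fun σ p hp => h.hasDerivAt σ p (h.sphere_subset h.lt.le le_rfl hp))
      fun σ => (h.continuousOn_deriv σ).mono (h.sphere_subset h.lt.le le_rfl)]

theorem coeffT_add (h : NeckData q ρ r₁ r₃ A Ψ dΨ) {u : ℂ} (hu : u ∈ latticeOf q.tau) {z : ℂ}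
    (hz : z ∈ gluedDomain q r₁ r₃ A) :
    coeffT q ρ r₁ r₃ Ψ (z + u) = coeffT q ρ r₁ r₃ Ψ z := by
  rw [coeffT, coeffT, h.deriv_glued_add hu hz,
    omegaT_add h.good.im_pos hu (h.notMem hz).1 (h.notMem hz).2]

theorem differentiableOn_coeffT (h : NeckData q ρ r₁ r₃ A Ψ dΨ) :
    DifferentiableOn ℂ (coeffT q ρ r₁ r₃ Ψ) (gluedDomain q r₁ r₃ A) := by
  have h1 : DifferentiableOn ℂ (glued q ρ r₁ r₃ Ψ) (gluedDomain q r₁ r₃ A) :=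
    fun z hz => (h.differentiableAt_glued hz).differentiableWithinAt
  refine DifferentiableOn.add (DifferentiableOn.add_const _ fun z hz => ?_)
    (h1.deriv h.isOpen_gluedDomain)
  have h2 := (hasDerivAt_wZeta h.good.im_pos (h.notMem hz).1).differentiableAt
  have h3 := ((hasDerivAt_wZeta h.good.im_pos (h.notMem hz).2).comp_sub_const z q.v).differentiableAt
  exact ((h2.sub h3).sub_const _).differentiableWithinAt

/-- The real part of the form has the single-valued primitive L, built from log|σ(z)/σ(z - v)|, the
linear terms and the glued function. A period is an increment of L. The σ-part, together with the
ξ-term, is invariant by Legendre's relation, and the increment Re(ηS) of the glued function is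
cancelled by `periodCorrection`. -/
theorem re_period_eq_zero (h : NeckData q ρ r₁ r₃ A Ψ dΨ) {u : ℂ} (hu : u = 1 ∨ u = q.tau)
    {γ : ℝ → ℂ} (hγ : ContDiff ℝ 1 γ) (hγA : ∀ s ∈ Icc (0 : ℝ) 1, γ s ∈ gluedDomain q r₁ r₃ A)
    (h01 : γ 1 = γ 0 + u) :
    (∫ s in (0 : ℝ)..1, coeffT q ρ r₁ r₃ Ψ (γ s) * deriv γ s).re = 0 := by
  have hτ := h.good.im_pos
  set S := nodePeriod (fun σ p => sgn σ * Ψ σ p) r₃ with hS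
  set C := periodCorrection q.tau S with hC
  let L : ℂ → ℝ := fun z =>
    logSigma z q.tau - logSigma (z - q.v) q.tau - (wXi q.v q.tau * z).re + (C * z).re +
      (glued q ρ r₁ r₃ Ψ z).re
  have hL z (hz : z ∈ gluedDomain q r₁ r₃ A) :
      HasFDerivAt L (reMul (coeffT q ρ r₁ r₃ Ψ z)) z := by
    have h1 := hasFDerivAt_logSigma_sub hτ (h.notMem hz).1 (h.notMem hz).2
    have h2 : HasDerivAt (fun z => C * z) C z := by
      simpa using (hasDerivAt_id z).const_mul C
    have h3 := (h1.add (hasFDerivAt_re h2)).add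
      (hasFDerivAt_re (h.differentiableAt_glued hz).hasDerivAt)
    refine h3.congr_fderiv ?_
    rw [coeffT, map_add, map_add]
  have hcont : ContinuousOn (fun s => coeffT q ρ r₁ r₃ Ψ (γ s) * deriv γ s) (uIcc (0 : ℝ) 1) := by
    rw [uIcc_of_le zero_le_one]
    exact (h.differentiableOn_coeffT.continuousOn.comp hγ.continuous.continuousOn hγA).mul
      (hγ.continuous_deriv le_rfl).continuousOn
  have hint := hcont.intervalIntegrable (μ := MeasureTheory.volume)
  have h1 := reCLM.intervalIntegral_comp_comm hint
  simp only [reCLM_apply] at h1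
  rw [← h1, intervalIntegral.integral_eq_sub_of_hasDerivAt (f := fun s => L (γ s))]
  · have hz := hγA 0 (by simp)
    have hη {η : ℂ} (hu' : u = 1 ∧ η = eta1 q.tau ∨ u = q.tau ∧ η = eta2 q.tau)
        (hmem : u ∈ latticeOf q.tau)
        (hη : ∀ z ∉ latticeOf q.tau, wZeta (z + u) q.tau = wZeta z q.tau + η)
        (hre : (C * u + η * S).re = 0) : L (γ 1) - L (γ 0) = 0 := by
      simp only [L]
      rw [h01, exists_logSigma_sub_add hτ hu' (h.notMem hz).1 (h.notMem hz).2,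
        h.glued_add hmem hη hz, mul_add C]
      simp only [add_re] at *
      linarith
    rcases hu with rfl | rfl
    · exact hη (Or.inl ⟨rfl, rfl⟩) (one_mem_latticeOf _) (fun z => wZeta_add_one hτ)
        (by rw [mul_one]; exact re_periodCorrection_one _ _)
    · exact hη (Or.inr ⟨rfl, rfl⟩) (tau_mem_latticeOf _) (fun z => wZeta_add_tau hτ)
        (re_periodCorrection_tau hτ _)
  · intro s hs
    rw [uIcc_of_le zero_le_one] at hs
    have := (hL _ (hγA s hs)).comp_hasDerivAt s
      ((hγ.differentiable (by simp)).differentiableAt (x := s)).hasDerivAt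
    exact this
  · exact (reCLM.continuous.comp_continuousOn hcont).intervalIntegrable

end NeckData

/-! ### The Cauchy transform in the node coordinate -/

/-- The function `1/(2πi) ∮ f(s) / (1/g(s) - y) ds`. -/
def cauchyT (q : TorusParams) (r : ℝ) (f : ℂ → ℂ) (y : ℂ) : ℂ :=
  (2 * Real.pi * I)⁻¹ * ∮ s in C(0, r), f s / (nodeCoord s q - y)

theorem differentiableOn_cauchyT {q : TorusParams} {ρ r : ℝ} (h : GoodParams q ρ) (hr : 0 ≤ r)
    (hrρ : r < ρ) {f : ℂ → ℂ} (hf : ContinuousOn f (sphere 0 r)) :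
    DifferentiableOn ℂ (cauchyT q r f) (ball 0 r) := by
  have hsub : sphere (0 : ℂ) r ⊆ ball 0 ρ := fun s hs => by
    rw [mem_sphere_zero_iff_norm] at hs
    simpa [hs] using hrρ
  have hm : ContinuousOn (fun s => nodeCoord s q) (sphere 0 r) := fun s hs =>
    (h.differentiableAt_nodeCoord (hsub hs)).continuousAt.continuousWithinAt
  -- The coordinate does not decrease the modulus, so on the circle its modulus is at least r, while
  -- |y| < r.
  have hne : ∀ y ∈ ball (0 : ℂ) r, ∀ s ∈ sphere (0 : ℂ) r, nodeCoord s q - y ≠ 0 := by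
    intro y hy s hs he
    have := h.le_norm_nodeCoord (hsub hs)
    rw [sub_eq_zero.1 he, mem_sphere_zero_iff_norm.1 hs] at this
    rw [mem_ball_zero_iff] at hy
    linarith
  intro y hy
  refine (HasDerivAt.const_mul _ (hasDerivAt_circleIntegral
    (K := fun y s => f s / (nodeCoord s q - y)) (K' := fun y s => f s / (nodeCoord s q - y) ^ 2)
    hr isOpen_ball hy (fun y hy s hs => ?_) (fun y hy => hf.div (hm.sub continuousOn_const) (hne y hy))
    ?_)).differentiableAt.differentiableWithinAt
  · have h1 := (((hasDerivAt_id y).const_sub (nodeCoord s q)).inv (hne y hy s hs)).const_mul (f s)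
    refine (h1.congr_deriv ?_).congr_of_eventuallyEq (Eventually.of_forall fun y => ?_)
    · simp [div_eq_mul_inv]
    · simp [div_eq_mul_inv]
  · refine ContinuousOn.div (hf.comp continuousOn_snd fun w hw => hw.2) (ContinuousOn.pow
      ((hm.comp continuousOn_snd fun w hw => hw.2).sub continuousOn_fst) 2) fun w hw => ?_
    exact pow_ne_zero 2 (hne w.1 hw.1 w.2 hw.2)

/-- With m = 1/g, the quotient (m(s) - m(s₀))/(s - s₀) extends to a nonvanishing holomorphic
function, and Cauchy's formula applies to f divided by it. In other words, the form f ds has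
coefficient `cauchyT` in the coordinate w = m(s). -/
theorem cauchyT_nodeCoord {q : TorusParams} {ρ r : ℝ} (h : GoodParams q ρ) (hr : 0 < r)
    (hrρ : r < ρ) {f : ℂ → ℂ} (hf : DifferentiableOn ℂ f (closedBall 0 r)) {s₀ : ℂ}
    (hs₀ : ‖s₀‖ < r) :
    cauchyT q r f (nodeCoord s₀ q) * deriv (fun s => nodeCoord s q) s₀ = f s₀ := by
  have hρ : closedBall (0 : ℂ) r ⊆ ball 0 ρ := closedBall_subset_ball hrρ
  have hs₀ρ : s₀ ∈ ball (0 : ℂ) ρ := by simpa using hs₀.trans hrρ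
  have hd : DifferentiableOn ℂ (dslope (fun s => nodeCoord s q) s₀) (ball 0 ρ) :=
    (Complex.differentiableOn_dslope (isOpen_ball.mem_nhds hs₀ρ)).2
      fun s hs => (h.differentiableAt_nodeCoord hs).differentiableWithinAt
  have hne : ∀ s ∈ ball (0 : ℂ) ρ, dslope (fun s => nodeCoord s q) s₀ s ≠ 0 := by
    intro s hs h0
    by_cases hss : s = s₀
    · rw [hss, dslope_same] at h0
      exact h.deriv_nodeCoord_ne_zero hs₀ρ h0
    · rw [dslope_of_ne _ hss, slope_def_field, div_eq_zero_iff, sub_eq_zero, sub_eq_zero] at h0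
      rcases h0 with h0 | h0
      · exact hss (h.injOn_nodeCoord hs hs₀ρ h0)
      · exact hss h0
  have hF : DifferentiableOn ℂ (fun s => f s / dslope (fun s => nodeCoord s q) s₀ s)
      (closedBall 0 r) := hf.div (hd.mono hρ) fun s hs => hne s (hρ hs)
  have key := (hF.diffContOnCl_ball subset_rfl).circleIntegral_sub_inv_smul
    (mem_ball_zero_iff.2 hs₀)
  have hcong : (∮ s in C(0, r), f s / (nodeCoord s q - nodeCoord s₀ q)) =
      ∮ s in C(0, r), (s - s₀)⁻¹ • (f s / dslope (fun s => nodeCoord s q) s₀ s) := by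
    refine circleIntegral.integral_congr hr.le fun s hs => ?_
    have hss : s ≠ s₀ := fun he => by
      rw [mem_sphere_zero_iff_norm, he] at hs
      exact hs₀.ne hs
    have h1 := hne s (hρ (sphere_subset_closedBall hs))
    rw [dslope_of_ne _ hss, slope_def_field] at h1 ⊢
    have h2 : nodeCoord s q - nodeCoord s₀ q ≠ 0 := fun h0 => h1 (by rw [h0, zero_div])
    have h3 : s - s₀ ≠ 0 := sub_ne_zero.2 hss
    rw [smul_eq_mul]
    field_simp
  have hm := h.deriv_nodeCoord_ne_zero hs₀ρ
  rw [cauchyT, hcong, key, dslope_same, smul_eq_mul]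
  have hπ : (2 * Real.pi * I : ℂ) ≠ 0 := by simp [Real.pi_ne_zero]
  field_simp

/-! ### Solutions of the neck equation -/

namespace GoodParams

variable {q : TorusParams} {ρ : ℝ}

theorem gaussH_ne_zero (h : GoodParams q ρ) {s : ℂ} (hs : ‖s‖ < ρ) : gaussH s q ≠ 0 :=
  (h.mem s (mem_ball_zero_iff.2 hs)).2

theorem gaussT_ne_zero (h : GoodParams q ρ) {s : ℂ} (hs : ‖s‖ < ρ) (h0 : s ≠ 0) :
    gaussT s q ≠ 0 := fun he => h.gaussH_ne_zero hs (by rw [gaussH_eq h0, he, mul_zero])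

theorem mem_gaussDomain (h : GoodParams q ρ) {s : ℂ} (hs : ‖s‖ < ρ) (h0 : s ≠ 0) :
    (s, q) ∈ gaussDomain := by
  have hm := (h.mem s (mem_ball_zero_iff.2 hs)).1
  refine ⟨?_, hm.2⟩
  rw [zetaDomain_eq]
  exact ⟨hm.1, h0⟩

theorem hasDerivAt_gaussT (h : GoodParams q ρ) {s : ℂ} (hs : ‖s‖ < ρ) (h0 : s ≠ 0) :
    HasDerivAt (fun s => gaussT s q) (deriv (fun s => gaussT s q) s) s :=
  (differentiableAt_fst isOpen_gaussDomain contDiffOn_gaussT (h.mem_gaussDomain hs h0)).hasDerivAt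

theorem deriv_nodeCoord (h : GoodParams q ρ) {s : ℂ} (hs : ‖s‖ < ρ) (h0 : s ≠ 0) :
    deriv (fun s => nodeCoord s q) s = -deriv (fun s => gaussT s q) s / gaussT s q ^ 2 := by
  have h1 := (h.hasDerivAt_gaussT hs h0).inv (h.gaussT_ne_zero hs h0)
  refine (h1.congr_of_eventuallyEq ?_).deriv
  filter_upwards [isOpen_ne.mem_nhds h0] with w hw
  exact nodeCoord_eq hw q

end GoodParams

/-- The part of `ω` at a node which is regular after subtracting `dw / w`, `w = 1 / g`. -/
def regT (s : ℂ) (q : TorusParams) : ℂ :=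
  wZetaReg s q.tau - wZeta (s - q.v) q.tau - wXi q.v q.tau +
    deriv (fun s => gaussH s q) s / gaussH s q

/-- Since w = s/H with H = s g(s), dw/w = ds/s - dH/H. Both ω and dw/w thus have the polar part
ds/s. -/
theorem omegaT_eq {q : TorusParams} {ρ : ℝ} (h : GoodParams q ρ) {s : ℂ} (hs : ‖s‖ < ρ)
    (h0 : s ≠ 0) :
    omegaT s q = regT s q + deriv (fun s => nodeCoord s q) s / nodeCoord s q := by
  have hH := h.gaussH_ne_zero hs
  have hd := (differentiableAt_fst isOpen_gaussHDomain contDiffOn_gaussH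
    (h.mem s (mem_ball_zero_iff.2 hs)).1).hasDerivAt
  have hm := ((hasDerivAt_id s).div hd hH).deriv
  have hm' : deriv (fun s => nodeCoord s q) s =
      (1 * gaussH s q - s * deriv (fun s => gaussH s q) s) / gaussH s q ^ 2 := hm
  rw [hm', omegaT, wZeta_eq, regT, nodeCoord]
  field_simp
  ring

theorem differentiableAt_regT {q : TorusParams} {ρ : ℝ} (h : GoodParams q ρ) {s : ℂ}
    (hs : ‖s‖ < ρ) : DifferentiableAt ℂ (fun s => regT s q) s := by
  have hm := (h.mem s (mem_ball_zero_iff.2 hs)).1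
  have h1 := (hasDerivAt_wZetaReg h.im_pos hm.1).differentiableAt
  have h2 := ((hasDerivAt_wZeta h.im_pos hm.2.2).comp_sub_const s q.v).differentiableAt
  have h3 := differentiableAt_fst isOpen_gaussHDomain contDiffOn_gaussH hm
  have h4 := differentiableAt_fst (F := fun s q => deriv (fun s => gaussH s q) s) isOpen_gaussHDomain
    (contDiffOn_deriv_fst isOpen_gaussHDomain contDiffOn_gaussH) hm
  exact ((h1.sub h2).sub_const _).add (h4.div h3 (h.gaussH_ne_zero hs))

/-- The index of the torus glued to `T_k` at the node `σ`. -/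
def adj (k : ℤ) (σ : Bool) : ℤ := if σ then k + 1 else k - 1

@[simp] theorem adj_adj (k : ℤ) (σ : Bool) : adj (adj k σ) (!σ) = k := by cases σ <;> simp [adj]

theorem sgn_not (σ : Bool) : sgn (!σ) = -sgn σ := by cases σ <;> simp [sgn]

/-- The local parameters at a node which lie in the neck. -/
def neckDomain (q : TorusParams) (ρ t r₂ : ℝ) : Set ℂ :=
  {s | ‖s‖ < ρ ∧ s ≠ 0 ∧ ‖(t : ℂ) ^ 2 * gaussT s q‖ < r₂}

/-- A primitive of the Cauchy transform. -/
def cauchyPrim (q : TorusParams) (r : ℝ) (f : ℂ → ℂ) : ℂ → ℂ :=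
  Classical.epsilon fun Q => ∀ y ∈ ball (0 : ℂ) r, HasDerivAt Q (cauchyT q r f y) y

theorem hasDerivAt_cauchyPrim {q : TorusParams} {ρ r : ℝ} (h : GoodParams q ρ) (hr : 0 ≤ r)
    (hrρ : r < ρ) {f : ℂ → ℂ} (hf : ContinuousOn f (sphere 0 r)) {y : ℂ} (hy : ‖y‖ < r) :
    HasDerivAt (cauchyPrim q r f) (cauchyT q r f y) y :=
  Classical.epsilon_spec (p := fun Q => ∀ y ∈ ball (0 : ℂ) r, HasDerivAt Q (cauchyT q r f y) y)
    (differentiableOn_cauchyT h hr hrρ hf).isExactOn_ball y (mem_ball_zero_iff.2 hy)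

/-- The contribution of the adjacent torus to the 1-form in the neck. -/
def neckDeriv (x : Params) (t r₂ : ℝ) (U : ℤ → Bool → ℂ → ℂ) (k : ℤ) (σ : Bool) (s : ℂ) : ℂ :=
  cauchyT (x.pt (adj k σ)) r₂ (U (adj k σ) (!σ)) ((t : ℂ) ^ 2 * gaussT s (x.pt k)) *
    ((t : ℂ) ^ 2 * deriv (fun s => gaussT s (x.pt k)) s)

/-- A primitive of `neckDeriv`. -/
def neckPrim (x : Params) (t r₂ : ℝ) (U : ℤ → Bool → ℂ → ℂ) (k : ℤ) (σ : Bool) (s : ℂ) : ℂ :=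
  cauchyPrim (x.pt (adj k σ)) r₂ (U (adj k σ) (!σ)) ((t : ℂ) ^ 2 * gaussT s (x.pt k))

/-- The regular part of the 1-form at the node `σ`, computed from functions `f` on the circles of
radius `r₃` around the nodes. -/
def regPart (q : TorusParams) (r₃ : ℝ) (f : Bool → ℂ → ℂ) (σ : Bool) (s : ℂ) : ℂ :=
  sgn σ * (regT s q + periodCorrection q.tau (nodePeriod (fun σ p => -(sgn σ * p) * f σ p) r₃) +
    nodeConv q f r₃ (nodePt q σ s))

/-- The functions `U` on the circles of radius `r₂` around the nodes are the regular parts of a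
1-form on the glued surface. -/
structure NeckSolution (x : Params) (t ρ r₁ r₂ r₃ : ℝ) (U : ℤ → Bool → ℂ → ℂ) : Prop where
  good : ∀ k, GoodParams (x.pt k) ρ
  pos : 0 < r₁
  lt₁₂ : r₁ < r₂
  lt₂₃ : r₂ < r₃
  lt_rho : r₃ < ρ
  sq_lt : t ^ 2 < r₁ * r₂
  continuousOn : ∀ k σ, ContinuousOn (U k σ) (sphere 0 r₂)
  eq : ∀ k σ, ∀ s ∈ sphere (0 : ℂ) r₂,
    U k σ s = regPart (x.pt k) r₃ (neckDeriv x t r₂ U k) σ s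

/-- The coefficient of the 1-form in the local coordinate `w = 1 / g` at a node. -/
def nodeForm (x : Params) (t r₂ : ℝ) (U : ℤ → Bool → ℂ → ℂ) (k : ℤ) (σ : Bool) (w : ℂ) : ℂ :=
  sgn σ / w + cauchyT (x.pt k) r₂ (U k σ) w -
    (t : ℂ) ^ 2 / w ^ 2 * cauchyT (x.pt (adj k σ)) r₂ (U (adj k σ) (!σ)) ((t : ℂ) ^ 2 / w)

/-- The pullback by w ↦ t²/w reverses the sign of dw/w, in accordance with the opposite residues on
the two sides, and interchanges the two Cauchy transforms. -/
theorem nodeForm_adj (x : Params) (t r₂ : ℝ) (U : ℤ → Bool → ℂ → ℂ) (k : ℤ) (σ : Bool) {w : ℂ}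
    (hw : w ≠ 0) (ht : t ≠ 0) :
    -((t : ℂ) ^ 2 / w ^ 2) * nodeForm x t r₂ U (adj k σ) (!σ) ((t : ℂ) ^ 2 / w) =
      nodeForm x t r₂ U k σ w := by
  have ht' : (t : ℂ) ≠ 0 := by exact_mod_cast ht
  have h1 : (t : ℂ) ^ 2 / ((t : ℂ) ^ 2 / w) = w := by field_simp
  simp only [nodeForm, adj_adj, Bool.not_not, h1, sgn_not]
  field_simp
  ring

/-- The coefficient of the 1-form on `T_k`. -/
def coeffX (x : Params) (t ρ r₁ r₂ r₃ : ℝ) (U : ℤ → Bool → ℂ → ℂ) (k : ℤ) (z : ℂ) : ℂ :=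
  coeffT (x.pt k) ρ r₁ r₃ (neckPrim x t r₂ U k) z

/-- The domain of the 1-form on `T_k`. -/
def domX (x : Params) (t ρ r₁ r₂ r₃ : ℝ) (k : ℤ) : Set ℂ :=
  gluedDomain (x.pt k) r₁ r₃ (neckDomain (x.pt k) ρ t r₂)

/-! ### The form defined by a solution of the neck equation, near the nodes -/

namespace NeckSolution

variable {x : Params} {t ρ r₁ r₂ r₃ : ℝ} {U : ℤ → Bool → ℂ → ℂ}

theorem neckData (h : NeckSolution x t ρ r₁ r₂ r₃ U) (k : ℤ) :
    NeckData (x.pt k) ρ r₁ r₃ (neckDomain (x.pt k) ρ t r₂) (neckPrim x t r₂ U k)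
      (neckDeriv x t r₂ U k) where
  good := h.good k
  pos := h.pos
  lt := h.lt₁₂.trans h.lt₂₃
  lt_rho := h.lt_rho
  isOpen := by
    have : neckDomain (x.pt k) ρ t r₂ = (ball 0 ρ ∩ {0}ᶜ) ∩
        (fun s => (t : ℂ) ^ 2 * gaussT s (x.pt k)) ⁻¹' ball 0 r₂ := by
      ext s
      simp [neckDomain, and_assoc]
    rw [this]
    refine ContinuousOn.isOpen_inter_preimage (fun s hs => ?_)
      (isOpen_ball.inter isOpen_compl_singleton) isOpen_ball
    exact (((h.good k).hasDerivAt_gaussT (mem_ball_zero_iff.1 hs.1)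
      hs.2).continuousAt.const_mul _).continuousWithinAt
  zero_notMem := fun h0 => h0.2.1 rfl
  -- Since |1/g(s)| ≥ |s| ≥ r₁, one has |t² g(s)| ≤ t²/r₁ < r₂ by `sq_lt`.
  annulus_subset := by
    intro s hs
    have h1 : r₁ ≤ ‖s‖ := by simpa using hs.2
    have h3 : ‖s‖ < ρ := (mem_closedBall_zero_iff.1 hs.1).trans_lt h.lt_rho
    have h0 : s ≠ 0 := fun he => by
      rw [he, norm_zero] at h1
      linarith [h.pos]
    refine ⟨h3, h0, ?_⟩
    have hm := (h.good k).le_norm_nodeCoord (mem_ball_zero_iff.2 h3)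
    rw [nodeCoord_eq h0, norm_inv] at hm
    have hg : 0 < ‖gaussT s (x.pt k)‖ := norm_pos_iff.2 ((h.good k).gaussT_ne_zero h3 h0)
    have hg1 : r₁ * ‖gaussT s (x.pt k)‖ ≤ 1 := by
      have := mul_le_mul_of_nonneg_right (h1.trans hm) hg.le
      rwa [inv_mul_cancel₀ hg.ne'] at this
    rw [norm_mul, norm_pow, norm_real, Real.norm_eq_abs, sq_abs]
    have h5 := mul_lt_mul_of_pos_right h.sq_lt hg
    have h6 := mul_le_mul_of_nonneg_left hg1 (h.pos.trans h.lt₁₂).le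
    nlinarith
  hasDerivAt σ s hs := by
    have h1 := ((h.good k).hasDerivAt_gaussT hs.1 hs.2.1).const_mul ((t : ℂ) ^ 2)
    exact (hasDerivAt_cauchyPrim (h.good (adj k σ)) (h.pos.trans h.lt₁₂).le
      (h.lt₂₃.trans h.lt_rho) (h.continuousOn _ _) hs.2.2).comp s h1

theorem differentiableOn_regPart (h : NeckSolution x t ρ r₁ r₂ r₃ U) (k : ℤ) (σ : Bool) :
    DifferentiableOn ℂ (regPart (x.pt k) r₃ (neckDeriv x t r₂ U k) σ) (ball 0 r₃) := by
  intro s hs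
  rw [mem_ball_zero_iff] at hs
  have hN := h.neckData k
  have h1 := hasDerivAt_nodeConv_aux (h.good k).im_pos (hN.pos.trans hN.lt).le
    (fun σ => (hN.continuousOn_deriv σ).mono (hN.sphere_subset hN.lt.le le_rfl))
    (nodePt_mem_offCircles (h.good k) h.lt_rho (σ := σ) (hs.trans h.lt_rho) hs.ne)
  have h2 := (h1.comp s (hasDerivAt_nodePt (x.pt k) σ s)).differentiableAt
  have h3 := differentiableAt_regT (h.good k) (hs.trans h.lt_rho)
  exact (((h3.add_const _).add h2).const_mul _).differentiableWithinAt

/-- `U` is given only on the circle of radius r₂, but the neck equation identifies it there with a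
function holomorphic in the larger disk of radius r₃. Its Cauchy transform is therefore that
function, written in the coordinate w. -/
theorem cauchyT_mul (h : NeckSolution x t ρ r₁ r₂ r₃ U) (k : ℤ) (σ : Bool) {s : ℂ}
    (hs : ‖s‖ < r₂) :
    cauchyT (x.pt k) r₂ (U k σ) (nodeCoord s (x.pt k)) * deriv (fun s => nodeCoord s (x.pt k)) s =
      regPart (x.pt k) r₃ (neckDeriv x t r₂ U k) σ s := by
  have hr := h.pos.trans h.lt₁₂
  rw [← cauchyT_nodeCoord (h.good k) hr (h.lt₂₃.trans h.lt_rho)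
    ((h.differentiableOn_regPart k σ).mono (closedBall_subset_ball h.lt₂₃)) hs]
  congr 1
  rw [cauchyT, cauchyT]
  congr 1
  refine circleIntegral.integral_congr hr.le fun p hp => ?_
  simp only [h.eq k σ p hp]

/-- The singular part dw/w comes from `omegaT_eq`, the holomorphic part from the neck equation, and
the neck contribution is the pullback of the adjacent holomorphic part by w ↦ t²/w = t² g. The last
factor is dw/dz. -/
theorem coeffX_near (h : NeckSolution x t ρ r₁ r₂ r₃ U) (k : ℤ) (σ : Bool) {s u : ℂ}
    (hs : s ∈ neckDomain (x.pt k) ρ t r₂) (hs₂ : ‖s‖ < r₂) (hu : u ∈ latticeOf (x.tau k)) :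
    coeffX x t ρ r₁ r₂ r₃ U k (nodePt (x.pt k) σ s + u) =
      nodeForm x t r₂ U k σ (nodeCoord s (x.pt k)) *
        (sgn σ * deriv (fun s => nodeCoord s (x.pt k)) s) := by
  have hN := h.neckData k
  have hs₃ := hs₂.trans h.lt₂₃
  have hg := (h.good k).gaussT_ne_zero hs.1 hs.2.1
  rw [coeffX, hN.coeffT_add hu (Or.inr ⟨σ, s, hs, hs₃, 0, zero_mem _, add_zero _⟩),
    hN.coeffT_near hs hs₃]
  have h1 := h.cauchyT_mul k σ hs₂
  rw [regPart] at h1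
  have h2 := omegaT_eq (h.good k) hs.1 hs.2.1
  have h3 : neckDeriv x t r₂ U k σ s = -((t : ℂ) ^ 2 / nodeCoord s (x.pt k) ^ 2 *
      cauchyT (x.pt (adj k σ)) r₂ (U (adj k σ) (!σ)) ((t : ℂ) ^ 2 / nodeCoord s (x.pt k))) *
        deriv (fun s => nodeCoord s (x.pt k)) s := by
    have h4 : (t : ℂ) ^ 2 / nodeCoord s (x.pt k) = (t : ℂ) ^ 2 * gaussT s (x.pt k) := by
      rw [nodeCoord_eq hs.2.1, div_inv_eq_mul]
    rw [h4, neckDeriv, (h.good k).deriv_nodeCoord hs.1 hs.2.1, nodeCoord_eq hs.2.1]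
    field_simp
  rw [h2, nodeForm]
  generalize periodCorrection _ _ = C at *
  generalize nodeConv _ _ _ _ = D at *
  generalize regT _ _ = G at *
  generalize neckDeriv _ _ _ _ _ _ _ = E at *
  generalize cauchyT (x.pt (adj k σ)) _ _ _ = R' at *
  generalize cauchyT _ _ _ _ = R at *
  generalize deriv (fun s => nodeCoord s (x.pt k)) s = m' at *
  generalize nodeCoord _ _ = m at *
  linear_combination (-(G + C + D) - m' / m) * sgn_mul_self σ - sgn σ * h1 + sgn σ * h3

/-- Only dw/w contributes: the first Cauchy transform is holomorphic in the disk, and the term of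
the adjacent torus is exact on the circle, with primitive -Q(t²/w) up to sign conventions absorbed
in `nodeForm`. -/
theorem integral_nodeForm (h : NeckSolution x t ρ r₁ r₂ r₃ U) (k : ℤ) {ε : ℝ} (hε : 0 < ε)
    (hε₂ : ε < r₂) (htε : t ^ 2 < ε * r₂) :
    (∮ w in C(0, ε), nodeForm x t r₂ U k false w) = 2 * Real.pi * I := by
  have hr := h.pos.trans h.lt₁₂
  have hw0 : ∀ w ∈ sphere (0 : ℂ) ε, w ≠ 0 := fun w hw he => by
    rw [mem_sphere_zero_iff_norm, he, norm_zero] at hw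
    exact hε.ne hw
  have hR k σ := differentiableOn_cauchyT (h.good k) hr.le (h.lt₂₃.trans h.lt_rho)
    (h.continuousOn k σ)
  have hRc k σ : ContinuousOn (cauchyT (x.pt k) r₂ (U k σ)) (sphere 0 ε) :=
    (hR k σ).continuousOn.mono fun w hw => by
      rw [mem_sphere_zero_iff_norm] at hw
      rw [mem_ball_zero_iff, hw]
      exact hε₂
  have htw : ∀ w ∈ sphere (0 : ℂ) ε, ‖(t : ℂ) ^ 2 / w‖ < r₂ := fun w hw => by
    rw [mem_sphere_zero_iff_norm] at hw
    rw [norm_div, norm_pow, norm_real, Real.norm_eq_abs, sq_abs, hw, div_lt_iff₀ hε, mul_comm]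
    exact htε
  have hdiv : ContinuousOn (fun w : ℂ => (t : ℂ) ^ 2 / w) (sphere 0 ε) :=
    ContinuousOn.div (by fun_prop) (by fun_prop) hw0
  have h3 : ContinuousOn (fun w : ℂ => (t : ℂ) ^ 2 / w ^ 2 *
      cauchyT (x.pt (adj k false)) r₂ (U (adj k false) (!false)) ((t : ℂ) ^ 2 / w))
      (sphere 0 ε) := by
    refine (ContinuousOn.div (by fun_prop) (by fun_prop) fun w hw => pow_ne_zero 2 (hw0 w hw)).mul
      ((hR _ _).continuousOn.comp hdiv fun w hw => ?_)
    exact mem_ball_zero_iff.2 (htw w hw)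
  have h1 : ContinuousOn (fun w : ℂ => sgn false / w) (sphere 0 ε) :=
    ContinuousOn.div (by fun_prop) (by fun_prop) hw0
  have e1 : (∮ w in C(0, ε), sgn false / w) = 2 * Real.pi * I := by
    have := circleIntegral.integral_sub_inv_of_mem_ball (mem_ball_self (x := (0 : ℂ)) hε)
    simpa [sgn] using this
  have e2 : (∮ w in C(0, ε), cauchyT (x.pt k) r₂ (U k false) w) = 0 := by
    refine circleIntegral_eq_zero_of_differentiable_on_off_countable hε.le countable_empty
      ((hR k false).continuousOn.mono (closedBall_subset_ball hε₂)) fun w hw => ?_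
    exact (hR k false).differentiableAt
      (isOpen_ball.mem_nhds (ball_subset_ball hε₂.le hw.1))
  have e3 : (∮ w in C(0, ε), (t : ℂ) ^ 2 / w ^ 2 *
      cauchyT (x.pt (adj k false)) r₂ (U (adj k false) (!false)) ((t : ℂ) ^ 2 / w)) = 0 := by
    refine circleIntegral.integral_eq_zero_of_hasDerivWithinAt
      (f := fun w => -cauchyPrim (x.pt (adj k false)) r₂ (U (adj k false) (!false))
        ((t : ℂ) ^ 2 / w)) hε.le fun w hw => ?_
    have d1 := ((hasDerivAt_inv (hw0 w hw)).const_mul ((t : ℂ) ^ 2))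
    have d2 := hasDerivAt_cauchyPrim (h.good (adj k false)) hr.le (h.lt₂₃.trans h.lt_rho)
      (h.continuousOn (adj k false) (!false)) (htw w hw)
    have d3 := (HasDerivAt.comp w (by simpa only [div_eq_mul_inv] using d2) d1).neg
    refine (d3.congr_deriv ?_).hasDerivWithinAt.congr_of_eventuallyEq
      (Eventually.of_forall fun y => ?_) ?_
    · simp only [div_eq_mul_inv]
      ring
    · simp [div_eq_mul_inv]
    · simp [div_eq_mul_inv]
  simp only [nodeForm]
  rw [circleIntegral.integral_sub _ (h3.circleIntegrable hε.le), circleIntegral.integral_add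
    (h1.circleIntegrable hε.le) ((hRc _ _).circleIntegrable hε.le), e1, e2, e3]
  · ring
  · exact (h1.add (hRc _ _)).circleIntegrable hε.le

end NeckSolution

/-! ### Points of the glued surface -/

section Surface

variable {x : Params} {ε t : ℝ} {c : NodeCoordinates x ε}

theorem Glue.exists_coord (hε : 0 < ε) {a b : Σ k : ℤ, piece c t k} (h : Glue c t a b) :
    b.1 = a.1 + 1 ∧ ∃ w w' : ℂ, w * w' = (t : ℂ) ^ 2 ∧ ‖w‖ < ε ∧ ‖w'‖ < ε ∧
      (t = 0 → w = 0 ∧ w' = 0) ∧ (t ≠ 0 → t ^ 2 / ε < ‖w‖ ∧ t ^ 2 / ε < ‖w'‖) ∧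
      a.2.1 = toTorus (x.tau a.1) (c.plus a.1 w) ∧
      b.2.1 = toTorus (x.tau b.1) (c.minus b.1 w') := by
  cases h with
  | node ht k p p' hp hp' =>
    refine ⟨rfl, 0, 0, by simp [ht], by simpa using hε, by simpa using hε, fun _ => ⟨rfl, rfl⟩,
      fun h => absurd ht h, ?_, ?_⟩
    · simpa only [c.plus_zero] using hp
    · simpa only [c.minus_zero] using hp'
  | neck ht k p p' w w' hw hw' hww' hp hp' =>
    exact ⟨rfl, w, w', hww', hw.2, hw'.2, fun h => absurd h ht, fun _ => ⟨hw.1, hw'.1⟩, hp, hp'⟩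

theorem mul_unique {w w₁ w₂ : ℂ} (h1 : w * w₁ = (t : ℂ) ^ 2) (h2 : w * w₂ = (t : ℂ) ^ 2)
    (ht1 : t = 0 → w₁ = 0) (ht2 : t = 0 → w₂ = 0) : w₁ = w₂ := by
  by_cases ht : t = 0
  · rw [ht1 ht, ht2 ht]
  · have hw : w ≠ 0 := fun h => by
      rw [h, zero_mul, eq_comm, sq_eq_zero_iff] at h1
      exact ht (by exact_mod_cast h1)
    exact mul_left_cancel₀ hw (h1.trans h2.symm)

theorem Glue.right_unique (hε : 0 < ε) {a b b' : Σ k : ℤ, piece c t k} (h : Glue c t a b)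
    (h' : Glue c t a b') : b = b' := by
  obtain ⟨e, w, w₁, hw, hwε, hw₁ε, h0, -, ha, hb⟩ := h.exists_coord hε
  obtain ⟨e', w', w₁', hw', hwε', hw₁ε', h0', -, ha', hb'⟩ := h'.exists_coord hε
  have hww : w = w' := c.plus_injOn a.1 (mem_ball_zero_iff.2 (by linarith))
    (mem_ball_zero_iff.2 (by linarith)) (ha.symm.trans ha')
  subst hww
  have h1 := mul_unique hw hw' (fun h => (h0 h).2) fun h => (h0' h).2
  subst h1
  obtain ⟨l, p⟩ := b
  obtain ⟨l', p'⟩ := b'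
  simp only at e e'
  subst e
  subst e'
  congr 1
  exact Subtype.ext (hb.trans hb'.symm)

theorem Glue.left_unique (hε : 0 < ε) {a a' b : Σ k : ℤ, piece c t k} (h : Glue c t a b)
    (h' : Glue c t a' b) : a = a' := by
  obtain ⟨e, w, w₁, hw, hwε, hw₁ε, h0, -, ha, hb⟩ := h.exists_coord hε
  obtain ⟨e', w', w₁', hw', hwε', hw₁ε', h0', -, ha', hb'⟩ := h'.exists_coord hε
  have hww : w₁ = w₁' := c.minus_injOn b.1 (mem_ball_zero_iff.2 (by linarith))
    (mem_ball_zero_iff.2 (by linarith)) (hb.symm.trans hb')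
  subst hww
  rw [mul_comm] at hw hw'
  have h1 := mul_unique hw hw' (fun h => (h0 h).1) fun h => (h0' h).1
  subst h1
  obtain ⟨k, p⟩ := a
  obtain ⟨k', p'⟩ := a'
  simp only at e e'
  obtain rfl : k = k' := by linarith
  congr 1
  exact Subtype.ext (ha.trans ha'.symm)

theorem Glue.not_glue (hε : 0 < ε) {a b d : Σ k : ℤ, piece c t k} (h : Glue c t a b) :
    ¬ Glue c t b d := by
  intro h'
  obtain ⟨e, w, w₁, hw, hwε, hw₁ε, h0, -, ha, hb⟩ := h.exists_coord hε
  obtain ⟨e', w', w₁', hw', hwε', hw₁ε', h0', -, ha', hb'⟩ := h'.exists_coord hε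
  exact Set.disjoint_left.1 (c.disjoint b.1) ⟨w', mem_ball_zero_iff.2 (by linarith), rfl⟩
    ⟨w₁, mem_ball_zero_iff.2 (by linarith), hb.symm.trans ha'⟩

/-- A point is glued to at most one point on each side, and never on both sides because the disks
around the two nodes of a torus are disjoint. Chains of identifications therefore collapse to length
at most one. -/
theorem eq_or_glue_of_mk_eq (hε : 0 < ε) {a b : Σ k : ℤ, piece c t k}
    (h : Quot.mk (Glue c t) a = Quot.mk (Glue c t) b) : a = b ∨ Glue c t a b ∨ Glue c t b a := by
  have h' := Quot.eqvGen_exact h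
  clear h
  induction h' with
  | rel a b h => exact Or.inr (Or.inl h)
  | refl a => exact Or.inl rfl
  | symm a b _ ih =>
    rcases ih with h | h | h
    · exact Or.inl h.symm
    · exact Or.inr (Or.inr h)
    · exact Or.inr (Or.inl h)
  | trans a b d _ _ ih ih' =>
    rcases ih with rfl | h | h
    · exact ih'
    · rcases ih' with rfl | h' | h'
      · exact Or.inr (Or.inl h)
      · exact absurd h' (h.not_glue hε)
      · exact Or.inl (h.left_unique hε h')
    · rcases ih' with rfl | h' | h'
      · exact Or.inr (Or.inr h)
      · exact Or.inl (h.right_unique hε h')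
      · exact absurd h (h'.not_glue hε)

theorem ne_zero_of_glue (hε : 0 < ε) {k l : ℤ} {z : chartDomain c t k} {z' : chartDomain c t l}
    (h : Glue c t ⟨k, ⟨toTorus (x.tau k) z.1, Or.inr z.2⟩⟩
      ⟨l, ⟨toTorus (x.tau l) z'.1, Or.inr z'.2⟩⟩) : t ≠ 0 := by
  intro ht
  obtain ⟨-, w, w', -, -, -, h0, -, ha, -⟩ := h.exists_coord hε
  refine z.2 (Or.inl ⟨0, by simp [ht], ?_⟩)
  rw [← (h0 ht).1]
  exact ha.symm

end Surface

/-! ### The charts in terms of the local parameters at the nodes -/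

theorem nodePt_true (q : TorusParams) (s : ℂ) : nodePt q true s = q.v - s := by
  simp [nodePt, ctr, sgn, sub_eq_add_neg]

theorem nodePt_false (q : TorusParams) (s : ℂ) : nodePt q false s = s := by
  simp [nodePt, ctr, sgn]

section Charts

variable {x : Params} {ρ ε t : ℝ} {h : ∀ k, GoodParams (x.pt k) ρ} {hε : 2 * ε ≤ ρ / 2}

theorem nodeCoordinates_plus (k : ℤ) (w : ℂ) : (nodeCoordinates h hε).plus k w =
    nodePt (x.pt k) true (nodeInv (x.pt k) ρ w) := (nodePt_true (x.pt k) (nodeInv (x.pt k) ρ w)).symm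

theorem nodeCoordinates_minus (k : ℤ) (w : ℂ) : (nodeCoordinates h hε).minus k w =
    nodePt (x.pt k) false (nodeInv (x.pt k) ρ w) := (nodePt_false (x.pt k) (nodeInv (x.pt k) ρ w)).symm

theorem mem_closedDisks_iff {r : ℝ} {k : ℤ} {z : ℂ} :
    toTorus (x.tau k) z ∈ closedDisks (nodeCoordinates h hε) r k ↔
      ∃ σ, ∃ w, ‖w‖ ≤ r ∧ z - nodePt (x.pt k) σ (nodeInv (x.pt k) ρ w) ∈ latticeOf (x.tau k) := by
  simp only [closedDisks, nodeCoordinates_plus, nodeCoordinates_minus, mem_union, mem_image,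
    mem_closedBall_zero_iff, Bool.exists_bool, eq_comm (b := toTorus (x.tau k) z),
    GoodParams.toTorus_eq_iff]
  exact or_comm

theorem chart_eq (hε0 : 0 < ε) {k l : ℤ} {z : chartDomain (nodeCoordinates h hε) t k}
    {z' : chartDomain (nodeCoordinates h hε) t l}
    (he : chart (nodeCoordinates h hε) t k z = chart (nodeCoordinates h hε) t l z') :
    (k = l ∧ z.1 - z'.1 ∈ latticeOf (x.tau k)) ∨ t ≠ 0 ∧ ∃ σ, l = adj k σ ∧ ∃ w w' : ℂ,
      w * w' = (t : ℂ) ^ 2 ∧ ‖w‖ < ε ∧ ‖w'‖ < ε ∧ t ^ 2 / ε < ‖w‖ ∧ t ^ 2 / ε < ‖w'‖ ∧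
      z.1 - nodePt (x.pt k) σ (nodeInv (x.pt k) ρ w) ∈ latticeOf (x.tau k) ∧
      z'.1 - nodePt (x.pt l) (!σ) (nodeInv (x.pt l) ρ w') ∈ latticeOf (x.tau l) := by
  rcases eq_or_glue_of_mk_eq hε0 he with he | he | he
  · left
    obtain ⟨rfl, he⟩ := Sigma.mk.inj_iff.1 he
    exact ⟨rfl, GoodParams.toTorus_eq_iff.1 (congrArg Subtype.val (eq_of_heq he))⟩
  · right
    have ht := ne_zero_of_glue hε0 he
    obtain ⟨e, w, w', hww, hw, hw', -, h1, ha, hb⟩ := he.exists_coord hε0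
    simp only at e ha hb
    rw [nodeCoordinates_plus, GoodParams.toTorus_eq_iff] at ha
    rw [nodeCoordinates_minus, GoodParams.toTorus_eq_iff] at hb
    exact ⟨ht, true, e, w, w', hww, hw, hw', (h1 ht).1, (h1 ht).2, ha, hb⟩
  · right
    have ht := ne_zero_of_glue hε0 he
    obtain ⟨e, w, w', hww, hw, hw', -, h1, ha, hb⟩ := he.exists_coord hε0
    simp only at e ha hb
    rw [nodeCoordinates_plus, GoodParams.toTorus_eq_iff] at ha
    rw [nodeCoordinates_minus, GoodParams.toTorus_eq_iff] at hb
    exact ⟨ht, false, by simp [adj, e], w', w, (mul_comm _ _).trans hww, hw', hw, (h1 ht).2,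
      (h1 ht).1, hb, ha⟩

end Charts

theorem adj_ne (k : ℤ) (σ : Bool) : k ≠ adj k σ := by
  cases σ <;> simp only [adj] <;> grind

theorem adj_injective (k : ℤ) : Function.Injective (adj k) := by
  intro σ σ' h
  cases σ <;> cases σ' <;> simp [adj] at h ⊢ <;> omega

theorem gaussT_nodePt_add {q : TorusParams} {ρ : ℝ} (h : GoodParams q ρ) (σ : Bool) {s u : ℂ}
    (hs : ‖s‖ < ρ) (h0 : s ≠ 0) (hu : u ∈ latticeOf q.tau) :
    gaussT (nodePt q σ s + u) q = gaussT s q := by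
  have hm := nodePt_notMem h (σ := σ) hs h0 (zero_mem (latticeOf q.tau))
  rw [add_zero] at hm
  rw [gaussT_add_mem h.im_pos hu hm.1 hm.2, gaussT_nodePt]

theorem hasDerivAt_inv_gaussT {q : TorusParams} {ρ : ℝ} (h : GoodParams q ρ) (σ : Bool) {s u : ℂ}
    (hs : ‖s‖ < ρ) (h0 : s ≠ 0) (hu : u ∈ latticeOf q.tau) :
    HasDerivAt (fun z => (gaussT z q)⁻¹) (sgn σ * deriv (fun s => nodeCoord s q) s)
      (nodePt q σ s + u) := by
  have hz : sgn σ * (nodePt q σ s + u - u - ctr q σ) = s := by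
    rw [nodePt]
    linear_combination s * sgn_mul_self σ
  have hd : HasDerivAt (fun z => sgn σ * (z - u - ctr q σ)) (sgn σ) (nodePt q σ s + u) := by
    simpa using (((hasDerivAt_id (nodePt q σ s + u)).sub_const u).sub_const
      (ctr q σ)).const_mul (sgn σ)
  have h1 := HasDerivAt.comp (h₂ := fun s => nodeCoord s q) (nodePt q σ s + u)
    (by rw [hz]; exact (h.differentiableAt_nodeCoord (mem_ball_zero_iff.2 hs)).hasDerivAt) hd
  refine (h1.congr_deriv (mul_comm _ _)).congr_of_eventuallyEq ?_
  have e1 : ∀ᶠ z in 𝓝 (nodePt q σ s + u), ‖sgn σ * (z - u - ctr q σ)‖ < ρ :=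
    hd.continuousAt.norm.eventually (gt_mem_nhds (by simp only [hz]; exact hs))
  have e2 : ∀ᶠ z in 𝓝 (nodePt q σ s + u), sgn σ * (z - u - ctr q σ) ≠ 0 :=
    hd.continuousAt.eventually_ne (by rw [hz]; exact h0)
  filter_upwards [e1, e2] with z hz1 hz2
  have h3 := gaussT_nodePt_add h σ hz1 hz2 hu
  rw [exists_nodePt_eq, sub_add_cancel] at h3
  rw [h3]
  exact (nodeCoord_eq hz2 q).symm

theorem GoodParams.nodeInv_ne_zero {q : TorusParams} {ρ : ℝ} (h : GoodParams q ρ) {w : ℂ}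
    (hw : ‖w‖ < ρ / 2) (h0 : w ≠ 0) : nodeInv q ρ w ≠ 0 := fun he => h0 <| by
  rw [← h.nodeCoord_nodeInv hw, he, nodeCoord_zero]

theorem nodeInv_mem_neckDomain {q : TorusParams} {ρ t r₂ : ℝ} (h : GoodParams q ρ) {w : ℂ}
    (hw : ‖w‖ < ρ / 2) (h0 : w ≠ 0) (ht : t ^ 2 < ‖w‖ * r₂) :
    nodeInv q ρ w ∈ neckDomain q ρ t r₂ := by
  refine ⟨mem_ball_zero_iff.1 (h.nodeInv_mem hw), h.nodeInv_ne_zero hw h0, ?_⟩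
  rw [← inv_inv (gaussT _ _), h.inv_gaussT_nodeInv hw h0, norm_mul, norm_pow, norm_real,
    Real.norm_eq_abs, sq_abs, norm_inv, ← div_eq_mul_inv, div_lt_iff₀ (norm_pos_iff.2 h0), mul_comm]
  exact ht

/-! ### Compatibility of the coefficients across the necks -/

namespace NeckSolution

variable {x : Params} {t ρ r₁ r₂ r₃ ε : ℝ} {U : ℤ → Bool → ℂ → ℂ}

/-- A point at local parameter |s| ≤ r₁ that is outside the removed disks satisfies |1/g(s)| > t²/ε.
Hence |t² g(s)| < ε < r₂, and the neck expression of the form is defined there. -/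
theorem chartDomain_subset (h : NeckSolution x t ρ r₁ r₂ r₃ U) (hε : 2 * ε ≤ ρ / 2) (hε0 : 0 < ε)
    (hε₂ : ε < r₂) (ht : t ^ 2 / ε ≤ ε) (k : ℤ) :
    chartDomain (nodeCoordinates h.good hε) t k ⊆ domX x t ρ r₁ r₂ r₃ k := by
  intro z hz
  by_cases hzo : z ∈ outer (x.pt k) r₁
  · exact Or.inl hzo
  right
  simp only [outer, mem_ofPred_eq, not_forall, not_not] at hzo
  obtain ⟨σ, s, hs, hu⟩ := hzo
  rw [mem_closedBall_zero_iff] at hs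
  have hr₁ := h.lt₁₂
  have hr₂ := h.lt₂₃
  have hr₃ := h.lt_rho
  have hsρ : ‖s‖ < ρ := by linarith
  have hz' : ∀ w, ‖w‖ ≤ t ^ 2 / ε → nodeInv (x.pt k) ρ w ≠ s := fun w hw he =>
    hz (mem_closedDisks_iff.2 ⟨σ, w, hw, by rw [he]; exact hu⟩)
  have h0 : s ≠ 0 := fun he => hz' 0 (by rw [norm_zero]; positivity) (by
    rw [he, (h.good k).nodeInv_zero])
  have hm : t ^ 2 / ε < ‖nodeCoord s (x.pt k)‖ := by
    by_contra hle
    refine hz' _ (not_lt.1 hle) ((h.good k).nodeInv_nodeCoord (mem_ball_zero_iff.2 hsρ) ?_)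
    linarith
  refine ⟨σ, s, ⟨hsρ, h0, ?_⟩, by linarith, _, hu, by ring⟩
  rw [nodeCoord_eq h0, norm_inv] at hm
  have hg : 0 < ‖gaussT s (x.pt k)‖ := norm_pos_iff.2 ((h.good k).gaussT_ne_zero hsρ h0)
  rw [norm_mul, norm_pow, norm_real, Real.norm_eq_abs, sq_abs]
  rw [div_lt_iff₀ hε0, ← div_eq_inv_mul, lt_div_iff₀ hg] at hm
  linarith

/-- A change of parameter either stays on one torus, where it is a translation by a period, or
passes through a neck, where it preserves the product w w' = t². The second case reduces to
`nodeForm_adj` by differentiating this product. -/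
theorem compatible (h : NeckSolution x t ρ r₁ r₂ r₃ U) (hε : 2 * ε ≤ ρ / 2) (hε0 : 0 < ε)
    (hε₂ : ε < r₂) (ht : t ^ 2 / ε ≤ ε) (k l : ℤ) (V : Set ℂ) (g : ℂ → ℂ) (hVo : IsOpen V)
    (hg : DifferentiableOn ℂ g V)
    (hV : ∀ z ∈ V, z ∈ chartDomain (nodeCoordinates h.good hε) t k)
    (hV' : ∀ z ∈ V, g z ∈ chartDomain (nodeCoordinates h.good hε) t l)
    (hgl : ∀ (z : ℂ) (hz : z ∈ V), chart (nodeCoordinates h.good hε) t k ⟨z, hV z hz⟩ =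
      chart (nodeCoordinates h.good hε) t l ⟨g z, hV' z hz⟩) (z : ℂ) (hz : z ∈ V) :
    coeffX x t ρ r₁ r₂ r₃ U k z = coeffX x t ρ r₁ r₂ r₃ U l (g z) * deriv g z := by
  have hgz := (hg.differentiableAt (hVo.mem_nhds hz)).hasDerivAt
  have hρ := (h.good k).pos
  rcases chart_eq hε0 (hgl z hz) with ⟨rfl, hu⟩ | ⟨ht0, σ, hl, w, w', hww, hw, hw', htw, htw', hu, hu'⟩
  -- The function y - g y is continuous with values in the lattice, whose nonzero elements have norm
  -- at least 4ρ; hence it is locally constant.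
  · have hev : g =ᶠ[𝓝 z] fun y => y - (z - g z) := by
      have hc : ∀ᶠ y in 𝓝 z, ‖y - g y - (z - g z)‖ < 4 * ρ := by
        have h1 : ContinuousAt (fun y => ‖y - g y - (z - g z)‖) z :=
          ((continuousAt_id.sub hgz.continuousAt).sub continuousAt_const).norm
        exact h1.eventually (gt_mem_nhds (by simpa using hρ))
      filter_upwards [hc, hVo.mem_nhds hz] with y hy hyV
      have hy' : y - g y ∈ latticeOf (x.tau k) := by
        rcases chart_eq hε0 (hgl y hyV) with ⟨-, hu⟩ | ⟨-, σ, hl, -⟩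
        · exact hu
        · exact absurd hl (adj_ne k σ)
      have := (h.good k).eq_zero_of_mem (sub_mem hy' hu) hy
      linear_combination -this
    have hd : deriv g z = 1 := by
      rw [hev.deriv_eq]
      simp
    rw [hd, mul_one]
    have := (h.neckData k).coeffT_add (neg_mem hu)
      (h.chartDomain_subset hε hε0 hε₂ ht k (hV z hz))
    rw [neg_sub, add_sub_cancel] at this
    exact this.symm
  · subst hl
    -- The whole of V passes through the same neck, since `adj k` is injective.
    have hprod : ∀ y ∈ V, (gaussT y (x.pt k))⁻¹ * (gaussT (g y) (x.pt (adj k σ)))⁻¹ =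
        (t : ℂ) ^ 2 := by
      intro y hy
      rcases chart_eq hε0 (hgl y hy) with ⟨he, -⟩ |
        ⟨-, σ', hl, w, w', hww, hw, hw', htw, htw', hu, hu'⟩
      · exact absurd he (adj_ne k σ)
      · obtain rfl := adj_injective k hl
        have hwρ : ‖w‖ < ρ / 2 := by linarith
        have hwρ' : ‖w'‖ < ρ / 2 := by linarith
        have hw0 : w ≠ 0 := norm_pos_iff.1 (lt_of_le_of_lt (by positivity) htw)
        have hw0' : w' ≠ 0 := norm_pos_iff.1 (lt_of_le_of_lt (by positivity) htw')
        have e1 := gaussT_nodePt_add (h.good k) σ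
          (mem_ball_zero_iff.1 ((h.good k).nodeInv_mem hwρ)) ((h.good k).nodeInv_ne_zero hwρ hw0) hu
        have e2 := gaussT_nodePt_add (h.good (adj k σ)) (!σ)
          (mem_ball_zero_iff.1 ((h.good (adj k σ)).nodeInv_mem hwρ'))
          ((h.good (adj k σ)).nodeInv_ne_zero hwρ' hw0') hu'
        rw [add_sub_cancel] at e1 e2
        rw [e1, e2, (h.good _).inv_gaussT_nodeInv hwρ hw0, (h.good _).inv_gaussT_nodeInv hwρ' hw0',
          hww]
    have hwρ : ‖w‖ < ρ / 2 := by linarith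
    have hwρ' : ‖w'‖ < ρ / 2 := by linarith
    have hw0 : w ≠ 0 := norm_pos_iff.1 (lt_of_le_of_lt (by positivity) htw)
    have hw0' : w' ≠ 0 := norm_pos_iff.1 (lt_of_le_of_lt (by positivity) htw')
    have ht2 {w : ℂ} (hw : ‖w‖ < ε) (htw : t ^ 2 / ε < ‖w‖) : t ^ 2 < ‖w‖ * r₂ := by
      rw [div_lt_iff₀ hε0] at htw
      have := norm_nonneg w
      nlinarith
    have hs := nodeInv_mem_neckDomain (h.good k) hwρ hw0 (ht2 hw htw)
    have hs' := nodeInv_mem_neckDomain (h.good (adj k σ)) hwρ' hw0' (ht2 hw' htw')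
    have hs₂ := ((h.good k).norm_nodeInv_le hwρ).trans_lt (hw.trans hε₂)
    have hs₂' := ((h.good (adj k σ)).norm_nodeInv_le hwρ').trans_lt (hw'.trans hε₂)
    have c1 := h.coeffX_near k σ hs hs₂ hu
    have c2 := h.coeffX_near (adj k σ) (!σ) hs' hs₂' hu'
    have d1 := hasDerivAt_inv_gaussT (h.good k) σ hs.1 hs.2.1 hu
    have d2 := hasDerivAt_inv_gaussT (h.good (adj k σ)) (!σ) hs'.1 hs'.2.1 hu'
    have e1 := gaussT_nodePt_add (h.good k) σ hs.1 hs.2.1 hu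
    have e2 := gaussT_nodePt_add (h.good (adj k σ)) (!σ) hs'.1 hs'.2.1 hu'
    rw [add_sub_cancel] at c1 c2 d1 d2 e1 e2
    rw [(h.good _).nodeCoord_nodeInv hwρ] at c1
    rw [(h.good _).nodeCoord_nodeInv hwρ'] at c2
    have d3 := d1.mul (d2.comp z hgz)
    have d4 : HasDerivAt (fun y => (gaussT y (x.pt k))⁻¹ * (gaussT (g y) (x.pt (adj k σ)))⁻¹) 0 z := by
      refine (hasDerivAt_const z ((t : ℂ) ^ 2)).congr_of_eventuallyEq ?_
      filter_upwards [hVo.mem_nhds hz] with y hy using hprod y hy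
    have d5 := d3.unique d4
    simp only [Function.comp_apply] at d5
    rw [e1, e2, (h.good _).inv_gaussT_nodeInv hwρ hw0,
      (h.good _).inv_gaussT_nodeInv hwρ' hw0'] at d5
    have hf := nodeForm_adj x t r₂ U k σ hw0 ht0
    have hw'' : (t : ℂ) ^ 2 / w = w' := by rw [← hww, mul_div_cancel_left₀ _ hw0]
    have hw''' : (t : ℂ) ^ 2 / w ^ 2 = w' / w := by
      rw [← hww]
      field_simp
    rw [hw'', hw'''] at hf
    rw [c1, c2, ← hf]
    generalize nodeForm _ _ _ _ _ _ _ = F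
    generalize sgn σ * deriv (fun s => nodeCoord s (x.pt k)) (nodeInv (x.pt k) ρ w) = A at *
    generalize sgn (!σ) * deriv (fun s => nodeCoord s (x.pt (adj k σ)))
      (nodeInv (x.pt (adj k σ)) ρ w') = B at *
    generalize deriv g z = D at *
    field_simp
    linear_combination (-F) * d5

end NeckSolution

/-! ### The 1-form on the glued surface -/

namespace NeckSolution

variable {x : Params} {t ρ r₁ r₂ r₃ ε : ℝ} {U : ℤ → Bool → ℂ → ℂ}

theorem coeffX_outer (h : NeckSolution x t ρ r₁ r₂ r₃ U) (k : ℤ) {z : ℂ}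
    (hz : z ∈ outer (x.pt k) r₁) :
    coeffX x t ρ r₁ r₂ r₃ U k z = omegaT z (x.pt k) + periodCorrection (x.tau k)
      (nodePeriod (fun σ p => -(sgn σ * p) * neckDeriv x t r₂ U k σ p) r₁) +
        nodeConv (x.pt k) (neckDeriv x t r₂ U k) r₁ z :=
  (h.neckData k).coeffT_outer hz

theorem coeffX_zero (h : NeckSolution x 0 ρ r₁ r₂ r₃ U) (k : ℤ) {z : ℂ}
    (hz : z ∈ domX x 0 ρ r₁ r₂ r₃ k) : coeffX x 0 ρ r₁ r₂ r₃ U k z = omegaT z (x.pt k) := by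
  have h0 : neckDeriv x 0 r₂ U k = fun _ _ => 0 := by
    ext σ s
    simp [neckDeriv]
  have hP r : nodePeriod (fun σ p => -(sgn σ * p) * neckDeriv x 0 r₂ U k σ p) r = 0 := by
    simp [nodePeriod, h0, circleIntegral]
  have hC r z : nodeConv (x.pt k) (neckDeriv x 0 r₂ U k) r z = 0 := by
    simp [nodeConv, h0, circleIntegral]
  rcases hz with hz | ⟨σ, s, hsA, hs, u, hu, rfl⟩
  · rw [h.coeffX_outer k hz, hP, hC, periodCorrection_zero, add_zero, add_zero]
  · have hm := nodePt_notMem (h.good k) (σ := σ) hsA.1 hsA.2.1 (zero_mem _)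
    rw [add_zero] at hm
    rw [coeffX, (h.neckData k).coeffT_add hu (Or.inr ⟨σ, s, hsA, hs, 0, zero_mem _, add_zero _⟩),
      (h.neckData k).coeffT_near hsA hs, hP, hC, h0, periodCorrection_zero,
      omegaT_add (h.good k).im_pos hu hm.1 hm.2, omegaT_nodePt]
    simp

theorem tendsto_mul_omegaT {q : TorusParams} {ρ : ℝ} (h : GoodParams q ρ) :
    Tendsto (fun z => z * omegaT z q) (𝓝[≠] 0) (𝓝 1) := by
  have hm := (h.mem 0 (mem_ball_self h.pos)).1
  have h1 := (hasDerivAt_wZetaReg h.im_pos hm.1).continuousAt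
  have h2 := ((hasDerivAt_wZeta h.im_pos hm.2.2).comp_sub_const 0 q.v).continuousAt
  have h3 : ContinuousAt (fun z => 1 + z * (wZetaReg z q.tau - wZeta (z - q.v) q.tau -
      wXi q.v q.tau)) 0 :=
    continuousAt_const.add (continuousAt_id.mul ((h1.sub h2).sub continuousAt_const))
  have h4 : Tendsto _ _ _ := h3.tendsto.mono_left (nhdsWithin_le_nhds (s := {0}ᶜ))
  rw [zero_mul, add_zero] at h4
  refine h4.congr' ?_
  filter_upwards [self_mem_nhdsWithin] with z hz
  have hz : z ≠ 0 := hz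
  rw [omegaT, wZeta_eq z]
  field_simp
  ring

theorem eventually_mem_domX (h : NeckSolution x 0 ρ r₁ r₂ r₃ U) (k : ℤ) (σ : Bool) :
    ∀ᶠ s in 𝓝[≠] (0 : ℂ), nodePt (x.pt k) σ s ∈ domX x 0 ρ r₁ r₂ r₃ k := by
  have hr₂ := h.pos.trans h.lt₁₂
  filter_upwards [self_mem_nhdsWithin, nhdsWithin_le_nhds
    (ball_mem_nhds (0 : ℂ) (hr₂.trans h.lt₂₃))] with s hs hs'
  rw [mem_ball_zero_iff] at hs'
  exact Or.inr ⟨σ, s, ⟨hs'.trans h.lt_rho, hs, by simpa using hr₂⟩, hs', 0, zero_mem _, add_zero _⟩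

theorem regular (h : NeckSolution x 0 ρ r₁ r₂ r₃ U) (k : ℤ) :
    Tendsto (fun z => z * coeffX x 0 ρ r₁ r₂ r₃ U k z) (𝓝[≠] 0) (𝓝 1) ∧
      Tendsto (fun z => (z - x.v k) * coeffX x 0 ρ r₁ r₂ r₃ U k z) (𝓝[≠] (x.v k)) (𝓝 (-1)) := by
  have key := tendsto_mul_omegaT (h.good k)
  constructor
  · refine key.congr' ?_
    filter_upwards [h.eventually_mem_domX k false] with z hz
    rw [nodePt_false] at hz
    rw [h.coeffX_zero k hz]
  · have h1 : Tendsto (fun z => x.v k - z) (𝓝[≠] (x.v k)) (𝓝[≠] 0) := by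
      refine tendsto_nhdsWithin_iff.2 ⟨?_, ?_⟩
      · have : Tendsto (fun z => x.v k - z) (𝓝 (x.v k)) (𝓝 (x.v k - x.v k)) :=
          tendsto_const_nhds.sub tendsto_id
        rw [sub_self] at this
        exact this.mono_left nhdsWithin_le_nhds
      · filter_upwards [self_mem_nhdsWithin] with z hz
        exact sub_ne_zero.2 (Ne.symm hz)
    have h2 := (key.comp h1).neg
    refine h2.congr' ?_
    filter_upwards [h1.eventually (h.eventually_mem_domX k true)] with z hz
    have e : nodePt (x.pt k) true (x.v k - z) = z := by
      rw [nodePt_true]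
      exact sub_sub_cancel (x.v k) z
    have e' := omegaT_nodePt (x.pt k) true (x.v k - z)
    rw [e] at hz e'
    rw [h.coeffX_zero k hz, Function.comp_apply, ← e']
    ring

/-- The 1-form on the glued surface defined by a solution of the neck equation. -/
def oneForm (h : NeckSolution x t ρ r₁ r₂ r₃ U) (hε : 2 * ε ≤ ρ / 2) (hε0 : 0 < ε) (hε₂ : ε < r₂)
    (ht : t ^ 2 / ε ≤ ε) : OneForm (nodeCoordinates h.good hε) t where
  coeff := coeffX x t ρ r₁ r₂ r₃ U
  holomorphic k := (h.neckData k).differentiableOn_coeffT.mono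
    (h.chartDomain_subset hε hε0 hε₂ ht k)
  compatible := h.compatible hε hε0 hε₂ ht
  regular := by
    rintro rfl
    exact ⟨fun _ => 1, fun k => h.regular k⟩

theorem oneForm_imaginaryPeriod (h : NeckSolution x t ρ r₁ r₂ r₃ U) (hε : 2 * ε ≤ ρ / 2)
    (hε0 : 0 < ε) (hε₂ : ε < r₂) (ht : t ^ 2 / ε ≤ ε) (k : ℤ) {u : ℂ}
    (hu : u = 1 ∨ u = x.tau k) : (h.oneForm hε hε0 hε₂ ht).ImaginaryPeriod k u :=
  fun _ hγ hγD h01 => (h.neckData k).re_period_eq_zero hu hγ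
    (fun s hs => h.chartDomain_subset hε hε0 hε₂ ht k (hγD s hs)) h01

theorem oneForm_integralBoundaryDisk (h : NeckSolution x t ρ r₁ r₂ r₃ U) (hε : 2 * ε ≤ ρ / 2)
    (hε0 : 0 < ε) (hε₂ : ε < r₂) (ht : t ^ 2 / ε ≤ ε) (k : ℤ) :
    (h.oneForm hε hε0 hε₂ ht).integralBoundaryDisk k = 2 * Real.pi * I := by
  have ht2 : t ^ 2 < ε * r₂ := by
    rw [div_le_iff₀ hε0] at ht
    nlinarith
  rw [← h.integral_nodeForm k hε0 hε₂ ht2]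
  refine circleIntegral.integral_congr hε0.le fun w hw => ?_
  rw [mem_sphere_zero_iff_norm] at hw
  have hwρ : ‖w‖ < ρ / 2 := by linarith [(h.good k).pos]
  have hw0 : w ≠ 0 := norm_pos_iff.1 (by rw [hw]; exact hε0)
  have hs := nodeInv_mem_neckDomain (h.good k) hwρ hw0 (by rw [hw]; exact ht2)
  have hs₂ := ((h.good k).norm_nodeInv_le hwρ).trans_lt (hw.trans_lt hε₂)
  have c1 := h.coeffX_near k false hs hs₂ (zero_mem _)
  rw [add_zero, nodePt_false, (h.good k).nodeCoord_nodeInv hwρ] at c1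
  have c2 := ((h.good k).hasDerivAt_nodeInv hwρ).deriv
  change coeffX x t ρ r₁ r₂ r₃ U k (nodeInv (x.pt k) ρ w) * deriv (nodeInv (x.pt k) ρ) w = _
  rw [c1, c2, show sgn false = 1 from rfl, one_mul, mul_assoc,
    mul_inv_cancel₀ ((h.good k).deriv_nodeCoord_ne_zero (mem_ball_zero_iff.2 hs.1)), mul_one]

end NeckSolution

/-! ### The fixed domain -/

theorem mem_chartDomain_of_mem_outer {x : Params} {ρ ε t r₁ : ℝ} {h : ∀ k, GoodParams (x.pt k) ρ}
    {hε : 2 * ε ≤ ρ / 2} (ht : t ^ 2 / ε ≤ r₁) (hr₁ : r₁ < ρ / 2) {k : ℤ} {z : ℂ}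
    (hz : z ∈ outer (x.pt k) r₁) : z ∈ chartDomain (nodeCoordinates h hε) t k := by
  intro hmem
  obtain ⟨σ, w, hw, hu⟩ := mem_closedDisks_iff.1 hmem
  refine hz σ _ (mem_closedBall_zero_iff.2 ?_) hu
  exact ((h k).norm_nodeInv_le ((hw.trans ht).trans_lt hr₁)).trans (hw.trans ht)

theorem psi_add (τ z w : ℂ) : psi τ (z + w) = psi τ z + psi τ w := by
  simp [psi]
  ring

theorem psi_sub (τ z w : ℂ) : psi τ (z - w) = psi τ z - psi τ w := by
  simp [psi]
  ring

theorem psi_mem_latticeOf {τ u : ℂ} (hu : u ∈ latticeOf I) : psi τ u ∈ latticeOf τ := by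
  obtain ⟨m, n, rfl⟩ := mem_latticeOf.1 hu
  exact mem_latticeOf.2 ⟨m, n, by simp [psi, mul_comm]⟩

theorem psiInv_psi (τ z : ℂ) (hτ : τ.im ≠ 0) : psiInv τ (psi τ z) = z := by
  apply Complex.ext <;> simp [psiInv, psi, coordX, coordY, hτ]
  field_simp
  ring

theorem psiInv_sub (τ z w : ℂ) : psiInv τ (z - w) = psiInv τ z - psiInv τ w := by
  apply Complex.ext <;> simp [psiInv, coordX, coordY] <;> ring

theorem psiInv_mem_latticeOf {τ u : ℂ} (hτ : τ.im ≠ 0) (hu : u ∈ latticeOf τ) :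
    psiInv τ u ∈ latticeOf I := by
  obtain ⟨m, n, rfl⟩ := mem_latticeOf.1 hu
  refine mem_latticeOf.2 ⟨m, n, ?_⟩
  rw [← psiInv_psi τ ((m : ℂ) + n * I) hτ]
  simp [psi, mul_comm]

theorem norm_psi_le (τ z : ℂ) : ‖psi τ z‖ ≤ (1 + ‖τ‖) * ‖z‖ := by
  calc ‖psi τ z‖ ≤ ‖(z.re : ℂ)‖ + ‖τ * (z.im : ℂ)‖ := norm_add_le _ _
    _ ≤ ‖z‖ + ‖τ‖ * ‖z‖ := by
        rw [norm_mul, norm_real, norm_real]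
        gcongr
        · exact abs_re_le_norm z
        · exact abs_im_le_norm z
    _ = _ := by ring

theorem norm_psiInv_le (τ z : ℂ) : ‖psiInv τ z‖ ≤ (1 + |τ.im|⁻¹ * |τ.re| + |τ.im|⁻¹) * ‖z‖ := by
  have h2 : |coordY z τ| ≤ |τ.im|⁻¹ * ‖z‖ := by
    unfold coordY
    rw [abs_div, div_eq_inv_mul]
    gcongr
    exact abs_im_le_norm z
  have h1 : |coordX z τ| ≤ (1 + |τ.im|⁻¹ * |τ.re|) * ‖z‖ := by
    have e : coordX z τ = z.re - coordY z τ * τ.re := rfl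
    rw [e]
    calc |z.re - coordY z τ * τ.re| ≤ |z.re| + |coordY z τ * τ.re| := abs_sub _ _
      _ ≤ ‖z‖ + |τ.im|⁻¹ * ‖z‖ * |τ.re| := by
          rw [abs_mul]
          gcongr
          exact abs_re_le_norm z
      _ = _ := by ring
  calc ‖psiInv τ z‖ ≤ ‖(coordX z τ : ℂ)‖ + ‖I * (coordY z τ : ℂ)‖ := norm_add_le _ _
    _ = |coordX z τ| + |coordY z τ| := by simp
    _ ≤ _ := by linarith

theorem mem_fixedDomain_iff {x₀ : Params} {ε' : ℝ} {k : ℤ} {z : ℂ} :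
    toTorus I z ∈ fixedDomain x₀ ε' k ↔ ∀ σ : Bool, ∀ p : ℂ, ‖p‖ ≤ ε' →
      z - ((if σ then psiInv (x₀.tau k) (x₀.v k) else 0) + p) ∉ latticeOf I := by
  simp only [fixedDomain, mem_compl_iff, mem_union, mem_image, not_or, not_exists, not_and,
    Bool.forall_bool, eq_comm (b := toTorus I z), GoodParams.toTorus_eq_iff]
  refine and_congr ?_ ?_
  · simp
  · constructor
    · intro h p hp
      exact h _ (by simpa using hp)
    · intro h p hp
      have := h (p - psiInv (x₀.tau k) (x₀.v k)) (by simpa [dist_eq_norm] using hp)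
      simpa using this

/-- If the parameters are close to the reference value, the image of the fixed domain is contained
in the complement of small disks around the nodes. -/
theorem psi_mem_outer {x₀ x : Params} {ε' r₁ M : ℝ} {k : ℤ} (hτ : 0 < (x.tau k).im)
    (hM : ∀ z, ‖psiInv (x.tau k) z‖ ≤ M * ‖z‖) (hM0 : 0 ≤ M)
    (hd : ‖psiInv (x.tau k) (x.v k) - psiInv (x₀.tau k) (x₀.v k)‖ ≤ ε' / 2)
    (hr : M * r₁ ≤ ε' / 2) {z : ℂ} (hz : toTorus I z ∈ fixedDomain x₀ ε' k) :
    psi (x.tau k) z ∈ outer (x.pt k) r₁ := by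
  intro σ p hp hu
  rw [mem_closedBall_zero_iff] at hp
  have h1 := psiInv_mem_latticeOf hτ.ne' hu
  rw [psiInv_sub, psiInv_psi _ _ hτ.ne'] at h1
  have hMp : ‖psiInv (x.tau k) p‖ ≤ ε' / 2 :=
    ((hM p).trans (mul_le_mul_of_nonneg_left hp hM0)).trans hr
  have hz' := mem_fixedDomain_iff.1 hz σ
  cases σ
  · refine hz' (psiInv (x.tau k) p) (by linarith [norm_nonneg (psiInv (x.tau k) p)]) ?_
    rw [nodePt_false] at h1
    simpa using h1
  · rw [nodePt_true] at h1
    -- Half of the radius ε' absorbs the displacement of the node from its reference position, the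
    -- other half the disk of radius r₁.
    refine hz' (psiInv (x.tau k) (x.v k) - psiInv (x₀.tau k) (x₀.v k) - psiInv (x.tau k) p) ?_ ?_
    · linarith [norm_sub_le (psiInv (x.tau k) (x.v k) - psiInv (x₀.tau k) (x₀.v k))
        (psiInv (x.tau k) p)]
    · convert h1 using 1
      change _ = z - psiInv (x.tau k) (x.v k - p)
      rw [psiInv_sub, if_pos rfl]
      ring

/-- If the parameters are close to the reference value, the image of the fixed domain contains the
complement of the disks around the nodes. -/
theorem mem_fixedDomain {x₀ x : Params} {ρ ε ε' M : ℝ} {h : ∀ k, GoodParams (x.pt k) ρ}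
    {hε : 2 * ε ≤ ρ / 2} (hε0 : 0 < ε) {k : ℤ} (hM : ∀ z, ‖psi (x.tau k) z‖ ≤ M * ‖z‖)
    (hM0 : 0 ≤ M)
    (hd : ‖psiInv (x.tau k) (x.v k) - psiInv (x₀.tau k) (x₀.v k)‖ ≤ ε')
    (hr : M * (2 * ε') ≤ ε / 3) {z : ℂ}
    (hz : toTorus (x.tau k) (psi (x.tau k) z) ∉ closedDisks (nodeCoordinates h hε) ε k) :
    toTorus I z ∈ fixedDomain x₀ ε' k := by
  rw [mem_fixedDomain_iff]
  intro σ p hp hu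
  have hτ := (h k).im_pos.ne'
  have hρ := (h k).pos
  set d : ℂ := if σ then psiInv (x.tau k) (x.v k) - psiInv (x₀.tau k) (x₀.v k) else 0 with hd_def
  have hdn : ‖d‖ ≤ ε' := by
    rw [hd_def]
    split_ifs
    · exact hd
    · simpa using (norm_nonneg p).trans hp
  -- The local parameter, at the displaced node, of a point in the removed disk. The bound ε/3 and
  -- the distortion factor 3 of the coordinate give |1/g(s)| ≤ ε, contrary to `hz`.
  set s := sgn σ * psi (x.tau k) (p - d) with hs_def
  have hs : ‖s‖ ≤ ε / 3 := by
    rw [hs_def, norm_mul, norm_sgn, one_mul]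
    refine (hM _).trans (le_trans (mul_le_mul_of_nonneg_left ?_ hM0) hr)
    linarith [norm_sub_le p d]
  have hsρ : s ∈ ball (0 : ℂ) ρ := mem_ball_zero_iff.2 (by linarith)
  have hm := (h k).norm_nodeCoord_le hsρ
  refine hz (mem_closedDisks_iff.2 ⟨σ, nodeCoord s (x.pt k), by linarith, ?_⟩)
  rw [(h k).nodeInv_nodeCoord hsρ (by linarith)]
  have h1 := psi_mem_latticeOf (τ := x.tau k) hu
  rw [psi_sub] at h1
  convert h1 using 2
  rw [nodePt, hs_def, ← mul_assoc, sgn_mul_self, one_mul, psi_add, psi_sub]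
  cases σ
  · simp [ctr, hd_def, psi]
  · have := psi_psiInv (x.tau k) (x.v k) hτ
    simp only [ctr, hd_def, if_true, psi_sub, this]
    change x.v k + _ = _
    ring

/-! ### Functions on the circles around the nodes -/

/-- The circles of radius `r` around all the nodes. -/
abbrev NodeCircles (r : ℝ) : Type := (ℤ × Bool) × sphere (0 : ℂ) r

/-- The parametrization of all the circles by an angle. -/
def nodeAngle {r : ℝ} (hr : 0 ≤ r) : C((ℤ × Bool) × ℝ, NodeCircles r) where
  toFun w := (w.1, ⟨circleMap 0 r w.2, circleMap_mem_sphere 0 hr w.2⟩)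
  continuous_toFun := continuous_fst.prodMk
    (((continuous_circleMap 0 r).comp continuous_snd).subtype_mk _)

/-- The composition with the parametrization by an angle. -/
def pullAngle {r : ℝ} (hr : 0 ≤ r) :
    (NodeCircles r →ᵇ ℂ) →L[ℝ] (((ℤ × Bool) × ℝ) →ᵇ ℂ) :=
  LinearMap.mkContinuous
    { toFun := fun f => f.compContinuous (nodeAngle hr)
      map_add' := fun _ _ => rfl
      map_smul' := fun _ _ => rfl } 1 fun f => by
    rw [one_mul]
    exact (BoundedContinuousFunction.norm_le (norm_nonneg _)).2 fun i => f.norm_coe_le_norm _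

open Classical in
/-- A function on the circles, as a family of functions of the local parameters. -/
def circleFun {r : ℝ} (f : NodeCircles r →ᵇ ℂ) (k : ℤ) (σ : Bool) (s : ℂ) : ℂ :=
  if h : s ∈ sphere (0 : ℂ) r then f ((k, σ), ⟨s, h⟩) else 0

theorem circleFun_of_mem {r : ℝ} (f : NodeCircles r →ᵇ ℂ) (k : ℤ) (σ : Bool) {s : ℂ}
    (h : s ∈ sphere (0 : ℂ) r) : circleFun f k σ s = f ((k, σ), ⟨s, h⟩) := dif_pos h

theorem continuousOn_circleFun {r : ℝ} (f : NodeCircles r →ᵇ ℂ) (k : ℤ) (σ : Bool) :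
    ContinuousOn (circleFun f k σ) (sphere 0 r) := by
  rw [continuousOn_iff_continuous_domRestrict]
  have : (sphere (0 : ℂ) r).domRestrict (circleFun f k σ) = fun s => f ((k, σ), s) := by
    ext s
    exact circleFun_of_mem f k σ s.2
  rw [this]
  exact f.continuous.comp (by fun_prop)

theorem pullAngle_apply {r : ℝ} (hr : 0 ≤ r) (f : NodeCircles r →ᵇ ℂ) (k : ℤ) (σ : Bool) (θ : ℝ) :
    pullAngle hr f ((k, σ), θ) = circleFun f k σ (circleMap 0 r θ) :=
  (circleFun_of_mem f k σ (circleMap_mem_sphere 0 hr θ)).symm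

/-- Multiplication by a complex number, as a real linear map. -/
abbrev mulC : ℂ →L[ℝ] ℂ →L[ℝ] ℂ := ContinuousLinearMap.mul ℝ ℂ

/-! ### The operator giving the contribution of the adjacent torus -/

/-- The index of the node at the other side of the neck. -/
def neckIndex (r : ℝ) : C(NodeCircles r, ℤ × Bool) where
  toFun w := (adj w.1.1 w.1.2, !w.1.2)
  continuous_toFun := (continuous_of_discreteTopology
    (f := fun w : ℤ × Bool => (adj w.1 w.2, !w.2))).comp continuous_fst

/-- The contribution of the adjacent torus is an integral operator with explicit kernel. At `t = 0`
the denominator is the coordinate on the circle of radius r₂, of modulus at least r₂, so the kernel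
is smooth near the central value. -/
theorem exists_neckOperator {Q : Set TorusParams} (hQ : IsCompact Q) {ρ r r₂ : ℝ}
    (hgood : ∀ q ∈ Q, GoodParams q ρ) {x₀ : Params} (hx₀ : ∀ k, x₀.pt k ∈ Q) (hr : 0 < r)
    (hrρ : r < ρ) (hr₂ : 0 < r₂) (hr₂ρ : r₂ < ρ) :
    ∃ (𝒦 : ℝ × Params → (NodeCircles r₂ →ᵇ ℂ) →L[ℝ] (NodeCircles r →ᵇ ℂ))
      (N : Set (ℝ × Params)), IsOpen N ∧ (0, x₀) ∈ N ∧ ContDiffOn ℝ ∞ 𝒦 N ∧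
      ∀ p ∈ N, ∀ u k σ s (hs : s ∈ sphere (0 : ℂ) r),
        𝒦 p u ((k, σ), ⟨s, hs⟩) = neckDeriv p.2 p.1 r₂ (circleFun u) k σ s := by
  let W : Set (ℝ × TorusParams × TorusParams × (ℂ × ℂ)) :=
    {w | (w.2.2.2.1, w.2.1) ∈ gaussDomain ∧ (w.2.2.2.2, w.2.2.1) ∈ nodeCoordDomain ∧
      nodeCoord w.2.2.2.2 w.2.2.1 - (w.1 : ℂ) ^ 2 * gaussT w.2.2.2.1 w.2.1 ≠ 0}
  let W' : Set (ℝ × TorusParams × TorusParams × (ℂ × ℂ)) :=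
    {w | (w.2.2.2.1, w.2.1) ∈ gaussDomain} ∩ {w | (w.2.2.2.2, w.2.2.1) ∈ nodeCoordDomain}
  have hW' : IsOpen W' := (isOpen_gaussDomain.preimage (by fun_prop)).inter
    (isOpen_nodeCoordDomain.preimage (by fun_prop))
  have ht : ContDiff ℝ ∞ fun w : ℝ × TorusParams × TorusParams × (ℂ × ℂ) => (w.1 : ℂ) :=
    ofRealCLM.contDiff.comp contDiff_fst
  have hl1 : ContDiff ℝ ∞ fun w : ℝ × TorusParams × TorusParams × (ℂ × ℂ) =>
      (w.2.2.2.1, w.2.1) := by fun_prop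
  have hl2 : ContDiff ℝ ∞ fun w : ℝ × TorusParams × TorusParams × (ℂ × ℂ) =>
      (w.2.2.2.2, w.2.2.1) := by fun_prop
  have hg : ContDiffOn ℝ ∞ (fun w : ℝ × TorusParams × TorusParams × (ℂ × ℂ) =>
      gaussT w.2.2.2.1 w.2.1) W' :=
    (contDiffOn_gaussT.restrict_scalars ℝ).comp hl1.contDiffOn fun w hw => hw.1
  have hg' : ContDiffOn ℝ ∞ (fun w : ℝ × TorusParams × TorusParams × (ℂ × ℂ) =>
      deriv (fun z => gaussT z w.2.1) w.2.2.2.1) W' :=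
    ((contDiffOn_deriv_fst isOpen_gaussDomain contDiffOn_gaussT).restrict_scalars ℝ).comp
      hl1.contDiffOn fun w hw => hw.1
  have hm : ContDiffOn ℝ ∞ (fun w : ℝ × TorusParams × TorusParams × (ℂ × ℂ) =>
      nodeCoord w.2.2.2.2 w.2.2.1) W' :=
    (contDiffOn_nodeCoord.restrict_scalars ℝ).comp hl2.contDiffOn fun w hw => hw.2
  have hden : ContDiffOn ℝ ∞ (fun w : ℝ × TorusParams × TorusParams × (ℂ × ℂ) =>
      nodeCoord w.2.2.2.2 w.2.2.1 - (w.1 : ℂ) ^ 2 * gaussT w.2.2.2.1 w.2.1) W' :=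
    hm.sub ((ht.pow 2).contDiffOn.mul hg)
  have hWeq : W = W' ∩ (fun w : ℝ × TorusParams × TorusParams × (ℂ × ℂ) =>
      nodeCoord w.2.2.2.2 w.2.2.1 - (w.1 : ℂ) ^ 2 * gaussT w.2.2.2.1 w.2.1) ⁻¹' {0}ᶜ := by
    ext w
    simp [W, W', and_assoc]
  have hW : IsOpen W := by
    rw [hWeq]
    exact hden.continuousOn.isOpen_inter_preimage hW' isOpen_compl_singleton
  have hWW' : W ⊆ W' := fun w hw => ⟨hw.1, hw.2.1⟩
  -- The factor s' I is the derivative of the circle parametrization at the source point s'.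
  let F : ℝ × TorusParams × TorusParams × (ℂ × ℂ) → ℂ →L[ℝ] ℂ := fun w =>
    mulC ((2 * Real.pi * I)⁻¹ * (w.2.2.2.2 * I) /
      (nodeCoord w.2.2.2.2 w.2.2.1 - (w.1 : ℂ) ^ 2 * gaussT w.2.2.2.1 w.2.1) *
        ((w.1 : ℂ) ^ 2 * deriv (fun z => gaussT z w.2.1) w.2.2.2.1))
  have hF : ContDiffOn ℝ ∞ F W := by
    refine mulC.contDiff.comp_contDiffOn ?_
    have hnum : ContDiffOn ℝ ∞ (fun w : ℝ × TorusParams × TorusParams × (ℂ × ℂ) =>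
        (2 * Real.pi * I : ℂ)⁻¹ * (w.2.2.2.2 * I)) W := ContDiff.contDiffOn (by fun_prop)
    simp only [div_eq_mul_inv]
    exact (hnum.mul ((hden.mono hWW').inv fun w hw => hw.2.2)).mul
      ((ht.pow 2).contDiffOn.mul (hg'.mono hWW'))
  have hK : IsCompact (({0} : Set ℝ) ×ˢ Q ×ˢ Q ×ˢ (sphere (0 : ℂ) r ×ˢ sphere (0 : ℂ) r₂)) :=
    isCompact_singleton.prod (hQ.prod (hQ.prod ((isCompact_sphere _ _).prod (isCompact_sphere _ _))))
  have hKW : ({0} : Set ℝ) ×ˢ Q ×ˢ Q ×ˢ (sphere (0 : ℂ) r ×ˢ sphere (0 : ℂ) r₂) ⊆ W := by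
    rintro ⟨t, q, q', s, s'⟩ ⟨rfl, hq, hq', hs, hs'⟩
    simp only [mem_sphere_zero_iff_norm] at hs hs'
    have h0 : s ≠ 0 := norm_pos_iff.1 (by rw [hs]; exact hr)
    have hs'ρ : s' ∈ ball (0 : ℂ) ρ := mem_ball_zero_iff.2 (by rw [hs']; exact hr₂ρ)
    refine ⟨(hgood q hq).mem_gaussDomain (by rw [hs]; exact hrρ) h0, (hgood q' hq').mem _ hs'ρ, ?_⟩
    have := (hgood q' hq').le_norm_nodeCoord hs'ρ
    simp only [ofReal_zero, ne_eq, OfNat.ofNat_ne_zero, not_false_eq_true, zero_pow, zero_mul,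
      sub_zero]
    exact norm_pos_iff.1 (by linarith)
  let k₁ : C(NodeCircles r × ℝ, ℤ) := ⟨fun i => i.1.1.1, by fun_prop⟩
  let k₂ : C(NodeCircles r × ℝ, ℤ) := ⟨fun i => (neckIndex r i.1).1, by fun_prop⟩
  obtain ⟨Φ, N, hN, hN0, hΦ, hΦW⟩ := exists_smooth_superposition k₁ k₂
    (fun i => ((i.1.2 : ℂ), circleMap 0 r₂ i.2)) (by fun_prop) hW hF hK hKW x₀ fun i =>
      ⟨rfl, hx₀ _, hx₀ _, i.1.2.2, circleMap_mem_sphere 0 hr₂.le i.2⟩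
  refine ⟨fun p => (integralOp (neckIndex r) (Φ p)).comp (pullAngle hr₂.le), N, hN, hN0, ?_, ?_⟩
  · have h0 : ContDiff ℝ ∞ (integralOp (A := ℂ) (B := ℂ) (neckIndex r)) :=
      ContinuousLinearMap.contDiff _
    have h1 : ContDiffOn ℝ ∞ (fun p => integralOp (neckIndex r) (Φ p)) N := h0.comp_contDiffOn hΦ
    exact h1.clm_comp contDiffOn_const
  · intro p hp u k σ s hs
    rw [neckDeriv, cauchyT, circleIntegral, ← intervalIntegral.integral_const_mul,
      ← intervalIntegral.integral_mul_const, ContinuousLinearMap.comp_apply, integralOp_apply]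
    refine intervalIntegral.integral_congr fun θ _ => ?_
    have h1 := (hΦW p hp (((k, σ), ⟨s, hs⟩), θ)).2
    have h2 : neckIndex r ((k, σ), ⟨s, hs⟩) = (adj k σ, !σ) := rfl
    rw [show k₁ (((k, σ), ⟨s, hs⟩), θ) = k from rfl,
      show k₂ (((k, σ), ⟨s, hs⟩), θ) = adj k σ from rfl] at h1
    rw [h1, h2, pullAngle_apply, deriv_circleMap]
    simp only [F, ContinuousLinearMap.mul_apply', smul_eq_mul]
    ring

/-! ### The operator giving the convolution with the zeta function -/

/-- The real linear map `periodCorrection τ`. -/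
def correctionL (τ : ℂ) : ℂ →L[ℝ] ℂ :=
  -mulC (eta1 τ) + (τ.im)⁻¹ • ((mulC I).comp (ofRealCLM.comp reCLM)).comp
    (mulC (eta2 τ - eta1 τ * τ))

theorem correctionL_apply (τ S : ℂ) : correctionL τ S = periodCorrection τ S := by
  simp [correctionL, periodCorrection, mul_comm S]
  simp [div_eq_mul_inv]
  ring

theorem contDiffOn_eta1 : ContDiffOn ℂ ∞ eta1 {τ | 0 < τ.im} :=
  contDiffOn_const.mul (contDiffOn_wZeta.comp (f := fun τ : ℂ => ((1 / 2 : ℂ), τ)) (by fun_prop)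
    fun _ hτ => ⟨hτ, half_notMem hτ⟩)

theorem contDiffOn_eta2 : ContDiffOn ℂ ∞ eta2 {τ | 0 < τ.im} :=
  contDiffOn_const.mul (contDiffOn_wZeta.comp (f := fun τ : ℂ => (τ / 2, τ)) (by fun_prop)
    fun _ hτ => ⟨hτ, half_tau_notMem hτ⟩)

theorem contDiffOn_correctionL : ContDiffOn ℝ ∞ correctionL {τ | 0 < τ.im} := by
  have h1 := contDiffOn_eta1.restrict_scalars ℝ
  have h2 := contDiffOn_eta2.restrict_scalars ℝ
  have him : ContDiffOn ℝ ∞ (fun τ : ℂ => (τ.im)⁻¹) {τ | 0 < τ.im} :=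
    imCLM.contDiff.contDiffOn.inv fun τ hτ => ne_of_gt hτ
  refine (mulC.contDiff.comp_contDiffOn h1).neg.add (him.smul ?_)
  exact contDiffOn_const.clm_comp
    (mulC.contDiff.comp_contDiffOn (h2.sub (h1.mul contDiffOn_id)))

/-- The points `δ v + s + ψ(w)`, for `y = (δ, s, w)`. -/
def targetPt (q : TorusParams) (y : ℂ × ℂ × ℂ) : ℂ := y.1 * q.v + y.2.1 + psi q.tau y.2.2

theorem contDiff_psi : ContDiff ℝ ∞ fun w : ℂ × ℂ => psi w.1 w.2 := by
  unfold psi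
  exact ((ofRealCLM.comp reCLM).contDiff.comp contDiff_snd).add
    (contDiff_fst.mul ((ofRealCLM.comp imCLM).contDiff.comp contDiff_snd))

theorem contDiff_targetPt : ContDiff ℝ ∞ fun w : TorusParams × (ℂ × ℂ × ℂ) =>
    targetPt w.1 w.2 := by
  unfold targetPt
  refine ContDiff.add (by fun_prop) ?_
  exact contDiff_psi.comp (f := fun w : TorusParams × (ℂ × ℂ × ℂ) => (w.1.tau, w.2.2.2))
    (by fun_prop)

theorem contDiff_nodePt (σ : Bool) : ContDiff ℝ ∞ fun w : TorusParams × ℂ =>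
    nodePt w.1 σ w.2 := by
  cases σ
  · simp only [nodePt_false]
    fun_prop
  · simp only [nodePt_true]
    fun_prop

/-- The variables of the kernel of the convolution operator. -/
abbrev ConvVars : Type := ℝ × TorusParams × TorusParams × ((ℂ × (ℂ × ℂ × ℂ)) × ℂ)

/-- The difference of the target and source points, and the modulus. -/
def convArg (σ : Bool) (w : ConvVars) : ℂ × ℂ :=
  (targetPt w.2.1 w.2.2.2.1.2 - nodePt w.2.1 σ w.2.2.2.2, w.2.1.tau)

/-- The domain of the kernel of the convolution operator. -/
def convDomain (σ : Bool) : Set ConvVars := {w | convArg σ w ∈ zetaDomain}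

/-- The kernel of the convolution operator. -/
def convKernel (σ : Bool) (w : ConvVars) : ℂ →L[ℝ] ℂ :=
  (mulC w.2.2.2.1.1).comp
    ((correctionL w.2.1.tau).comp (mulC ((2 * Real.pi * I)⁻¹ *
      ((w.2.2.2.2 * I) * -(sgn σ * w.2.2.2.2)))) +
    mulC ((2 * Real.pi * I)⁻¹ * ((w.2.2.2.2 * I) * wZeta (convArg σ w).1 (convArg σ w).2)))

theorem contDiff_convArg (σ : Bool) : ContDiff ℝ ∞ (convArg σ) := by
  refine ContDiff.prodMk (ContDiff.sub ?_ ?_) (by fun_prop)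
  · exact contDiff_targetPt.comp (f := fun w : ConvVars => (w.2.1, w.2.2.2.1.2)) (by fun_prop)
  · exact (contDiff_nodePt σ).comp (f := fun w : ConvVars => (w.2.1, w.2.2.2.2)) (by fun_prop)

theorem isOpen_convDomain (σ : Bool) : IsOpen (convDomain σ) :=
  isOpen_zetaDomain.preimage (contDiff_convArg σ).continuous

theorem contDiffOn_convKernel (σ : Bool) : ContDiffOn ℝ ∞ (convKernel σ) (convDomain σ) := by
  have hz : ContDiffOn ℝ ∞ (fun w => wZeta (convArg σ w).1 (convArg σ w).2) (convDomain σ) :=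
    (contDiffOn_wZeta.restrict_scalars ℝ).comp (contDiff_convArg σ).contDiffOn fun w hw => hw
  have hτ : ContDiffOn ℝ ∞ (fun w : ConvVars => w.2.1.tau) (convDomain σ) :=
    ContDiff.contDiffOn (by fun_prop)
  have hc : ContDiffOn ℝ ∞ (fun w : ConvVars => correctionL w.2.1.tau) (convDomain σ) :=
    contDiffOn_correctionL.comp hτ fun w hw => hw.1
  have h1 : ContDiffOn ℝ ∞ (fun w : ConvVars => w.2.2.2.1.1) (convDomain σ) :=
    ContDiff.contDiffOn (by fun_prop)
  have h2 : ContDiffOn ℝ ∞ (fun w : ConvVars => w.2.2.2.2) (convDomain σ) :=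
    ContDiff.contDiffOn (by fun_prop)
  have h3 : ContDiffOn ℝ ∞ (fun w : ConvVars => (2 * Real.pi * I : ℂ)⁻¹ *
      ((w.2.2.2.2 * I) * -(sgn σ * w.2.2.2.2))) (convDomain σ) :=
    contDiffOn_const.mul ((h2.mul contDiffOn_const).mul (contDiffOn_const.mul h2).neg)
  have h4 : ContDiffOn ℝ ∞ (fun w : ConvVars => (2 * Real.pi * I : ℂ)⁻¹ *
      ((w.2.2.2.2 * I) * wZeta (convArg σ w).1 (convArg σ w).2)) (convDomain σ) :=
    contDiffOn_const.mul ((h2.mul contDiffOn_const).mul hz)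
  have h5 := mulC.contDiff.comp_contDiffOn (n := ∞) h1
  have h6 := mulC.contDiff.comp_contDiffOn (n := ∞) h3
  have h7 := mulC.contDiff.comp_contDiffOn (n := ∞) h4
  exact h5.clm_comp ((hc.clm_comp h6).add h7)

/-- One statement serves both uses: target points on the circles around the nodes, with prefactor
±1, and points ψ(w) of the lifted domain, with prefactor 1. The hypothesis on `K₀` keeps the target
points away from the source circles, where ζ(z - p) would be singular. -/
theorem exists_convOperator {X : Type*} [TopologicalSpace X] [FirstCountableTopology X]
    (k : C(X, ℤ)) {y : X → ℂ × (ℂ × ℂ × ℂ)} (hy : Continuous y) {r : ℝ} (hr : 0 < r)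
    {K₀ : Set (TorusParams × ℂ × (ℂ × ℂ × ℂ))} (hK₀ : IsCompact K₀)
    (hK₀' : ∀ w ∈ K₀, 0 < w.1.tau.im ∧ targetPt w.1 w.2.2 ∈ offCircles w.1 r) {x₀ : Params}
    (hx₀ : ∀ i, (x₀.pt (k i), y i) ∈ K₀) :
    ∃ (𝒵 : ℝ × Params → (NodeCircles r →ᵇ ℂ) →L[ℝ] (X →ᵇ ℂ)) (N : Set (ℝ × Params)), IsOpen N ∧
      (0, x₀) ∈ N ∧ ContDiffOn ℝ ∞ 𝒵 N ∧ ∀ p ∈ N, ∀ f i, 𝒵 p f i = (y i).1 *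
        (periodCorrection (p.2.tau (k i))
          (nodePeriod (fun σ s => -(sgn σ * s) * circleFun f (k i) σ s) r) +
        nodeConv (p.2.pt (k i)) (circleFun f (k i)) r (targetPt (p.2.pt (k i)) (y i).2)) := by
  let K : Set ConvVars :=
    (fun w : (TorusParams × ℂ × (ℂ × ℂ × ℂ)) × ℂ => ((0 : ℝ), w.1.1, w.1.1, (w.1.2, w.2))) ''
      (K₀ ×ˢ sphere (0 : ℂ) r)
  have hK : IsCompact K := (hK₀.prod (isCompact_sphere 0 r)).image (by fun_prop)
  have hKW σ : K ⊆ convDomain σ := by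
    rintro _ ⟨⟨⟨q, y⟩, s⟩, ⟨hw, hs⟩, rfl⟩
    exact ⟨(hK₀' _ hw).1, (hK₀' _ hw).2 σ s hs⟩
  let k' : C(X × ℝ, ℤ) := ⟨fun i => k i.1, by fun_prop⟩
  let ν (σ : Bool) : C(X, ℤ × Bool) := ⟨fun i => (k i, σ), by fun_prop⟩
  have hex σ := exists_smooth_superposition k' k'
    (fun i => (y i.1, circleMap 0 r i.2)) (by fun_prop) (isOpen_convDomain σ)
    (contDiffOn_convKernel σ) hK (hKW σ) x₀ fun i =>
      ⟨((x₀.pt (k i.1), y i.1), circleMap 0 r i.2), ⟨hx₀ i.1, circleMap_mem_sphere 0 hr.le i.2⟩, rfl⟩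
  choose Φ N hN hN0 hΦ hΦW using hex
  refine ⟨fun p => ∑ σ, (integralOp (ν σ) (Φ σ p)).comp (pullAngle hr.le), ⋂ σ, N σ,
    isOpen_iInter_of_finite hN, mem_iInter.2 hN0, ?_, ?_⟩
  · refine ContDiffOn.sum fun σ _ => ?_
    have h0 : ContDiff ℝ ∞ (integralOp (A := ℂ) (B := ℂ) (ν σ)) := ContinuousLinearMap.contDiff _
    have h1 : ContDiffOn ℝ ∞ (fun p => integralOp (ν σ) (Φ σ p)) (⋂ σ, N σ) :=
      h0.comp_contDiffOn ((hΦ σ).mono (iInter_subset _ _))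
    exact h1.clm_comp contDiffOn_const
  · intro p hp f i
    rw [mem_iInter] at hp
    have hfc σ : Continuous fun θ => circleFun f (k i) σ (circleMap 0 r θ) :=
      (continuousOn_circleFun f (k i) σ).comp_continuous (continuous_circleMap 0 r)
        (circleMap_mem_sphere 0 hr.le)
    have key σ : integralOp (ν σ) (Φ σ p) (pullAngle hr.le f) i = (y i).1 *
        (correctionL (p.2.tau (k i)) ((2 * Real.pi * I)⁻¹ *
          ∮ s in C(0, r), -(sgn σ * s) * circleFun f (k i) σ s) +
        (2 * Real.pi * I)⁻¹ * ∮ s in C(0, r), wZeta (targetPt (p.2.pt (k i)) (y i).2 -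
          nodePt (p.2.pt (k i)) σ s) (p.2.tau (k i)) * circleFun f (k i) σ s) := by
      have hzc : Continuous fun θ => wZeta (targetPt (p.2.pt (k i)) (y i).2 -
          nodePt (p.2.pt (k i)) σ (circleMap 0 r θ)) (p.2.tau (k i)) := by
        refine continuous_iff_continuousAt.2 fun θ => ?_
        have h1 := (hΦW σ p (hp σ) (i, θ)).1
        have h2 := (hasDerivAt_wZeta h1.1 h1.2).continuousAt
        exact ContinuousAt.comp (f := fun θ => targetPt (p.2.pt (k i)) (y i).2 -
          nodePt (p.2.pt (k i)) σ (circleMap 0 r θ)) h2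
          (continuous_const.sub ((continuous_nodePt _ σ).comp (continuous_circleMap 0 r))).continuousAt
      rw [integralOp_apply, circleIntegral, circleIntegral, ← intervalIntegral.integral_const_mul,
        ← intervalIntegral.integral_const_mul, ← (correctionL _).intervalIntegral_comp_comm,
        ← intervalIntegral.integral_add, ← intervalIntegral.integral_const_mul]
      · refine intervalIntegral.integral_congr fun θ _ => ?_
        have h1 := (hΦW σ p (hp σ) (i, θ)).2
        rw [show k' (i, θ) = k i from rfl] at h1
        rw [h1, show ν σ i = (k i, σ) from rfl, pullAngle_apply, deriv_circleMap]
        change (y i).1 * (correctionL (p.2.tau (k i)) _ + (2 * Real.pi * I)⁻¹ *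
          (circleMap 0 r θ * I * wZeta (targetPt (p.2.pt (k i)) (y i).2 -
            nodePt (p.2.pt (k i)) σ (circleMap 0 r θ)) (p.2.tau (k i))) *
              circleFun f (k i) σ (circleMap 0 r θ)) = _
        simp only [smul_eq_mul]
        congr 2
        · refine congrArg (correctionL (p.2.tau (k i))) ?_
          change (2 * Real.pi * I)⁻¹ * (circleMap 0 r θ * I * -(sgn σ * circleMap 0 r θ)) *
            circleFun f (k i) σ (circleMap 0 r θ) = _
          ring
        · ring
      · refine Continuous.intervalIntegrable ?_ _ _
        simp only [deriv_circleMap, smul_eq_mul]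
        fun_prop
      · refine Continuous.intervalIntegrable ?_ _ _
        simp only [deriv_circleMap, smul_eq_mul]
        fun_prop
      · refine Continuous.intervalIntegrable ?_ _ _
        simp only [deriv_circleMap, smul_eq_mul]
        fun_prop
    rw [← correctionL_apply, nodePeriod, nodeConv, map_sum, ← Finset.sum_add_distrib,
      Finset.mul_sum, _root_.sum_apply, BoundedContinuousFunction.sum_apply]
    exact Finset.sum_congr rfl fun σ _ => key σ

/-! ### Smooth dependence of the source terms -/

theorem nodePeriod_congr {f g : Bool → ℂ → ℂ} {r : ℝ} (hr : 0 ≤ r)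
    (h : ∀ σ, ∀ s ∈ sphere (0 : ℂ) r, f σ s = g σ s) : nodePeriod f r = nodePeriod g r :=
  Finset.sum_congr rfl fun σ _ => congrArg _ (circleIntegral.integral_congr hr (h σ))

theorem nodeConv_congr {q : TorusParams} {f g : Bool → ℂ → ℂ} {r : ℝ} (hr : 0 ≤ r)
    (h : ∀ σ, ∀ s ∈ sphere (0 : ℂ) r, f σ s = g σ s) (z : ℂ) :
    nodeConv q f r z = nodeConv q g r z :=
  Finset.sum_congr rfl fun σ _ => congrArg _ (circleIntegral.integral_congr hr fun s hs => by
    simp only [h σ s hs])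

/-- The real coordinates of v with respect to 1 and τ are not holomorphic in v and τ. For this
reason smoothness in the parameters is real. -/
theorem contDiffOn_wXi : ContDiffOn ℝ ∞ (fun q : TorusParams => wXi q.v q.tau)
    {q | 0 < q.tau.im} := by
  have hre {f : TorusParams → ℂ} (hf : ContDiffOn ℝ ∞ f {q | 0 < q.tau.im}) :
      ContDiffOn ℝ ∞ (fun q => (f q).re) {q | 0 < q.tau.im} := reCLM.contDiff.comp_contDiffOn hf
  have him {f : TorusParams → ℂ} (hf : ContDiffOn ℝ ∞ f {q | 0 < q.tau.im}) :
      ContDiffOn ℝ ∞ (fun q => (f q).im) {q | 0 < q.tau.im} := imCLM.contDiff.comp_contDiffOn hf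
  have hof {f : TorusParams → ℝ} (hf : ContDiffOn ℝ ∞ f {q | 0 < q.tau.im}) :
      ContDiffOn ℝ ∞ (fun q => (f q : ℂ)) {q | 0 < q.tau.im} :=
    ofRealCLM.contDiff.comp_contDiffOn hf
  have hv : ContDiffOn ℝ ∞ (fun q : TorusParams => q.v) {q | 0 < q.tau.im} :=
    ContDiff.contDiffOn (by fun_prop)
  have hτ : ContDiffOn ℝ ∞ (fun q : TorusParams => q.tau) {q | 0 < q.tau.im} :=
    ContDiff.contDiffOn (by fun_prop)
  have h1 : ContDiffOn ℝ ∞ (fun q : TorusParams => eta1 q.tau) {q | 0 < q.tau.im} :=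
    (contDiffOn_eta1.restrict_scalars ℝ).comp hτ fun q hq => hq
  have h2 : ContDiffOn ℝ ∞ (fun q : TorusParams => eta2 q.tau) {q | 0 < q.tau.im} :=
    (contDiffOn_eta2.restrict_scalars ℝ).comp hτ fun q hq => hq
  have hy : ContDiffOn ℝ ∞ (fun q : TorusParams => coordY q.v q.tau) {q | 0 < q.tau.im} := by
    simp only [coordY, div_eq_mul_inv]
    exact (him hv).mul ((him hτ).inv fun q hq => ne_of_gt hq)
  have hx : ContDiffOn ℝ ∞ (fun q : TorusParams => coordX q.v q.tau) {q | 0 < q.tau.im} :=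
    (hre hv).sub (hy.mul (hre hτ))
  exact ((hof hx).mul h1).add ((hof hy).mul h2)

theorem contDiffOn_wZeta_comp {E : Type*} [NormedAddCommGroup E] [NormedSpace ℝ E]
    {f g : E → ℂ} (hf : ContDiff ℝ ∞ f) (hg : ContDiff ℝ ∞ g) {s : Set E}
    (h : ∀ w ∈ s, (f w, g w) ∈ zetaDomain) : ContDiffOn ℝ ∞ (fun w => wZeta (f w) (g w)) s :=
  ContDiffOn.comp (g := fun w : ℂ × ℂ => wZeta w.1 w.2) (t := zetaDomain)
    (f := fun w => (f w, g w)) (contDiffOn_wZeta.restrict_scalars ℝ) (hf.prodMk hg).contDiffOn h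

theorem contDiffOn_wZetaReg_comp {E : Type*} [NormedAddCommGroup E] [NormedSpace ℝ E]
    {f g : E → ℂ} (hf : ContDiff ℝ ∞ f) (hg : ContDiff ℝ ∞ g) {s : Set E}
    (h : ∀ w ∈ s, (f w, g w) ∈ zetaRegDomain) :
    ContDiffOn ℝ ∞ (fun w => wZetaReg (f w) (g w)) s :=
  ContDiffOn.comp (g := fun w : ℂ × ℂ => wZetaReg w.1 w.2) (t := zetaRegDomain)
    (f := fun w => (f w, g w)) (contDiffOn_wZetaReg.restrict_scalars ℝ) (hf.prodMk hg).contDiffOn h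

theorem contDiffOn_wXi_comp {E : Type*} [NormedAddCommGroup E] [NormedSpace ℝ E]
    {f : E → TorusParams} (hf : ContDiff ℝ ∞ f) {s : Set E}
    (h : ∀ w ∈ s, 0 < (f w).tau.im) : ContDiffOn ℝ ∞ (fun w => wXi (f w).v (f w).tau) s :=
  ContDiffOn.comp (g := fun q : TorusParams => wXi q.v q.tau) (t := {q : TorusParams | 0 < q.tau.im})
    (f := f) contDiffOn_wXi hf.contDiffOn fun w hw => h w hw

theorem contDiffOn_logDeriv_gaussH : ContDiffOn ℝ ∞ (fun w : ℂ × TorusParams =>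
    deriv (fun s => gaussH s w.2) w.1 / gaussH w.1 w.2) nodeCoordDomain := by
  have h4 : ContDiffOn ℝ ∞ (fun w : ℂ × TorusParams => gaussH w.1 w.2) nodeCoordDomain :=
    (contDiffOn_gaussH.restrict_scalars ℝ).mono fun w hw => hw.1
  have h5 : ContDiffOn ℝ ∞ (fun w : ℂ × TorusParams => deriv (fun s => gaussH s w.2) w.1)
      nodeCoordDomain :=
    ((contDiffOn_deriv_fst isOpen_gaussHDomain contDiffOn_gaussH).restrict_scalars ℝ).mono
      fun w hw => hw.1
  simp only [div_eq_mul_inv]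
  exact h5.mul (h4.inv fun w hw => hw.2)

theorem contDiffOn_regT : ContDiffOn ℝ ∞ (fun w : ℂ × TorusParams => regT w.1 w.2)
    nodeCoordDomain :=
  (((contDiffOn_wZetaReg_comp contDiff_fst (by fun_prop) fun w hw => hw.1.1).sub
    (contDiffOn_wZeta_comp (by fun_prop) (by fun_prop) fun w hw => hw.1.2)).sub
    (contDiffOn_wXi_comp contDiff_snd fun w hw => hw.1.1.1)).add contDiffOn_logDeriv_gaussH

theorem contDiffOn_omegaT : ContDiffOn ℝ ∞ (fun w : ℂ × TorusParams => omegaT w.1 w.2)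
    gaussDomain :=
  ((contDiffOn_wZeta_comp contDiff_fst (by fun_prop) fun w hw => hw.1).sub
    (contDiffOn_wZeta_comp (by fun_prop) (by fun_prop) fun w hw => hw.2)).sub
    (contDiffOn_wXi_comp contDiff_snd fun w hw => hw.1.1)

/-! ### Smooth families of solutions of the neck equation -/

/-- The node `nodePt q σ s` as a target point. -/
def nodeTarget (w : Bool × ℂ) : ℂ × (ℂ × ℂ × ℂ) :=
  (sgn w.1, (if w.1 then 1 else 0, sgn w.1 * w.2, 0))

theorem continuous_nodeTarget : Continuous nodeTarget := by
  have h1 : Continuous sgn := continuous_of_discreteTopology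
  have h2 : Continuous fun b : Bool => if b then (1 : ℂ) else 0 := continuous_of_discreteTopology
  exact (h1.comp continuous_fst).prodMk ((h2.comp continuous_fst).prodMk
    (((h1.comp continuous_fst).mul continuous_snd).prodMk continuous_const))

theorem targetPt_nodeTarget (q : TorusParams) (σ : Bool) (s : ℂ) :
    targetPt q (nodeTarget (σ, s)).2 = nodePt q σ s := by
  cases σ <;> simp [targetPt, nodeTarget, nodePt, psi, ctr]

/-- The variables of a function of the parameters and of a sign and a local parameter. -/
abbrev SourceVars : Type := ℝ × TorusParams × TorusParams × (ℂ × ℂ)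

theorem contDiffOn_regT_source : ContDiffOn ℝ ∞ (fun w : SourceVars =>
    w.2.2.2.1 * regT w.2.2.2.2 w.2.1) {w | (w.2.2.2.2, w.2.1) ∈ nodeCoordDomain} := by
  have hl : ContDiff ℝ ∞ fun w : SourceVars => (w.2.2.2.2, w.2.1) := by fun_prop
  have he : ContDiff ℝ ∞ fun w : SourceVars => w.2.2.2.1 := by fun_prop
  exact he.contDiffOn.mul (ContDiffOn.comp (g := fun w : ℂ × TorusParams => regT w.1 w.2)
    (f := fun w : SourceVars => (w.2.2.2.2, w.2.1)) contDiffOn_regT hl.contDiffOn fun w hw => hw)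

theorem exists_regT_source {Q : Set TorusParams} (hQ : IsCompact Q) {ρ r₂ : ℝ}
    (hgood : ∀ q ∈ Q, GoodParams q ρ) {x₀ : Params} (hx₀ : ∀ k, x₀.pt k ∈ Q) (hr₂ : r₂ < ρ) :
    ∃ (b : ℝ × Params → (NodeCircles r₂ →ᵇ ℂ)) (N : Set (ℝ × Params)), IsOpen N ∧ (0, x₀) ∈ N ∧
      ContDiffOn ℝ ∞ b N ∧ ∀ p ∈ N, ∀ i : NodeCircles r₂,
        b p i = sgn i.1.2 * regT i.2 (p.2.pt i.1.1) := by
  let k : C(NodeCircles r₂, ℤ) := ⟨fun i => i.1.1, by fun_prop⟩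
  have hKs : IsCompact (({0} : Set ℝ) ×ˢ Q ×ˢ Q ×ˢ
      (closedBall (0 : ℂ) 1 ×ˢ sphere (0 : ℂ) r₂)) :=
    isCompact_singleton.prod (hQ.prod (hQ.prod
      ((isCompact_closedBall _ _).prod (isCompact_sphere _ _))))
  have hsc : Continuous fun i : NodeCircles r₂ => (sgn i.1.2, (i.2 : ℂ)) :=
    ((continuous_of_discreteTopology (f := sgn)).comp
      (continuous_snd.comp continuous_fst)).prodMk (continuous_subtype_val.comp continuous_snd)
  have hW : IsOpen {w : SourceVars | (w.2.2.2.2, w.2.1) ∈ nodeCoordDomain} :=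
    isOpen_nodeCoordDomain.preimage (by fun_prop)
  obtain ⟨b, N, hN, hN0, hb, hbf⟩ := exists_smooth_superposition k k
    (fun i => (sgn i.1.2, (i.2 : ℂ))) hsc hW contDiffOn_regT_source hKs (by
      rintro ⟨t, q, q', e, s⟩ ⟨-, hq, -, -, hs⟩
      exact (hgood q hq).mem s (mem_ball_zero_iff.2 (by
        rw [mem_sphere_zero_iff_norm.1 hs]; exact hr₂))) x₀
    fun i => ⟨rfl, hx₀ _, hx₀ _, mem_closedBall_zero_iff.2 (by cases i.1.2 <;> simp [sgn]), i.2.2⟩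
  exact ⟨b, N, hN, hN0, hb, fun p hp i => (hbf p hp i).2⟩

theorem exists_neckConv {Q : Set TorusParams} (hQ : IsCompact Q) {ρ r₂ r₃ : ℝ}
    (hgood : ∀ q ∈ Q, GoodParams q ρ) {x₀ : Params} (hx₀ : ∀ k, x₀.pt k ∈ Q) (hr₂ : 0 < r₂)
    (hr₂₃ : r₂ < r₃) (hr₃ : r₃ < ρ) :
    ∃ (𝒵 : ℝ × Params → (NodeCircles r₃ →ᵇ ℂ) →L[ℝ] (NodeCircles r₂ →ᵇ ℂ))
      (N : Set (ℝ × Params)), IsOpen N ∧ (0, x₀) ∈ N ∧ ContDiffOn ℝ ∞ 𝒵 N ∧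
      ∀ p ∈ N, ∀ f, ∀ i : NodeCircles r₂, 𝒵 p f i = sgn i.1.2 *
        (periodCorrection (p.2.tau i.1.1)
          (nodePeriod (fun σ s => -(sgn σ * s) * circleFun f i.1.1 σ s) r₃) +
        nodeConv (p.2.pt i.1.1) (circleFun f i.1.1) r₃ (nodePt (p.2.pt i.1.1) i.1.2 i.2)) := by
  let k : C(NodeCircles r₂, ℤ) := ⟨fun i => i.1.1, by fun_prop⟩
  have hy : Continuous fun i : NodeCircles r₂ => nodeTarget (i.1.2, i.2) :=
    continuous_nodeTarget.comp (by fun_prop)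
  have hK₀ : IsCompact (Q ×ˢ (nodeTarget '' (univ ×ˢ sphere (0 : ℂ) r₂))) :=
    hQ.prod ((isCompact_univ.prod (isCompact_sphere 0 r₂)).image continuous_nodeTarget)
  obtain ⟨𝒵, N, hN, hN0, h𝒵, h𝒵f⟩ := exists_convOperator k hy (hr₂.trans hr₂₃) hK₀ (by
    rintro ⟨q, -⟩ ⟨hq, ⟨σ, s⟩, ⟨-, hs⟩, rfl⟩
    rw [mem_sphere_zero_iff_norm] at hs
    refine ⟨(hgood q hq).im_pos, ?_⟩
    simp only
    rw [targetPt_nodeTarget]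
    exact nodePt_mem_offCircles (hgood q hq) hr₃ (by linarith) (by linarith)) (x₀ := x₀)
    fun i => ⟨hx₀ _, mem_image_of_mem _ ⟨mem_univ _, i.2.2⟩⟩
  refine ⟨𝒵, N, hN, hN0, h𝒵, fun p hp f i => ?_⟩
  rw [h𝒵f p hp, targetPt_nodeTarget]
  rfl

/-- The neck equation is linear: u = b + A u, where A composes the neck operator with the
convolution. The factor t² gives A = 0 at the central value, so 1 - A is invertible nearby;
inversion is a smooth map on the invertible operators. -/
theorem exists_neckSolutions {Q : Set TorusParams} (hQ : IsCompact Q) {ρ r₂ r₃ : ℝ}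
    (hgood : ∀ q ∈ Q, GoodParams q ρ) {x₀ : Params} (hx₀ : ∀ k, x₀.pt k ∈ Q) (hr₂ : 0 < r₂)
    (hr₂₃ : r₂ < r₃) (hr₃ : r₃ < ρ) :
    ∃ (u : ℝ × Params → (NodeCircles r₂ →ᵇ ℂ)) (N : Set (ℝ × Params)), IsOpen N ∧ (0, x₀) ∈ N ∧
      ContDiffOn ℝ ∞ u N ∧ ∀ p ∈ N, ∀ k σ, ∀ s ∈ sphere (0 : ℂ) r₂, circleFun (u p) k σ s =
        regPart (p.2.pt k) r₃ (neckDeriv p.2 p.1 r₂ (circleFun (u p)) k) σ s := by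
  obtain ⟨𝒦, N₁, hN₁, hN₁0, h𝒦, h𝒦f⟩ := exists_neckOperator hQ hgood hx₀ (hr₂.trans hr₂₃) hr₃ hr₂
    (hr₂₃.trans hr₃)
  obtain ⟨𝒵, N₂, hN₂, hN₂0, h𝒵, h𝒵f⟩ := exists_neckConv hQ hgood hx₀ hr₂ hr₂₃ hr₃
  obtain ⟨b, N₃, hN₃, hN₃0, hb, hbf⟩ := exists_regT_source hQ hgood hx₀ (hr₂₃.trans hr₃)
  let A : ℝ × Params → (NodeCircles r₂ →ᵇ ℂ) →L[ℝ] (NodeCircles r₂ →ᵇ ℂ) :=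
    fun p => (𝒵 p).comp (𝒦 p)
  have hN₁₂ : IsOpen (N₁ ∩ N₂) := hN₁.inter hN₂
  have hA : ContDiffOn ℝ ∞ A (N₁ ∩ N₂) :=
    (h𝒵.mono inter_subset_right).clm_comp (h𝒦.mono inter_subset_left)
  have hA0 : A (0, x₀) = 0 := by
    have h0 : 𝒦 (0, x₀) = 0 := by
      ext u ⟨⟨k, σ⟩, s, hs⟩
      rw [h𝒦f _ hN₁0]
      simp [neckDeriv]
    simp only [A, h0, ContinuousLinearMap.comp_zero]
  let N := ((N₁ ∩ N₂) ∩ A ⁻¹' ball 0 1) ∩ N₃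
  have hN : IsOpen N := (hA.continuousOn.isOpen_inter_preimage hN₁₂ isOpen_ball).inter hN₃
  have hunit : ∀ p ∈ N, IsUnit (1 - A p) := fun p hp =>
    isUnit_one_sub_of_norm_lt_one (R := (NodeCircles r₂ →ᵇ ℂ) →L[ℝ] (NodeCircles r₂ →ᵇ ℂ))
      (mem_ball_zero_iff.1 hp.1.2)
  refine ⟨fun p => Ring.inverse (1 - A p) (b p), N, hN,
    ⟨⟨⟨hN₁0, hN₂0⟩, by simp [hA0]⟩, hN₃0⟩, ?_, ?_⟩
  · refine ContDiffOn.clm_apply (fun p hp => ?_) (hb.mono inter_subset_right)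
    obtain ⟨v, hv⟩ := hunit p hp
    have h1 : ContDiffAt ℝ ∞ Ring.inverse (1 - A p) := hv ▸ contDiffAt_ringInverse ℝ
      (R := (NodeCircles r₂ →ᵇ ℂ) →L[ℝ] (NodeCircles r₂ →ᵇ ℂ)) v
    have h2 : ContDiffAt ℝ ∞ (fun p => 1 - A p) p :=
      contDiffAt_const.sub (hA.contDiffAt (hN₁₂.mem_nhds hp.1.1))
    exact (ContDiffAt.comp p h1 h2).contDiffWithinAt
  · intro p hp k σ s hs
    set u := Ring.inverse (1 - A p) (b p) with hu
    have hr₃0 := (hr₂.trans hr₂₃).le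
    have h1 : u - 𝒵 p (𝒦 p u) = b p := by
      have := Ring.mul_inverse_cancel _ (hunit p hp)
      exact congrArg (fun L => L (b p)) this
    have h2 := congrArg (fun f => f ((k, σ), ⟨s, hs⟩)) h1
    simp only [BoundedContinuousFunction.coe_sub, Pi.sub_apply] at h2
    rw [hbf p hp.2, h𝒵f p hp.1.1.2] at h2
    simp only at h2
    have h3 : ∀ σ', ∀ y ∈ sphere (0 : ℂ) r₃, circleFun (𝒦 p u) k σ' y =
        neckDeriv p.2 p.1 r₂ (circleFun u) k σ' y := fun σ' y hy => by
      rw [circleFun_of_mem _ _ _ hy, h𝒦f p hp.1.1.1]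
    rw [nodeConv_congr hr₃0 h3, nodePeriod_congr hr₃0 (g := fun σ' y =>
      -(sgn σ' * y) * neckDeriv p.2 p.1 r₂ (circleFun u) k σ' y) fun σ' y hy => by
        simp only [h3 σ' y hy]] at h2
    change circleFun u k σ s = regPart _ _ (neckDeriv p.2 p.1 r₂ (circleFun u) k) σ s
    rw [circleFun_of_mem _ _ _ hs, regPart, sub_eq_iff_eq_add.1 h2,
      show (p.2.pt k).tau = p.2.tau k from rfl]
    ring

/-! ### Smooth dependence of the 1-form on the lift of the fixed domain -/

/-- The real linear map `psi τ`. -/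
def psiL (τ : ℂ) : ℂ →L[ℝ] ℂ := ofRealCLM.comp reCLM + (mulC τ).comp (ofRealCLM.comp imCLM)

theorem contDiff_psiL : ContDiff ℝ ∞ psiL :=
  contDiff_const.add (mulC.contDiff.clm_comp contDiff_const)

/-- The points of the plane which project to the fixed domain. -/
abbrev LiftedDomain (x₀ : Params) (ε' : ℝ) : Type :=
  {w : ℤ × ℂ // ‖w.2‖ < 2 ∧ toTorus I w.2 ∈ fixedDomain x₀ ε' w.1}

/-- The variables of a function of the parameters and of a point of the plane. -/
abbrev PointVars : Type := ℝ × TorusParams × TorusParams × ℂ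

/-- The image of the point by `psi`, and the parameters. -/
def psiArg (w : PointVars) : ℂ × TorusParams := (psi w.2.1.tau w.2.2.2, w.2.1)

theorem contDiff_psiArg : ContDiff ℝ ∞ psiArg := by
  refine ContDiff.prodMk ?_ (by fun_prop)
  exact contDiff_psi.comp (f := fun w : PointVars => (w.2.1.tau, w.2.2.2)) (by fun_prop)

theorem contDiffOn_omegaT_psiArg : ContDiffOn ℝ ∞ (fun w : PointVars =>
    omegaT (psiArg w).1 (psiArg w).2) (psiArg ⁻¹' gaussDomain) :=
  ContDiffOn.comp (g := fun w : ℂ × TorusParams => omegaT w.1 w.2) (f := psiArg)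
    contDiffOn_omegaT contDiff_psiArg.contDiffOn fun _ hw => hw

/-- The real linear map which maps `e` to the form `X ↦ e psi τ X`. -/
def scalePsi (w : PointVars) : ℂ →L[ℝ] ℂ →L[ℝ] ℂ :=
  ((ContinuousLinearMap.compL ℝ ℂ ℂ ℂ).flip (psiL w.2.1.tau)).comp mulC

theorem contDiff_scalePsi : ContDiff ℝ ∞ scalePsi := by
  have h1 : ContDiff ℝ ∞ fun w : PointVars => psiL w.2.1.tau :=
    contDiff_psiL.comp (f := fun w : PointVars => w.2.1.tau) (by fun_prop)
  have h2 : ContDiff ℝ ∞ fun w : PointVars =>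
      (ContinuousLinearMap.compL ℝ ℂ ℂ ℂ).flip (psiL w.2.1.tau) :=
    ((ContinuousLinearMap.compL ℝ ℂ ℂ ℂ).flip.contDiff).comp h1
  exact h2.clm_comp contDiff_const

theorem exists_liftedConv {r₁ : ℝ} (hr₁ : 0 < r₁) {x₀ : Params} {ε' : ℝ}
    {L : Set (TorusParams × ℂ)}
    (hL : IsCompact L) (hLouter : ∀ w ∈ L, 0 < w.1.tau.im ∧ psi w.1.tau w.2 ∈ outer w.1 r₁)
    (hxL : ∀ i : LiftedDomain x₀ ε', (x₀.pt i.1.1, i.1.2) ∈ L) :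
    ∃ (𝒵 : ℝ × Params → (NodeCircles r₁ →ᵇ ℂ) →L[ℝ] (LiftedDomain x₀ ε' →ᵇ ℂ))
      (N : Set (ℝ × Params)), IsOpen N ∧ (0, x₀) ∈ N ∧ ContDiffOn ℝ ∞ 𝒵 N ∧
      ∀ p ∈ N, ∀ f, ∀ i : LiftedDomain x₀ ε', 𝒵 p f i =
        periodCorrection (p.2.tau i.1.1)
          (nodePeriod (fun σ s => -(sgn σ * s) * circleFun f i.1.1 σ s) r₁) +
        nodeConv (p.2.pt i.1.1) (circleFun f i.1.1) r₁ (psi (p.2.tau i.1.1) i.1.2) := by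
  let k : C(LiftedDomain x₀ ε', ℤ) := ⟨fun i => i.1.1, by fun_prop⟩
  have hpsi0 q w : targetPt q (0, 0, w) = psi q.tau w := by simp [targetPt]
  have hy : Continuous fun i : LiftedDomain x₀ ε' => ((1 : ℂ), ((0 : ℂ), (0 : ℂ), i.1.2)) := by
    fun_prop
  have hK₀ : IsCompact
      ((fun w : TorusParams × ℂ => (w.1, ((1 : ℂ), ((0 : ℂ), (0 : ℂ), w.2)))) '' L) :=
    hL.image (by fun_prop)
  obtain ⟨𝒵, N, hN, hN0, h𝒵, h𝒵f⟩ := exists_convOperator k hy hr₁ hK₀ (by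
    rintro _ ⟨⟨q, w⟩, hw, rfl⟩
    refine ⟨(hLouter _ hw).1, ?_⟩
    simp only
    rw [hpsi0]
    exact outer_subset _ _ (hLouter _ hw).2) (x₀ := x₀) fun i => ⟨_, hxL i, rfl⟩
  refine ⟨𝒵, N, hN, hN0, h𝒵, fun p hp f i => ?_⟩
  rw [h𝒵f p hp, one_mul, hpsi0]
  rfl

theorem exists_omegaT_source {r₁ : ℝ} (hr₁ : 0 < r₁) {x₀ : Params} {ε' : ℝ}
    {L : Set (TorusParams × ℂ)}
    (hL : IsCompact L) (hLouter : ∀ w ∈ L, 0 < w.1.tau.im ∧ psi w.1.tau w.2 ∈ outer w.1 r₁)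
    (hxL : ∀ i : LiftedDomain x₀ ε', (x₀.pt i.1.1, i.1.2) ∈ L) :
    ∃ (b : ℝ × Params → (LiftedDomain x₀ ε' →ᵇ ℂ)) (N : Set (ℝ × Params)), IsOpen N ∧
      (0, x₀) ∈ N ∧ ContDiffOn ℝ ∞ b N ∧ ∀ p ∈ N, ∀ i : LiftedDomain x₀ ε',
        b p i = omegaT (psi (p.2.tau i.1.1) i.1.2) (p.2.pt i.1.1) := by
  let k : C(LiftedDomain x₀ ε', ℤ) := ⟨fun i => i.1.1, by fun_prop⟩
  have hK : IsCompact ((fun w : TorusParams × ℂ => ((0 : ℝ), w.1, w.1, w.2)) '' L) :=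
    hL.image (by fun_prop)
  have hy : Continuous fun i : LiftedDomain x₀ ε' => i.1.2 := by fun_prop
  have hW : IsOpen (psiArg ⁻¹' gaussDomain) := isOpen_gaussDomain.preimage contDiff_psiArg.continuous
  obtain ⟨b, N, hN, hN0, hb, hbf⟩ := exists_smooth_superposition k k
    (fun i : LiftedDomain x₀ ε' => i.1.2) hy hW contDiffOn_omegaT_psiArg hK (by
      rintro _ ⟨⟨q, w⟩, hw, rfl⟩
      have h1 := hLouter _ hw
      have h2 := notMem_of_mem_outer hr₁.le h1.2
      exact ⟨⟨h1.1, h2.1⟩, h1.1, h2.2⟩) x₀ fun i => ⟨_, hxL i, rfl⟩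
  exact ⟨b, N, hN, hN0, hb, fun p hp i => (hbf p hp i).2⟩

set_option maxSynthPendingDepth 5 in
theorem exists_scalePsi {x₀ : Params} {ε' : ℝ} {L : Set (TorusParams × ℂ)} (hL : IsCompact L)
    (hxL : ∀ i : LiftedDomain x₀ ε', (x₀.pt i.1.1, i.1.2) ∈ L) :
    ∃ (P : ℝ × Params → (LiftedDomain x₀ ε' →ᵇ (ℂ →L[ℝ] ℂ →L[ℝ] ℂ))) (N : Set (ℝ × Params)),
      IsOpen N ∧ (0, x₀) ∈ N ∧ ContDiffOn ℝ ∞ P N ∧ ∀ p ∈ N, ∀ i : LiftedDomain x₀ ε', ∀ e X,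
        P p i e X = e * psi (p.2.tau i.1.1) X := by
  let k : C(LiftedDomain x₀ ε', ℤ) := ⟨fun i => i.1.1, by fun_prop⟩
  have hK : IsCompact ((fun w : TorusParams × ℂ => ((0 : ℝ), w.1, w.1, w.2)) '' L) :=
    hL.image (by fun_prop)
  have hy : Continuous fun i : LiftedDomain x₀ ε' => i.1.2 := by fun_prop
  obtain ⟨P, N, hN, hN0, hP, hPf⟩ := exists_smooth_superposition k k
    (fun i : LiftedDomain x₀ ε' => i.1.2) hy isOpen_univ contDiff_scalePsi.contDiffOn hK
    (subset_univ _) x₀ fun i => ⟨_, hxL i, rfl⟩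
  exact ⟨P, N, hN, hN0, hP, fun p hp i e X => by rw [(hPf p hp i).2]; rfl⟩

-- The formula of `coeffT_outer` is a composite of smooth operators applied to the solution `u p`.
-- The circles of radius r₁ serve here as sources because the lifted points lie outside the
-- corresponding disks.
set_option maxSynthPendingDepth 5 in
theorem exists_liftedForm {Q : Set TorusParams} (hQ : IsCompact Q) {ρ r₁ r₂ : ℝ}
    (hgood : ∀ q ∈ Q, GoodParams q ρ) {x₀ : Params} (hx₀ : ∀ k, x₀.pt k ∈ Q) (hr₁ : 0 < r₁)
    (hr₁ρ : r₁ < ρ) (hr₂ : 0 < r₂) (hr₂ρ : r₂ < ρ)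
    {u : ℝ × Params → (NodeCircles r₂ →ᵇ ℂ)} {N : Set (ℝ × Params)} (hN : IsOpen N)
    (hN0 : (0, x₀) ∈ N) (hu : ContDiffOn ℝ ∞ u N) {ε' : ℝ} {L : Set (TorusParams × ℂ)}
    (hL : IsCompact L) (hLouter : ∀ w ∈ L, 0 < w.1.tau.im ∧ psi w.1.tau w.2 ∈ outer w.1 r₁)
    (hxL : ∀ i : LiftedDomain x₀ ε', (x₀.pt i.1.1, i.1.2) ∈ L) :
    ∃ (η : ℝ × Params → (LiftedDomain x₀ ε' →ᵇ (ℂ →L[ℝ] ℂ))) (N' : Set (ℝ × Params)),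
      IsOpen N' ∧ (0, x₀) ∈ N' ∧ N' ⊆ N ∧ ContDiffOn ℝ ∞ η N' ∧
      ∀ p ∈ N', ∀ i : LiftedDomain x₀ ε', ∀ X, η p i X =
        (omegaT (psi (p.2.tau i.1.1) i.1.2) (p.2.pt i.1.1) + periodCorrection (p.2.tau i.1.1)
          (nodePeriod (fun σ s => -(sgn σ * s) *
            neckDeriv p.2 p.1 r₂ (circleFun (u p)) i.1.1 σ s) r₁) +
          nodeConv (p.2.pt i.1.1) (neckDeriv p.2 p.1 r₂ (circleFun (u p)) i.1.1) r₁
            (psi (p.2.tau i.1.1) i.1.2)) * psi (p.2.tau i.1.1) X := by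
  obtain ⟨𝒦, N₁, hN₁, hN₁0, h𝒦, h𝒦f⟩ := exists_neckOperator hQ hgood hx₀ hr₁ hr₁ρ hr₂ hr₂ρ
  obtain ⟨𝒵, N₂, hN₂, hN₂0, h𝒵, h𝒵f⟩ := exists_liftedConv hr₁ hL hLouter hxL
  obtain ⟨b, N₃, hN₃, hN₃0, hb, hbf⟩ := exists_omegaT_source hr₁ hL hLouter hxL
  obtain ⟨P, N₄, hN₄, hN₄0, hP, hPf⟩ := exists_scalePsi hL hxL
  let E : ℝ × Params → (LiftedDomain x₀ ε' →ᵇ ℂ) := fun p => b p + 𝒵 p (𝒦 p (u p))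
  let N' := ((N ∩ N₁) ∩ (N₂ ∩ N₃)) ∩ N₄
  have hE : ContDiffOn ℝ ∞ E N' :=
    (hb.mono fun p hp => hp.1.2.2).add ((h𝒵.mono fun p hp => hp.1.2.1).clm_apply
      ((h𝒦.mono fun p hp => hp.1.1.2).clm_apply (hu.mono fun p hp => hp.1.1.1)))
  have h0 : ContDiff ℝ ∞ (mulOp (𝕜 := ℝ) (I := LiftedDomain x₀ ε') (E := ℂ) (G := ℂ →L[ℝ] ℂ)) :=
    ContinuousLinearMap.contDiff _
  have hM : ContDiffOn ℝ ∞ (fun p => mulOp (P p)) N' :=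
    h0.comp_contDiffOn (hP.mono fun p hp => hp.2)
  refine ⟨fun p => mulOp (P p) (E p), N',
    ((hN.inter hN₁).inter (hN₂.inter hN₃)).inter hN₄, ⟨⟨⟨hN0, hN₁0⟩, hN₂0, hN₃0⟩, hN₄0⟩,
    fun p hp => hp.1.1.1, hM.clm_apply hE, ?_⟩
  intro p hp i X
  have h3 : ∀ σ', ∀ y ∈ sphere (0 : ℂ) r₁, circleFun (𝒦 p (u p)) i.1.1 σ' y =
      neckDeriv p.2 p.1 r₂ (circleFun (u p)) i.1.1 σ' y := fun σ' y hy => by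
    rw [circleFun_of_mem _ _ _ hy, h𝒦f p hp.1.1.2]
  have h5 : E p i = b p i + 𝒵 p (𝒦 p (u p)) i := rfl
  rw [hbf p hp.1.2.2 i, h𝒵f p hp.1.2.1, nodeConv_congr hr₁.le h3, nodePeriod_congr hr₁.le
    (g := fun σ' y => -(sgn σ' * y) * neckDeriv p.2 p.1 r₂ (circleFun (u p)) i.1.1 σ' y)
    fun σ' y hy => by simp only [h3 σ' y hy], ← add_assoc] at h5
  rw [mulOp_apply, hPf p hp.2, h5]

/-! ### Descent from the lifted domain to the fixed domain -/

theorem exists_lift (z : ℂ) : ∃ z' : ℂ, ‖z'‖ < 2 ∧ toTorus I z' = toTorus I z := by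
  refine ⟨Int.fract z.re + Int.fract z.im * I, ?_, GoodParams.toTorus_eq_iff.2
    (mem_latticeOf.2 ⟨-⌊z.re⌋, -⌊z.im⌋, ?_⟩)⟩
  · refine (norm_add_le _ _).trans_lt ?_
    rw [norm_mul, norm_I, mul_one, norm_real, norm_real, Real.norm_eq_abs, Real.norm_eq_abs,
      abs_of_nonneg (Int.fract_nonneg _), abs_of_nonneg (Int.fract_nonneg _)]
    linarith [Int.fract_lt_one z.re, Int.fract_lt_one z.im]
  · apply Complex.ext <;> simp

section Descent

variable {x₀ : Params} {ε' : ℝ}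

/-- The projection from the lifted domain to the fixed domain. -/
def liftProj (i : LiftedDomain x₀ ε') : FixedDomain x₀ ε' := ⟨i.1.1, ⟨toTorus I i.1.2, i.2.2⟩⟩

theorem liftProj_surjective : Function.Surjective (liftProj (x₀ := x₀) (ε' := ε')) := by
  rintro ⟨k, ⟨y, hy⟩⟩
  obtain ⟨z, rfl⟩ := QuotientAddGroup.mk_surjective y
  obtain ⟨z', hz', h⟩ := exists_lift z
  have hy' : toTorus I z' ∈ fixedDomain x₀ ε' k := by rw [h]; exact hy
  refine ⟨⟨(k, z'), hz', hy'⟩, ?_⟩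
  exact congrArg (Sigma.mk k) (Subtype.ext h)

theorem continuous_liftProj : Continuous (liftProj (x₀ := x₀) (ε' := ε')) := by
  refine continuous_iff_continuousAt.2 fun i => ?_
  rw [ContinuousAt, tendsto_def]
  intro s hs
  obtain ⟨⟨k, z⟩, hz2, hz⟩ := i
  rw [liftProj, Sigma.nhds_mk, mem_map, nhds_subtype_eq_comap, mem_comap] at hs
  obtain ⟨V, hV, hVs⟩ := hs
  have h1 : ∀ᶠ j : LiftedDomain x₀ ε' in 𝓝 ⟨(k, z), hz2, hz⟩, toTorus I j.1.2 ∈ V :=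
    ((continuous_quotient_mk'.comp
      (continuous_snd.comp continuous_subtype_val)).continuousAt).eventually_mem hV
  have h2 : ∀ᶠ j : LiftedDomain x₀ ε' in 𝓝 ⟨(k, z), hz2, hz⟩, j.1.1 ∈ ({k} : Set ℤ) :=
    (continuous_fst.comp continuous_subtype_val).continuousAt.eventually_mem
      ((isOpen_discrete _).mem_nhds rfl)
  filter_upwards [h1, h2]
  rintro ⟨⟨k', z'⟩, h, h'⟩ hj1 rfl
  exact @hVs ⟨toTorus I z', h'⟩ hj1

theorem isOpenMap_liftProj : IsOpenMap (liftProj (x₀ := x₀) (ε' := ε')) := by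
  refine isOpenMap_iff_nhds_le.2 fun i s hs => ?_
  obtain ⟨⟨k, z⟩, hz2, hz⟩ := i
  rw [mem_map, nhds_subtype_eq_comap, mem_comap] at hs
  obtain ⟨V, hV, hVs⟩ := hs
  have h1 : ∀ᶠ w in 𝓝 z, (k, w) ∈ V ∧ ‖w‖ < 2 :=
    ((Continuous.prodMk_right k).continuousAt.eventually_mem hV).and
      (continuous_norm.continuousAt.eventually_lt continuousAt_const hz2)
  rw [liftProj, Sigma.nhds_mk, mem_map, nhds_subtype_eq_comap, mem_comap]
  refine ⟨toTorus I '' {w | (k, w) ∈ V ∧ ‖w‖ < 2},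
    QuotientAddGroup.isOpenMap_coe.image_mem_nhds h1, ?_⟩
  rintro ⟨_, hy⟩ ⟨w, ⟨hwV, hw2⟩, rfl⟩
  exact @hVs ⟨(k, w), hw2, hy⟩ hwV

/-- The composition with the projection from the lifted domain to the fixed domain. -/
def liftForm : FormSpace x₀ ε' →ₗᵢ[ℝ] (LiftedDomain x₀ ε' →ᵇ (ℂ →L[ℝ] ℂ)) where
  toFun f := f.compContinuous ⟨liftProj, continuous_liftProj⟩
  map_add' _ _ := rfl
  map_smul' _ _ := rfl
  norm_map' f := by
    change ‖f.compContinuous ⟨liftProj, continuous_liftProj⟩‖ = ‖f‖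
    refine le_antisymm ((BoundedContinuousFunction.norm_le (norm_nonneg f)).2 fun i =>
      f.norm_coe_le_norm (liftProj i)) ?_
    refine (BoundedContinuousFunction.norm_le (norm_nonneg
      (f.compContinuous ⟨liftProj, continuous_liftProj⟩))).2 fun y => ?_
    obtain ⟨i, rfl⟩ := liftProj_surjective y
    exact (f.compContinuous ⟨liftProj, continuous_liftProj⟩).norm_coe_le_norm i

theorem exists_liftForm_eq (g : LiftedDomain x₀ ε' →ᵇ (ℂ →L[ℝ] ℂ))
    (h : ∀ i j, liftProj i = liftProj j → g i = g j) : ∃ f, liftForm f = g := by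
  let s := Function.surjInv (liftProj_surjective (x₀ := x₀) (ε' := ε'))
  have hs i : g (s (liftProj i)) = g i := h _ _ (Function.surjInv_eq _ _)
  have hc : Continuous fun y => g (s y) :=
    (isOpenMap_liftProj.isQuotientMap continuous_liftProj liftProj_surjective).continuous_iff.2
      (g.continuous.congr fun i => (hs i).symm)
  refine ⟨BoundedContinuousFunction.ofNormedAddCommGroup (fun y => g (s y)) hc ‖g‖
    fun y => g.norm_coe_le_norm _, ?_⟩
  ext i : 1
  exact hs i

/-- The projection from the lift is an open surjection, so functions constant on its fibres descend
to continuous ones. Composition with it is isometric, so smoothness may be tested on the lift. -/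
theorem exists_contDiffOn_descent {η : ℝ × Params → (LiftedDomain x₀ ε' →ᵇ (ℂ →L[ℝ] ℂ))}
    {N : Set (ℝ × Params)} (hN : IsOpen N) (hη : ContDiffOn ℝ ∞ η N)
    (h : ∀ p ∈ N, ∀ i j, liftProj i = liftProj j → η p i = η p j) :
    ∃ η' : ℝ × Params → FormSpace x₀ ε', ContDiffOn ℝ ∞ η' N ∧
      ∀ p ∈ N, ∀ i, η' p (liftProj i) = η p i := by
  have key p : ∃ f : FormSpace x₀ ε', p ∈ N → liftForm f = η p := by
    by_cases hp : p ∈ N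
    · obtain ⟨f, hf⟩ := exists_liftForm_eq (η p) (h p hp)
      exact ⟨f, fun _ => hf⟩
    · exact ⟨0, fun h => absurd h hp⟩
  choose f hf using key
  refine ⟨f, contDiffOn_infty.2 fun n => ?_, fun p hp i => ?_⟩
  · refine contDiffOn_of_linearIsometry_comp n hN (G' := LiftedDomain x₀ ε' →ᵇ (ℂ →L[ℝ] ℂ))
      (liftForm (x₀ := x₀) (ε' := ε')) ?_
    exact (contDiffOn_infty.1 hη n).congr fun p hp => hf p hp
  · rw [← hf p hp]
    rfl

end Descent

/-! ### Uniform estimates near the central value -/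

/-- This form in terms of distances makes it possible to pass to a closed condition, and hence to a
compact set of lifts. -/
theorem mem_outer_iff {q : TorusParams} {r : ℝ} {z : ℂ} :
    z ∈ outer q r ↔ ∀ σ, ∀ m n : ℤ, r < ‖z - ctr q σ - (m + n * q.tau)‖ := by
  constructor
  · intro h σ m n
    by_contra! hle
    refine h σ (sgn σ * (z - ctr q σ - (m + n * q.tau))) ?_ (mem_latticeOf.2 ⟨m, n, ?_⟩)
    · rw [mem_closedBall_zero_iff, norm_mul]
      cases σ <;> simpa [sgn] using hle
    · rw [nodePt, ← mul_assoc, sgn_mul_self]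
      ring
  · intro h σ p hp hu
    obtain ⟨m, n, hmn⟩ := mem_latticeOf.1 hu
    rw [mem_closedBall_zero_iff] at hp
    have h1 := h σ m n
    rw [← hmn, nodePt, show z - ctr q σ - (z - (ctr q σ + sgn σ * p)) = sgn σ * p by ring,
      norm_mul] at h1
    cases σ <;> simp [sgn] at h1 <;> linarith

theorem continuous_ctr (σ : Bool) : Continuous fun q : TorusParams => ctr q σ := by
  cases σ
  · exact continuous_const
  · exact continuous_fst.comp (continuous_snd.comp continuous_snd)

/-- A compact set of lifts of points outside the disks around the nodes. -/
def liftSet (Q : Set TorusParams) (r : ℝ) : Set (TorusParams × ℂ) :=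
  (Q ×ˢ closedBall 0 2) ∩
    {w | ∀ σ, ∀ m n : ℤ, r ≤ ‖psi w.1.tau w.2 - ctr w.1 σ - (m + n * w.1.tau)‖}

theorem isCompact_liftSet {Q : Set TorusParams} (hQ : IsCompact Q) (r : ℝ) :
    IsCompact (liftSet Q r) := by
  refine (hQ.prod (isCompact_closedBall 0 2)).inter_right ?_
  simp only [ofPred_forall]
  refine isClosed_iInter fun σ => isClosed_iInter fun m => isClosed_iInter fun n =>
    isClosed_le continuous_const (continuous_norm.comp ?_)
  have h1 : Continuous fun w : TorusParams × ℂ => psi w.1.tau w.2 :=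
    contDiff_psi.continuous.comp (f := fun w : TorusParams × ℂ => (w.1.tau, w.2)) (by fun_prop)
  exact (h1.sub ((continuous_ctr σ).comp continuous_fst)).sub (by fun_prop)

theorem mem_outer_of_mem_liftSet {Q : Set TorusParams} {r r' : ℝ} (hr : r < r')
    {w : TorusParams × ℂ} (hw : w ∈ liftSet Q r') : psi w.1.tau w.2 ∈ outer w.1 r :=
  mem_outer_iff.2 fun σ m n => lt_of_lt_of_le hr (hw.2 σ m n)

theorem mem_liftSet {Q : Set TorusParams} {r : ℝ} {q : TorusParams} (hq : q ∈ Q) {z : ℂ}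
    (hz : ‖z‖ ≤ 2) (h : psi q.tau z ∈ outer q r) : (q, z) ∈ liftSet Q r :=
  ⟨⟨hq, mem_closedBall_zero_iff.2 hz⟩, fun σ m n => (mem_outer_iff.1 h σ m n).le⟩

theorem neg_conj_lattice (m n : ℤ) (τ : ℂ) :
    -(starRingEnd ℂ) (-m + n * τ) = m + n * (-(starRingEnd ℂ) τ) := by
  simp [add_comm]

/-- The central parameters of all tori lie in one compact set: a, b and v are bounded, τ_k takes two
values, and separation is a closed condition. The separation passes to odd k because -conj is an
isometry mapping the lattice of τ onto that of -conj τ. -/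
theorem exists_isCompact_central {τ : ℂ} {q : Linf} (hq : UniformlySeparated q τ) :
    ∃ Q : Set TorusParams, IsCompact Q ∧ (∀ k, (central q τ).pt k ∈ Q) ∧
      ∀ p ∈ Q, p.a = -1 / 2 ∧ p.v ∉ latticeOf p.tau ∧ p.tau.im = τ.im ∧ ‖p.tau‖ = ‖τ‖ := by
  obtain ⟨ϱ, hϱ, hsep⟩ := hq
  have hfin : IsCompact ({τ, -(starRingEnd ℂ) τ} : Set ℂ) := (toFinite _).isCompact
  refine ⟨(({-1 / 2} : Set ℂ) ×ˢ closedBall (0 : ℂ) ‖centralB q τ‖ ×ˢ closedBall (0 : ℂ) ‖q‖ ×ˢ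
      ({τ, -(starRingEnd ℂ) τ} : Set ℂ)) ∩
      {p | ∀ m n : ℤ, ϱ ≤ ‖p.2.2.1 - (m + n * p.2.2.2)‖}, ?_, ?_, ?_⟩
  · refine (isCompact_singleton.prod ((isCompact_closedBall _ _).prod
      ((isCompact_closedBall _ _).prod hfin))).inter_right ?_
    simp only [ofPred_forall]
    exact isClosed_iInter fun m => isClosed_iInter fun n =>
      isClosed_le continuous_const (by fun_prop)
  · intro k
    refine ⟨⟨rfl, mem_closedBall_zero_iff.2 (lp.norm_apply_le_norm (by simp) (centralB q τ) k),
      mem_closedBall_zero_iff.2 ?_, ?_⟩, fun m n => ?_⟩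
    · exact (norm_negConjPow k (q k)).le.trans (lp.norm_apply_le_norm (by simp) q k)
    · change negConjPow k τ ∈ _
      unfold negConjPow
      split_ifs <;> simp
    · change ϱ ≤ ‖negConjPow k (q k) - (m + n * negConjPow k τ)‖
      unfold negConjPow
      split_ifs
      · exact hsep k _ (mem_latticeOf.2 ⟨m, n, rfl⟩)
      -- -conj maps -m + nτ to m + n(-conj τ), whence the sign of m.
      · have h1 := hsep k _ (mem_latticeOf.2 ⟨-m, n, rfl⟩)
        push_cast at h1
        rw [← neg_conj_lattice, ← neg_sub_neg, ← neg_sub, neg_neg, neg_neg, ← map_sub, norm_neg,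
          norm_conj]
        exact h1
  · rintro ⟨a, b, v, τ'⟩ ⟨⟨ha, -, -, hτ'⟩, hv⟩
    refine ⟨ha, fun hmem => ?_, ?_⟩
    · obtain ⟨m, n, h⟩ := mem_latticeOf.1 hmem
      have h1 := hv m n
      have h2 : v - (m + n * τ') = 0 := sub_eq_zero.2 h
      simp only [h2, norm_zero] at h1
      linarith
    · rcases hτ' with h | h
      · have h : τ' = τ := h
        simp [TorusParams.tau, h]
      · have h : τ' = -(starRingEnd ℂ) τ := h
        simp [TorusParams.tau, h]

theorem continuousAt_psiInv {q : TorusParams} (hq : q.tau.im ≠ 0) :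
    ContinuousAt (fun q : TorusParams => psiInv q.tau q.v) q := by
  have h1 : Continuous fun q : TorusParams => q.v.im := by fun_prop
  have h2 : Continuous fun q : TorusParams => q.tau.im := by fun_prop
  have h3 : Continuous fun q : TorusParams => q.v.re := by fun_prop
  have h4 : Continuous fun q : TorusParams => q.tau.re := by fun_prop
  have hy : ContinuousAt (fun q : TorusParams => coordY q.v q.tau) q :=
    h1.continuousAt.div h2.continuousAt hq
  have hx : ContinuousAt (fun q : TorusParams => coordX q.v q.tau) q :=
    h3.continuousAt.sub (hy.mul h4.continuousAt)
  exact (continuous_ofReal.continuousAt.comp hx).add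
    (continuousAt_const.mul (continuous_ofReal.continuousAt.comp hy))

theorem exists_psiInv_close {Q : Set TorusParams} (hQ : IsCompact Q)
    (h : ∀ q ∈ Q, q.tau.im ≠ 0) {e : ℝ} (he : 0 < e) :
    ∃ δ > 0, ∀ q ∈ Q, ∀ q', dist q' q < δ →
      ‖psiInv q'.tau q'.v - psiInv q.tau q.v‖ ≤ e := by
  have h1 := hQ.uniformContinuousAt_of_continuousAt (fun q : TorusParams => psiInv q.tau q.v)
    (fun q hq => continuousAt_psiInv (h q hq)) (dist_mem_uniformity he)
  obtain ⟨δ, hδ, h2⟩ := Metric.mem_uniformity_dist.1 h1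
  refine ⟨δ, hδ, fun q hq q' hd => ?_⟩
  rw [← dist_eq_norm, dist_comm]
  exact (h2 (by rwa [dist_comm]) hq).le

theorem Params.dist_pt_le (x x' : Params) (k : ℤ) : dist (x.pt k) (x'.pt k) ≤ dist x x' := by
  rw [dist_eq_norm, dist_eq_norm]
  exact (x - x').norm_pt_le k

/-! ### The family of 1-forms -/

theorem NeckSolution.coeffX_add {x : Params} {t ρ r₁ r₂ r₃ : ℝ} {U : ℤ → Bool → ℂ → ℂ}
    (h : NeckSolution x t ρ r₁ r₂ r₃ U) (k : ℤ) {u z : ℂ} (hu : u ∈ latticeOf (x.tau k))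
    (hz : z ∈ outer (x.pt k) r₁) :
    coeffX x t ρ r₁ r₂ r₃ U k (z + u) = coeffX x t ρ r₁ r₂ r₃ U k z :=
  (h.neckData k).coeffT_add hu (Or.inl hz)

theorem NeckSolution.coeffX_psi_congr {x : Params} {t ρ r₁ r₂ r₃ : ℝ} {U : ℤ → Bool → ℂ → ℂ}
    (h : NeckSolution x t ρ r₁ r₂ r₃ U) (k : ℤ) {z z' : ℂ} (hzz' : toTorus I z' = toTorus I z)
    (hz : psi (x.tau k) z ∈ outer (x.pt k) r₁) :
    coeffX x t ρ r₁ r₂ r₃ U k (psi (x.tau k) z') =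
      coeffX x t ρ r₁ r₂ r₃ U k (psi (x.tau k) z) := by
  have hu := psi_mem_latticeOf (τ := x.tau k) (GoodParams.toTorus_eq_iff.1 hzz')
  rw [← h.coeffX_add k hu hz, psi_sub, add_sub_cancel]

/-- The solutions of the neck equation near a reference value of the parameters give a smooth
family of 1-forms on the fixed domain. -/
theorem exists_smooth_forms {Q : Set TorusParams} (hQ : IsCompact Q) {ρ r₁ ε' M δ : ℝ}
    {x₀ : Params} (hx₀ : ∀ k, x₀.pt k ∈ Q) (hr₁ : 0 < r₁) (hr₁ρ : r₁ < ρ / 2) (hδ : 0 < δ)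
    (hM0 : 0 ≤ M) (hr : M * (2 * r₁) ≤ ε' / 2)
    (hgood : ∀ q ∈ Q, ∀ q', dist q' q < δ → GoodParams q' ρ)
    (hM : ∀ q ∈ Q, ∀ q', dist q' q < δ → ∀ z, ‖psiInv q'.tau z‖ ≤ M * ‖z‖)
    (hd : ∀ q ∈ Q, ∀ q', dist q' q < δ →
      ‖psiInv q'.tau q'.v - psiInv q.tau q.v‖ ≤ ε' / 2) :
    ∃ (η : ℝ × Params → FormSpace x₀ ε') (U : ℝ × Params → ℤ → Bool → ℂ → ℂ)
      (N : Set (ℝ × Params)), IsOpen N ∧ (0, x₀) ∈ N ∧ ContDiffOn ℝ ∞ η N ∧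
      ∀ p ∈ N, |p.1| < r₁ ∧ dist p.2 x₀ < δ ∧
        NeckSolution p.2 p.1 ρ r₁ (ρ / 2) (3 * ρ / 4) (U p) ∧
        (∀ k z, toTorus I z ∈ fixedDomain x₀ ε' k →
          psi (p.2.tau k) z ∈ outer (p.2.pt k) r₁) ∧
        ∀ (k : ℤ) (z : ℂ) (hz : toTorus I z ∈ fixedDomain x₀ ε' k) (X : ℂ),
          η p ⟨k, ⟨toTorus I z, hz⟩⟩ X =
            coeffX p.2 p.1 ρ r₁ (ρ / 2) (3 * ρ / 4) (U p) k (psi (p.2.tau k) z) *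
              psi (p.2.tau k) X := by
  have hρ : 0 < ρ := by linarith
  have hgood₀ : ∀ q ∈ Q, GoodParams q ρ := fun q hq => hgood q hq q (by simpa using hδ)
  obtain ⟨u, N₁, hN₁, hN₁0, hu, huf⟩ := exists_neckSolutions (r₂ := ρ / 2) (r₃ := 3 * ρ / 4) hQ
    hgood₀ hx₀ (by linarith) (by linarith) (by linarith)
  have h0 k : dist (x₀.pt k) (x₀.pt k) < δ := by rwa [dist_self]
  -- The compact set uses radius 2r₁ with a non-strict inequality; it lies in the open condition for
  -- radius r₁.
  have hL : ∀ i : LiftedDomain x₀ ε', (x₀.pt i.1.1, i.1.2) ∈ liftSet Q (2 * r₁) := fun i =>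
    mem_liftSet (hx₀ _) i.2.1.le (psi_mem_outer (x := x₀) (k := i.1.1)
      (hgood₀ (x₀.pt i.1.1) (hx₀ i.1.1)).im_pos
      (hM (x₀.pt i.1.1) (hx₀ i.1.1) (x₀.pt i.1.1) (h0 i.1.1)) hM0
      (hd (x₀.pt i.1.1) (hx₀ i.1.1) (x₀.pt i.1.1) (h0 i.1.1)) hr i.2.2)
  obtain ⟨η, N₂, hN₂, hN₂0, hN₂₁, hη, hηf⟩ := exists_liftedForm (ε' := ε') hQ hgood₀ hx₀ hr₁
    (by linarith) (by linarith) (by linarith) hN₁ hN₁0 hu (isCompact_liftSet hQ (2 * r₁))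
    (fun w hw => ⟨(hgood₀ _ hw.1.1).im_pos, mem_outer_of_mem_liftSet (by linarith) hw⟩) hL
  let N : Set (ℝ × Params) := N₂ ∩ {p | |p.1| < r₁ ∧ dist p.2 x₀ < δ}
  have hNt : IsOpen {p : ℝ × Params | |p.1| < r₁} := isOpen_lt (by fun_prop) continuous_const
  have hNx : IsOpen {p : ℝ × Params | dist p.2 x₀ < δ} := isOpen_lt (by fun_prop) continuous_const
  have hN : IsOpen N := hN₂.inter (hNt.inter hNx)
  have hsol : ∀ p ∈ N, NeckSolution p.2 p.1 ρ r₁ (ρ / 2) (3 * ρ / 4) (circleFun (u p)) := by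
    intro p hp
    refine ⟨fun k => hgood (x₀.pt k) (hx₀ k) (p.2.pt k) ((p.2.dist_pt_le x₀ k).trans_lt hp.2.2), hr₁, hr₁ρ,
      by linarith, by linarith, ?_, fun k σ => continuousOn_circleFun _ _ _,
      huf p (hN₂₁ hp.1)⟩
    -- The condition `sq_lt` follows from t² < r₁² ≤ r₁ ρ/2.
    have h1 : p.1 ^ 2 < r₁ ^ 2 := by
      rw [← sq_abs]
      exact pow_lt_pow_left₀ hp.2.1 (abs_nonneg _) two_ne_zero
    exact h1.trans_le (by rw [sq]; gcongr)
  have hout : ∀ p ∈ N, ∀ k z, toTorus I z ∈ fixedDomain x₀ ε' k →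
      psi (p.2.tau k) z ∈ outer (p.2.pt k) r₁ := by
    intro p hp k z hz
    have hdk := (p.2.dist_pt_le x₀ k).trans_lt hp.2.2
    refine psi_mem_outer ((hsol p hp).good k).im_pos (hM (x₀.pt k) (hx₀ k) (p.2.pt k) hdk) hM0
      (hd (x₀.pt k) (hx₀ k) (p.2.pt k) hdk) ?_ hz
    linarith [mul_nonneg hM0 hr₁.le]
  have hval : ∀ p ∈ N, ∀ (i : LiftedDomain x₀ ε') (X : ℂ), η p i X =
      coeffX p.2 p.1 ρ r₁ (ρ / 2) (3 * ρ / 4) (circleFun (u p)) i.1.1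
        (psi (p.2.tau i.1.1) i.1.2) * psi (p.2.tau i.1.1) X := by
    intro p hp i X
    rw [hηf p hp.1 i X, (hsol p hp).coeffX_outer i.1.1 (hout p hp _ _ i.2.2)]
  have hfib : ∀ p ∈ N, ∀ (i : LiftedDomain x₀ ε') (k : ℤ) (z : ℂ)
      (hz : toTorus I z ∈ fixedDomain x₀ ε' k), liftProj i = ⟨k, ⟨toTorus I z, hz⟩⟩ → ∀ X, η p i X =
        coeffX p.2 p.1 ρ r₁ (ρ / 2) (3 * ρ / 4) (circleFun (u p)) k (psi (p.2.tau k) z) *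
          psi (p.2.tau k) X := by
    rintro p hp ⟨⟨k', z'⟩, h2, hz'⟩ k z hz heq X
    obtain ⟨rfl, h3⟩ := Sigma.mk.inj heq
    have h4 : toTorus I z' = toTorus I z := congrArg Subtype.val (eq_of_heq h3)
    rw [hval p hp, (hsol p hp).coeffX_psi_congr k' h4 (hout p hp k' z hz)]
  obtain ⟨η', hη', hη'f⟩ := exists_contDiffOn_descent hN (hη.mono inter_subset_left)
    fun p hp i j hij => by
      ext X
      rw [hfib p hp i _ _ j.2.2 hij, hval p hp j]
  refine ⟨η', fun p => circleFun (u p), N, hN, ⟨hN₂0, by simpa using hr₁, by simpa using hδ⟩, hη',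
    fun p hp => ⟨hp.2.1, hp.2.2, hsol p hp, hout p hp, fun k z hz X => ?_⟩⟩
  obtain ⟨i, hi⟩ := liftProj_surjective (⟨k, ⟨toTorus I z, hz⟩⟩ : FixedDomain x₀ ε')
  rw [← hi, hη'f p hp, hfib p hp i k z hz hi]

end StackedTori

end

/-! ### Choice of the constants and conclusion -/

theorem mainTheorem4 (τ : ℂ) (hτ : 0 < τ.im) (q : StackedTori.Linf)
    (hq : StackedTori.UniformlySeparated q τ) :
    ∃ ε₀ : ℝ, 0 < ε₀ ∧ ∀ ε : ℝ, 0 < ε → ε < ε₀ →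
    ∃ ε₀' : ℝ, 0 < ε₀' ∧ ∀ ε' : ℝ, 0 < ε' → ε' < ε₀' →
    ∃ N : Set (ℝ × StackedTori.Params), IsOpen N ∧ (0, StackedTori.central q τ) ∈ N ∧
    ∃ η : ℝ × StackedTori.Params → StackedTori.FormSpace (StackedTori.central q τ) ε',
      ContDiffOn ℝ ∞ η N ∧
      ∀ (t : ℝ) (x : StackedTori.Params), (t, x) ∈ N →
        |t| < ε ∧ (∀ k, 0 < (x.tau k).im) ∧
        ∃ c : StackedTori.NodeCoordinates x ε,
          -- the image of `ψ_k` lies in the surface (minus nodes) and contains `Ω_k`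
          (∀ (k : ℤ) (z : ℂ),
            StackedTori.toTorus Complex.I z ∈
                StackedTori.fixedDomain (StackedTori.central q τ) ε' k →
              StackedTori.psi (x.tau k) z ∈ StackedTori.chartDomain c t k) ∧
          (∀ (k : ℤ) (z : ℂ),
            StackedTori.toTorus (x.tau k) (StackedTori.psi (x.tau k) z) ∉
                StackedTori.closedDisks c ε k →
              StackedTori.toTorus Complex.I z ∈
                StackedTori.fixedDomain (StackedTori.central q τ) ε' k) ∧
          ∃ θ : StackedTori.OneForm c t,
            (∀ k : ℤ, θ.ImaginaryPeriod k 1 ∧ θ.ImaginaryPeriod k (x.tau k)) ∧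
            (∀ k : ℤ, θ.integralBoundaryDisk k = 2 * Real.pi * Complex.I) ∧
            (t = 0 → ∀ k : ℤ, ∀ z ∈ StackedTori.chartDomain c t k,
              θ.coeff k z = StackedTori.wZeta z (x.tau k)
                - StackedTori.wZeta (z - x.v k) (x.tau k)
                - StackedTori.wXi (x.v k) (x.tau k)) ∧
            StackedTori.IsPullback (η (t, x)) θ := by
  obtain ⟨Q, hQ, hx₀, hQp⟩ := StackedTori.exists_isCompact_central hq
  obtain ⟨ρ, hρ, δ₁, hδ₁, hgood⟩ := StackedTori.exists_goodParams_of_isCompact hQ fun p hp =>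
    ⟨by rw [(hQp p hp).2.2.1]; exact hτ, (hQp p hp).2.1, (hQp p hp).1⟩
  -- The inverse coordinate exists for |w| < ρ/2, and the disk D(0, 2ε) must fit in it.
  refine ⟨ρ / 4, by positivity, fun ε hε hερ => ?_⟩
  have hε2 : 2 * ε ≤ ρ / 2 := by linarith
  have hM0 : 0 < 2 + ‖τ‖ := by positivity
  -- For |τ_k| ≤ |τ| + 1 the norm of ψ_k is at most 2 + |τ|. The bound gives (2 + |τ|) · 2ε' ≤ ε/3,
  -- as required by `mem_fixedDomain`.
  refine ⟨ε / (6 * (2 + ‖τ‖)), by positivity, fun ε' hε' hεε' => ?_⟩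
  rw [lt_div_iff₀ (by positivity)] at hεε'
  -- A common bound for the inverses of ψ_k when |τ_k| ≤ |τ| + 1 and Im τ_k ≥ Im τ/2.
  set M : ℝ := 1 + (τ.im / 2)⁻¹ * (‖τ‖ + 1) + (τ.im / 2)⁻¹ with hM
  have hMpos : 0 < M := by positivity
  obtain ⟨δ₂, hδ₂, hd⟩ := StackedTori.exists_psiInv_close hQ
    (fun p hp => by rw [(hQp p hp).2.2.1]; exact hτ.ne') (half_pos hε')
  -- The three bounds ensure that the preimages of the disks of radius 2r₁ have radius at most ε'/2,
  -- that r₁ < ρ/2, and that |t| < r₁ implies t²/ε ≤ r₁ < ε.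
  set r₁ : ℝ := min (min (ε' / (4 * M)) (ρ / 4)) (ε / 2) with hr₁
  have hr₁0 : 0 < r₁ := by positivity
  have hr₁M : M * (2 * r₁) ≤ ε' / 2 := by
    have h1 : r₁ ≤ ε' / (4 * M) := (min_le_left _ _).trans (min_le_left _ _)
    rw [le_div_iff₀ (by positivity)] at h1
    linarith
  have hr₁ρ : r₁ < ρ / 2 := by
    have h1 : r₁ ≤ ρ / 4 := (min_le_left _ _).trans (min_le_right _ _)
    linarith
  have hr₁ε : r₁ < ε := (min_le_right _ _).trans_lt (by linarith)
  set δ : ℝ := min (min δ₁ δ₂) (min 1 (τ.im / 2)) with hδ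
  have hδ0 : 0 < δ := by positivity
  have htau : ∀ p ∈ Q, ∀ p' : StackedTori.TorusParams, dist p' p < δ →
      ‖p'.tau‖ ≤ ‖τ‖ + 1 ∧ τ.im / 2 ≤ p'.tau.im := by
    intro p hp p' hd
    have h1 : ‖p'.tau - p.tau‖ < δ := by
      rw [dist_eq_norm] at hd
      exact ((norm_snd_le _).trans ((norm_snd_le _).trans (norm_snd_le (p' - p)))).trans_lt hd
    have h2 : ‖p'.tau - p.tau‖ < 1 := h1.trans_le ((min_le_right _ _).trans (min_le_left _ _))
    have h3 : ‖p'.tau - p.tau‖ < τ.im / 2 :=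
      h1.trans_le ((min_le_right _ _).trans (min_le_right _ _))
    refine ⟨?_, ?_⟩
    · have h4 := norm_sub_norm_le p'.tau p.tau
      rw [(hQp p hp).2.2.2] at h4
      linarith
    · have h4 := (abs_le.1 (Complex.abs_im_le_norm (p'.tau - p.tau))).1
      rw [Complex.sub_im, (hQp p hp).2.2.1] at h4
      linarith
  obtain ⟨η, U, N, hN, hN0, hη, hNη⟩ := StackedTori.exists_smooth_forms (M := M) hQ hx₀ hr₁0 hr₁ρ
    hδ0 hMpos.le hr₁M
    (fun p hp p' h => hgood p hp p' (h.trans_le ((min_le_left _ _).trans (min_le_left _ _))))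
    (fun p hp p' h z => by
      obtain ⟨h1, h2⟩ := htau p hp p' h
      refine (StackedTori.norm_psiInv_le _ z).trans ?_
      rw [abs_of_pos (by linarith : 0 < p'.tau.im), hM]
      have h3 := (Complex.abs_re_le_norm p'.tau).trans h1
      gcongr)
    (fun p hp p' h => hd p hp p' (h.trans_le ((min_le_left _ _).trans (min_le_right _ _))))
  refine ⟨N, hN, hN0, η, hη, fun t x hp => ?_⟩
  obtain ⟨ht, hx, hsol, hout, hval⟩ := hNη _ hp
  have hdk k := (x.dist_pt_le (StackedTori.central q τ) k).trans_lt hx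
  have ht2 : t ^ 2 ≤ r₁ * r₁ := by
    rw [← sq_abs, sq]
    exact mul_le_mul ht.le ht.le (abs_nonneg _) hr₁0.le
  have htr : t ^ 2 / ε ≤ r₁ := by
    rw [div_le_iff₀ hε]
    exact ht2.trans (mul_le_mul_of_nonneg_left hr₁ε.le hr₁0.le)
  have htε : t ^ 2 / ε ≤ ε := htr.trans hr₁ε.le
  have hε₂ : ε < ρ / 2 := by linarith
  refine ⟨ht.trans hr₁ε, fun k => (hsol.good k).im_pos,
    StackedTori.nodeCoordinates hsol.good hε2, fun k z hz =>
      StackedTori.mem_chartDomain_of_mem_outer htr hr₁ρ (hout k z hz), fun k z hz => ?_,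
    hsol.oneForm hε2 hε hε₂ htε, fun k =>
      ⟨hsol.oneForm_imaginaryPeriod hε2 hε hε₂ htε k (Or.inl rfl),
        hsol.oneForm_imaginaryPeriod hε2 hε hε₂ htε k (Or.inr rfl)⟩,
    hsol.oneForm_integralBoundaryDisk hε2 hε hε₂ htε, ?_, hval⟩
  · refine StackedTori.mem_fixedDomain hε (M := 2 + ‖τ‖) (fun z => ?_) hM0.le ?_ (by linarith) hz
    · refine (StackedTori.norm_psi_le _ z).trans ?_
      have h1 : ‖x.tau k‖ ≤ ‖τ‖ + 1 := (htau _ (hx₀ k) _ (hdk k)).1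
      exact mul_le_mul_of_nonneg_right (by linarith) (norm_nonneg z)
    · have h1 := hd _ (hx₀ k) (x.pt k)
        ((hdk k).trans_le ((min_le_left _ _).trans (min_le_right _ _)))
      exact h1.trans (by linarith)
  · rintro rfl k z hz
    exact hsol.coeffX_zero k (hsol.chartDomain_subset hε2 hε hε₂ htε k hz)
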